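/- Let $d\ge 1$. A configuration is a locally finite subset $\omega\subset\mathbb R^d$; the space $\Omega$ of configurations carries the $\sigma$-algebra generated by the counts $N_\Lambda(\omega)=\#(\omega\cap\Lambda)$, and $\Omega_f\subset\Omega$ is the set of finite configurations. Throughout, $\Lambda,\Lambda',\dots$ are bounded Borel sets, $\omega_\Lambda=\omega\cap\Lambda$, $\Lambda_n=[-n,n]^d$, $|\cdot|$ is Lebesgue measure, and $\pi_\Lambda$ is the law of the Poisson point process on $\Lambda$ with Lebesgue intensity. Let $\mathcal P$ be the set of stationary (translation invariant) probability measures $P$ on $\Omega$ with $E_P(N_{[0,1]^d})<\infty$, and write $P_\Lambda$ for the law of $\omega_\Lambda$ under $P$. Let $H:\Omega_f\to\mathbb R\cup\{+\infty\}$ be measurable and (i) stationary: $H(\omega+u)=H(\omega)$ for all $\omega\in\Omega_f$, $u\in\mathbb R^d$; (ii) hereditary: $H(\omega)=+\infty$ implies $H(\omega\cup\{x\})=+\infty$ for all $x\in\mathbb R^d$; (iii) non-degenerate: $H(\{0\})\ne+\infty$ and $H(\emptyset)=0$; (iv) stable: there is $A>0$ with $H(\omega)\ge -A\,\#\omega$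 for all $\omega\in\Omega_f$; (v) of finite range: there is $R\ge 0$ such that, for every $\Lambda$ and every $\omega\in\Omega$ with $\omega_{\Lambda^c}\in\Omega_\infty$, the quantity $$H_\Lambda(\omega)=H(\omega_{\Lambda'})-H(\omega_{\Lambda'\setminus\Lambda})\qquad(\infty-\infty:=0)$$ is the same for all $\Lambda'\supset\Lambda+B(0,R)$, where $B(0,R)$ is the closed ball and $\Omega_\infty$ is the set of $\omega\in\Omega$ with $H(\omega_\Lambda)<\infty$ for every $\Lambda$. Put $Z_\Lambda(\omega_{\Lambda^c})=\int e^{-H_\Lambda(\omega'_\Lambda\cup\omega_{\Lambda^c})}\,\pi_\Lambda(d\omega')$ and $f_\Lambda(\omega)=e^{-H_\Lambda(\omega)}/Z_\Lambda(\omega_{\Lambda^c})$. A probability measure $P$ on $\Omega$ is a Gibbs measure for $H$ if $P(\Omega_\infty)=1$ and, for every $\Lambda$ and every bounded measurable $g:\Omega\to\mathbb R$, $$\int g\,dP=\int\!\!\int g(\omega'_\Lambda\cup\omega_{\Lambda^c})\,f_\Lambda(\omega'_\Lambda\cup\omega_{\Lambda^c})\,\pi_\Lambda(d\omega')\,P(d\omega).$$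 Assume that for every $P\in\mathcal P$ the mean energy $$H(P)=\lim_{n\to\infty}\frac1{|\Lambda_n|}\int H(\omega_{\Lambda_n})\,P(d\omega)\in\mathbb R\cup\{+\infty\}$$ exists, and that for every Gibbs measure $P\in\mathcal P$ $$\lim_{n\to\infty}\frac1{|\Lambda_n|}\int\bigl(H_{\Lambda_n}(\omega)-H(\omega_{\Lambda_n})\bigr)\,P(d\omega)=0$$ (the integrals being defined and finite for all large $n$). Then the pressure $p_H=\lim_{n\to\infty}|\Lambda_n|^{-1}\ln Z_{\Lambda_n}(\emptyset)$ exists in $\mathbb R$; for every $P\in\mathcal P$ the specific entropy $I(P)=\lim_{n\to\infty}|\Lambda_n|^{-1}I(P_{\Lambda_n},\pi_{\Lambda_n})\in[0,+\infty]$ exists, where $I(\mu,\nu)=\int\ln\frac{d\mu}{d\nu}\,d\mu$ if $\mu\ll\nu$ and $I(\mu,\nu)=+\infty$ otherwise; and $$I(P)+H(P)\ge -p_H,$$ with equality if and only if $P$ is a Gibbs measure for $H$. -/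

import Mathlib

open MeasureTheory Filter Topology
open scoped ENNReal Pointwise

noncomputable section

namespace GibbsPP

/-- The Euclidean space `ℝ^d`. -/
abbrev Space (d : ℕ) := EuclideanSpace ℝ (Fin d)

/-- The bounded Borel subsets of `ℝ^d`. -/
abbrev Window (d : ℕ) := {Λ : Set (Space d) // MeasurableSet Λ ∧ Bornology.IsBounded Λ}

/-- The window `Λ' \ Λ`. -/
def Window.diff {d : ℕ} (Λ' Λ : Window d) : Window d :=
  ⟨Λ'.1 \ Λ.1, Λ'.2.1.diff Λ.2.1, Λ'.2.2.subset Set.sdiff_subset⟩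

/-- The closed `R`-neighbourhood of a window; for `0 ≤ R` it contains `Λ + B(0, R)`. -/
def Window.thicken {d : ℕ} (R : ℝ) (Λ : Window d) : Window d :=
  ⟨Metric.cthickening R Λ.1, Metric.isClosed_cthickening.measurableSet, Λ.2.2.cthickening⟩

/-- The cube `Λ_n = [-n, n]^d`. -/
def cube (d n : ℕ) : Window d :=
  ⟨{x | ∀ i, x i ∈ Set.Icc (-(n : ℝ)) n}, by
    constructor
    · simp only [Set.ofPred_forall]
      exact MeasurableSet.iInter fun i =>
        measurableSet_Icc.preimage (EuclideanSpace.proj (𝕜 := ℝ) i).continuous.measurable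
    · have h : {x : Space d | ∀ i, x i ∈ Set.Icc (-(n : ℝ)) n} =
          WithLp.ofLp ⁻¹' (Set.univ.pi fun _ => Set.Icc (-(n : ℝ)) n) := by
        ext x; simp [Pi.le_def, forall_and]
      rw [h]
      exact (PiLp.antilipschitzWith_ofLp 2 (fun _ : Fin d => ℝ)).isBounded_preimage
        (Bornology.IsBounded.pi fun _ => Metric.isBounded_Icc _ _)⟩

/-- The unit cube `[0, 1]^d`. -/
def unitCube (d : ℕ) : Set (Space d) := {x | ∀ i, x i ∈ Set.Icc (0 : ℝ) 1}

/-- Lebesgue measure of a window, as a real number. -/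
def vol {d : ℕ} (Λ : Window d) : ℝ := (volume Λ.1).toReal

/-- Configurations: locally finite subsets of `ℝ^d`. -/
abbrev Config (d : ℕ) :=
  {ω : Set (Space d) // ∀ Λ : Set (Space d), Bornology.IsBounded Λ → (ω ∩ Λ).Finite}

/-- The number of points `N_Λ(ω)` of `ω` in `Λ`. -/
def count {d : ℕ} (Λ : Set (Space d)) (ω : Config d) : ℕ := (ω.1 ∩ Λ).ncard

/-- The `σ`-algebra generated by the counting variables of bounded Borel sets. -/
instance instMeasurableSpaceConfig (d : ℕ) : MeasurableSpace (Config d) :=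
  ⨆ Λ : Window d, MeasurableSpace.comap (count Λ.1) ⊤

/-- Finite configurations, with the trace `σ`-algebra. -/
abbrev FinConfig (d : ℕ) := {ω : Config d // ω.1.Finite}

/-- A finite set as a finite configuration. -/
def ofFinite {d : ℕ} (s : Set (Space d)) (hs : s.Finite) : FinConfig d :=
  ⟨⟨s, fun _ _ => hs.inter_of_left _⟩, hs⟩

/-- `ω ∪ x`. -/
def FinConfig.insert {d : ℕ} (x : Space d) (ω : FinConfig d) : FinConfig d :=
  ofFinite (Insert.insert x ω.1.1) (ω.2.insert x)

/-- The configuration `ω ∩ S`. -/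
def restrict {d : ℕ} (S : Set (Space d)) (ω : Config d) : Config d :=
  ⟨ω.1 ∩ S, fun Λ hΛ => (ω.2 Λ hΛ).subset fun _ hx => ⟨hx.1.1, hx.2⟩⟩

/-- `ω_Λ = ω ∩ Λ`, as a finite configuration. -/
def finRestrict {d : ℕ} (Λ : Window d) (ω : Config d) : FinConfig d :=
  ⟨restrict Λ.1 ω, ω.2 Λ.1 Λ.2.2⟩

/-- `ω'_Λ ∪ ω_{Λᶜ}`. -/
def glue {d : ℕ} (Λ : Window d) (ω' ω : Config d) : Config d :=
  ⟨(ω'.1 ∩ Λ.1) ∪ (ω.1 ∩ Λ.1ᶜ), fun B hB => by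
    rw [Set.union_inter_distrib_right]
    exact ((restrict Λ.1 ω').2 B hB).union ((restrict Λ.1ᶜ ω).2 B hB)⟩

/-- Translation of a configuration by `u`. -/
def shift {d : ℕ} (u : Space d) (ω : Config d) : Config d :=
  ⟨(fun x => x + u) '' ω.1, fun B hB => by
    have h : (fun x => x + u) '' ω.1 ∩ B ⊆
        (fun x => x + u) '' (ω.1 ∩ (fun x => x + -u) '' B) := by
      rintro _ ⟨⟨x, hx, rfl⟩, hB⟩
      exact ⟨x, ⟨hx, x + u, hB, by simp⟩, rfl⟩
    refine ((ω.2 _ ?_).image _).subset h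
    have h2 : LipschitzWith 1 (fun x : Space d => x + -u) :=
      (isometry_add_right (-u)).lipschitz
    exact h2.isBounded_image hB⟩

/-- Translation of a finite configuration. -/
def FinConfig.shift {d : ℕ} (u : Space d) (ω : FinConfig d) : FinConfig d :=
  ⟨GibbsPP.shift u ω.1, ω.2.image _⟩

/-- The configuration consisting of the entries of a tuple. -/
def ofTuple {d k : ℕ} (x : Fin k → Space d) : Config d :=
  (ofFinite (Set.range x) (Set.finite_range x)).1

/-- The Poisson point process on `Λ` with Lebesgue intensity: the number of points is Poisson
with parameter `|Λ|` and, given that it is `k`, the points are `k` independent uniform points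
of `Λ`. Here `e^{-|Λ|} |Λ|^k / k!` times the `k`-th power of the uniform law is written as
`e^{-|Λ|} / k!` times the `k`-th power of Lebesgue measure on `Λ`. -/
def poisson {d : ℕ} (Λ : Window d) : Measure (Config d) :=
  Measure.sum fun k : ℕ =>
    (ENNReal.ofReal (Real.exp (-vol Λ)) / (k.factorial : ℝ≥0∞)) •
      (Measure.pi fun _ : Fin k => (volume : Measure (Space d)).restrict Λ.1).map ofTuple

/-- The stationary probability measures on configurations with finite intensity. -/
structure IsStationaryFI {d : ℕ} (P : Measure (Config d)) : Prop where
  prob : IsProbabilityMeasure P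
  stationary : ∀ u : Space d, P.map (shift u) = P
  intensity : ∫⁻ ω, (count (unitCube d) ω : ℝ≥0∞) ∂P < ⊤

/-- Energy functions; the value `⊥ = -∞` is excluded separately. -/
abbrev Energy (d : ℕ) := FinConfig d → EReal

/-- Invariance under translations. -/
def IsStationaryEnergy {d : ℕ} (H : Energy d) : Prop :=
  ∀ (ω : FinConfig d) (u : Space d), H ω = H (ω.shift u)

/-- Adding a point to a configuration of infinite energy gives infinite energy. -/
def IsHereditary {d : ℕ} (H : Energy d) : Prop :=
  ∀ (x : Space d) (ω : FinConfig d), H ω = ⊤ → H (ω.insert x) = ⊤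

/-- `H({0}) ≠ ∞` and `H(∅) = 0`. -/
def IsNonDegenerate {d : ℕ} (H : Energy d) : Prop :=
  H (ofFinite {0} (Set.finite_singleton 0)) ≠ ⊤ ∧ H (ofFinite ∅ Set.finite_empty) = 0

/-- `H(ω) ≥ -A N(ω)` for some `A > 0`. -/
def IsStable {d : ℕ} (H : Energy d) : Prop :=
  ∃ A : ℝ, 0 < A ∧ ∀ ω : FinConfig d, ((-(A * (ω.1.1.ncard : ℝ)) : ℝ) : EReal) ≤ H ω

/-- Subtraction on `ℝ ∪ {+∞}` with the convention `∞ - ∞ = 0`. -/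
def esub (a b : EReal) : EReal :=
  open Classical in if a = ⊤ ∧ b = ⊤ then 0 else a - b

/-- `H(ω_{Λ'}) - H(ω_{Λ' \ Λ})`. -/
def energyDiff {d : ℕ} (H : Energy d) (Λ Λ' : Window d) (ω : Config d) : EReal :=
  esub (H (finRestrict Λ' ω)) (H (finRestrict (Λ'.diff Λ) ω))

/-- The set `Ω_∞` of configurations with finite energy in every window. -/
def finiteEnergy {d : ℕ} (H : Energy d) : Set (Config d) :=
  {ω | ∀ Λ : Window d, H (finRestrict Λ ω) < ⊤}

/-- `H` has range `R`: `H(ω_{Λ'}) - H(ω_{Λ' \ Λ})` is the same for all `Λ'` containing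
`Λ + B(0, R)`. This is asked for all configurations whose part outside `Λ` has locally finite
energy. (Without that restriction the condition, together with stationarity, would rule out
the value `+∞`, because `∞ - ∞ = 0`.) -/
def HasRange {d : ℕ} (H : Energy d) (R : ℝ) : Prop :=
  ∀ (ω : Config d) (Λ Λ' Λ'' : Window d), restrict Λ.1ᶜ ω ∈ finiteEnergy H →
    Λ.1 + Metric.closedBall 0 R ⊆ Λ'.1 → Λ.1 + Metric.closedBall 0 R ⊆ Λ''.1 →
      energyDiff H Λ Λ' ω = energyDiff H Λ Λ'' ω

/-- The local energy `H_Λ(ω)` of an energy of range `R`. -/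
def localEnergy {d : ℕ} (H : Energy d) (R : ℝ) (Λ : Window d) (ω : Config d) : EReal :=
  energyDiff H Λ (Λ.thicken R) ω

/-- The partition function `Z_Λ(ω_{Λᶜ})`. -/
def partitionFn {d : ℕ} (H : Energy d) (R : ℝ) (Λ : Window d) (ω : Config d) : ℝ≥0∞ :=
  ∫⁻ ω', EReal.exp (-localEnergy H R Λ (glue Λ ω' ω)) ∂(poisson Λ)

/-- The local density `f_Λ(ω) = exp(-H_Λ(ω)) / Z_Λ(ω_{Λᶜ})`. -/
def localDensity {d : ℕ} (H : Energy d) (R : ℝ) (Λ : Window d) (ω : Config d) : ℝ≥0∞ :=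
  EReal.exp (-localEnergy H R Λ ω) / partitionFn H R Λ ω

/-- Gibbs measures: `P(Ω_∞) = 1` and the DLR equations hold in every window. -/
structure IsGibbs {d : ℕ} (H : Energy d) (R : ℝ) (P : Measure (Config d)) : Prop where
  prob : IsProbabilityMeasure P
  finite : ∀ᵐ ω ∂P, ω ∈ finiteEnergy H
  dlr : ∀ (Λ : Window d) (g : Config d → ℝ), Measurable g → (∃ C, ∀ ω, |g ω| ≤ C) →
    ∫ ω, g ω ∂P =
      ∫ ω, ∫ ω', g (glue Λ ω' ω) * (localDensity H R Λ (glue Λ ω' ω)).toReal ∂(poisson Λ) ∂P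

/-- Integral of an extended-real function: integral of the positive part minus integral of the
negative part. If both are infinite the value is `⊤ - ⊤ = ⊥`. -/
def eintegral {d : ℕ} (P : Measure (Config d)) (f : Config d → EReal) : EReal :=
  ((∫⁻ ω, (f ω).toENNReal ∂P : ℝ≥0∞) : EReal) - ((∫⁻ ω, (-f ω).toENNReal ∂P : ℝ≥0∞) : EReal)

/-- The specific entropy of `P` (limit of relative entropies per volume along the cubes)
exists and equals `I`. -/
def HasSpecificEntropy {d : ℕ} (P : Measure (Config d)) (I : EReal) : Prop :=
  Tendsto (fun n : ℕ =>
    ((InformationTheory.klDiv (P.map (restrict (cube d n).1)) (poisson (cube d n)) : ℝ≥0∞)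
      : EReal) / (vol (cube d n) : EReal)) atTop (𝓝 I)

/-- The pressure exists and equals `p`; the boundary condition is empty. -/
def HasPressure {d : ℕ} (H : Energy d) (R : ℝ) (p : ℝ) : Prop :=
  Tendsto (fun n : ℕ =>
    ENNReal.log (partitionFn H R (cube d n) (ofFinite ∅ Set.finite_empty).1) /
      (vol (cube d n) : EReal)) atTop (𝓝 (p : EReal))

/-- The mean energy of `P` exists and equals `h`. -/
def HasMeanEnergy {d : ℕ} (H : Energy d) (P : Measure (Config d)) (h : EReal) : Prop :=
  Tendsto (fun n : ℕ =>
    eintegral P (fun ω => H (finRestrict (cube d n) ω)) / (vol (cube d n) : EReal))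
      atTop (𝓝 h)

/-- The boundary term `∂H_Λ(ω) = H_Λ(ω) - H(ω_Λ)`. -/
def boundaryEnergy {d : ℕ} (H : Energy d) (R : ℝ) (Λ : Window d) (ω : Config d) : EReal :=
  esub (localEnergy H R Λ ω) (H (finRestrict Λ ω))

/-- The expected boundary term per volume vanishes in the limit. Since the limit is finite, this
includes that the boundary terms are `P`-integrable for all large `n`. -/
def HasNegligibleBoundary {d : ℕ} (H : Energy d) (R : ℝ) (P : Measure (Config d)) : Prop :=
  Tendsto (fun n : ℕ =>
    eintegral P (boundaryEnergy H R (cube d n)) / (vol (cube d n) : EReal)) atTop (𝓝 0)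

end GibbsPP

end

open GibbsPP

noncomputable section

namespace GibbsPP

section Configurations

variable {d : ℕ}

/-! ### Measurability on the space of configurations -/

/-! The engine is the Donsker–Varadhan formula: I(μ,ν) is the supremum of ∫ log W dμ − log ∫ W dν
over weights W. One half is `integral_log_le_klDiv_add_log`; the other, with bounded log W, is
`exists_bounded_of_lt_klDiv`.

Both limits exist by superadditivity over arrays of disjoint translated cubes
(`exists_tendsto_of_block_le`). For the pressure, `freeZ` is e^{|Λ|} Z_Λ(∅). Configurations that
leave empty corridors wider than R between blocks have factorizing Boltzmann weights, so `freeZ` is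
supermultiplicative, while stability bounds it exponentially. The factor e^{|Λ|} makes discarding
configurations free of cost, and p = L − 1 for the limit L of log `freeZ` per volume. For the
entropy, a nearly optimal test function on one cube is summed over its translates; independence of
the Poisson process in disjoint windows factorizes the exponential moment (`block_mul_klDiv_le`).

The inequality is Donsker–Varadhan with W = e^{-H}: in each cube, −log Z is at most relative entropy
plus expected energy.

Equality implies Gibbs: take W = e^{-H} ∏ u, with translated copies of a local function u whose
conditional Gibbs mean in a window Λ is one. Averaging over one block at a time shows that ∫ W dπ is
still Z (`lintegral_prod_mul_boltz`). Hence entropy + energy + log Z is at least the number of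
blocks times ∫ log u dP, and if this excess is negligible per volume, ∫ log u dP ≤ 0. For u = 1 +
t(1_A − κ(A)), with κ the Gibbs kernel in Λ, letting t → 0 gives P(A) ≤ ∫ κ(A) dP. The same for the
complement of A gives the DLR equation.

Gibbs implies equality: for bounded F and c = log ∫ e^F dπ_Λ, the DLR equation shows that Y =
e^{F(ω_Λ) − c} / f_Λ has P-mean at most one. Integrating 1 + log Y ≤ Y bounds ∫ F dP_Λ − c by −∫
(H_Λ + log Z_Λ(ω)) dP. Configurations confined to an inner cube B do not see the boundary condition,
so Z_Λ(ω) ≥ e^{-|Λ|} `freeZ` B uniformly in ω (`freeZ_le_partitionFn`). The supremum over F bounds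
the entropy (`klDiv_add_energy_le`); the boundary energy is negligible by hypothesis and B fills
almost all of Λ. -/

theorem measurable_count (Λ : Window d) : Measurable (count Λ.1) := by
  intro s hs
  exact le_iSup (fun Λ : Window d => MeasurableSpace.comap (count Λ.1) ⊤) Λ _ ⟨s, trivial, rfl⟩

theorem measurable_of_count {α : Type*} [MeasurableSpace α] {f : α → Config d}
    (h : ∀ Λ : Window d, Measurable fun a => count Λ.1 (f a)) : Measurable f := by
  rw [measurable_iff_le_map]
  refine iSup_le fun Λ => ?_
  rintro _ ⟨s, -, rfl⟩
  exact h Λ (show MeasurableSet s from trivial)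

theorem Config.ext {ω ω' : Config d} (h : ∀ x, x ∈ ω.1 ↔ x ∈ ω'.1) : ω = ω' :=
  Subtype.ext (Set.ext h)

theorem finite_inter_window (ω : Config d) (Λ : Window d) : (ω.1 ∩ Λ.1).Finite := ω.2 _ Λ.2.2

/-- The window `Λ ∩ S` for a Borel set `S`. -/
def Window.inter (Λ : Window d) (S : Set (Space d)) (hS : MeasurableSet S) : Window d :=
  ⟨Λ.1 ∩ S, Λ.2.1.inter hS, Λ.2.2.subset Set.inter_subset_left⟩

theorem measurable_restrict {S : Set (Space d)} (hS : MeasurableSet S) :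
    Measurable (restrict S) := by
  refine measurable_of_count fun Λ => ?_
  have : (fun ω : Config d => count Λ.1 (restrict S ω)) = count (Λ.inter S hS).1 := by
    funext ω
    simp only [count, restrict, Window.inter]
    congr 1
    ext x
    simp only [Set.mem_inter_iff]
    tauto
  rw [this]
  exact measurable_count _

theorem measurable_finRestrict (Λ : Window d) : Measurable (finRestrict Λ) :=
  (measurable_restrict Λ.2.1).subtype_mk

theorem count_glue (Λ B : Window d) (ω' ω : Config d) :
    count B.1 (glue Λ ω' ω) =
      count (B.inter Λ.1 Λ.2.1).1 ω' + count (B.inter Λ.1ᶜ Λ.2.1.compl).1 ω := by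
  simp only [count, glue, Window.inter]
  rw [← Set.ncard_union_eq _ ((ω'.2 _ B.2.2).subset ?_) ((ω.2 _ B.2.2).subset ?_)]
  · congr 1
    ext x
    simp only [Set.mem_inter_iff, Set.mem_union]
    tauto
  · rw [Set.disjoint_left]
    rintro x ⟨-, -, hx⟩ ⟨-, -, hx'⟩
    exact hx' hx
  · exact fun x hx => ⟨hx.1, hx.2.1⟩
  · exact fun x hx => ⟨hx.1, hx.2.1⟩

theorem measurable_glue (Λ : Window d) :
    Measurable fun z : Config d × Config d => glue Λ z.1 z.2 := by
  refine measurable_of_count fun B => ?_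
  simp only [count_glue]
  exact ((measurable_count _).comp measurable_fst).add ((measurable_count _).comp measurable_snd)

theorem measurable_glue_left (Λ : Window d) (ω : Config d) :
    Measurable fun ω' : Config d => glue Λ ω' ω :=
  (measurable_glue Λ).comp (measurable_id.prodMk measurable_const)

/-- The translate `Λ + u` of a window. -/
def Window.translate (u : Space d) (Λ : Window d) : Window d :=
  ⟨(fun x => x + -u) ⁻¹' Λ.1, Λ.2.1.preimage (measurable_add_const _), by
    have h := (isometry_add_right u).lipschitz.isBounded_image Λ.2.2
    refine h.subset fun x hx => ⟨x + -u, hx, by simp⟩⟩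

theorem mem_translate {u x : Space d} {Λ : Window d} :
    x ∈ (Λ.translate u).1 ↔ x + -u ∈ Λ.1 := Iff.rfl

theorem mem_shift {u x : Space d} {ω : Config d} : x ∈ (shift u ω).1 ↔ x + -u ∈ ω.1 := by
  simp only [shift, Set.mem_image]
  constructor
  · rintro ⟨y, hy, rfl⟩
    simpa using hy
  · intro h
    exact ⟨_, h, by simp⟩

theorem count_shift (u : Space d) (B : Set (Space d)) (ω : Config d) :
    count ((fun x => x + -u) ⁻¹' B) (shift u ω) = count B ω := by
  have : (shift u ω).1 ∩ ((fun x => x + -u) ⁻¹' B) = (fun x => x + u) '' (ω.1 ∩ B) := by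
    ext x
    simp only [Set.mem_inter_iff, mem_shift, Set.mem_preimage, Set.mem_image]
    constructor
    · intro h
      exact ⟨_, h, by simp⟩
    · rintro ⟨y, hy, rfl⟩
      simpa using hy
  rw [count, this, Set.ncard_image_of_injective _ (add_left_injective u), count]

theorem measurable_shift (u : Space d) : Measurable (shift u) := by
  refine measurable_of_count fun B => ?_
  have : (fun ω : Config d => count B.1 (shift u ω)) = count (B.translate (-u)).1 := by
    funext ω
    rw [← count_shift u (B.translate (-u)).1 ω]
    congr 1
    ext x
    simp [Window.translate]
  rw [this]
  exact measurable_count _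

theorem shift_neg_shift (u : Space d) (ω : Config d) : shift (-u) (shift u ω) = ω :=
  Config.ext fun x => by simp [mem_shift]

/-- The configuration `ω ∪ {x}`. -/
def ins (x : Space d) (ω : Config d) : Config d :=
  ⟨insert x ω.1, fun B hB => by
    exact ((ω.2 B hB).insert x).subset (by
      rintro y ⟨hy | hy, hy'⟩
      · exact Or.inl hy
      · exact Or.inr ⟨hy, hy'⟩)⟩

/-! ### Joint measurability of adding a point -/

theorem isClosed_config (ω : Config d) : IsClosed ω.1 := by
  refine isClosed_of_closure_subset fun x hx => ?_
  have h1 : x ∈ closure (ω.1 ∩ Metric.closedBall x 1) := by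
    rw [mem_closure_iff_nhds] at hx ⊢
    intro t ht
    obtain ⟨y, hy, hy'⟩ := hx _ (Filter.inter_mem ht (Metric.closedBall_mem_nhds x one_pos))
    exact ⟨y, hy.1, hy', hy.2⟩
  rw [(ω.2 _ Metric.isBounded_closedBall).isClosed.closure_eq] at h1
  exact h1.1

/-- An open ball as a window. -/
def ballWindow (x : Space d) (r : ℝ) : Window d :=
  ⟨Metric.ball x r, measurableSet_ball, Metric.isBounded_ball⟩

/-- The σ-algebra only sees counts. Since a configuration is closed, x belongs to it exactly when
arbitrarily small balls that contain x, with centres in a countable dense set, have nonzero count.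
-/
theorem measurableSet_mem :
    MeasurableSet {z : Space d × Config d | z.1 ∈ z.2.1} := by
  obtain ⟨s, hs, hsd⟩ := TopologicalSpace.exists_countable_dense (Space d)
  have : {z : Space d × Config d | z.1 ∈ z.2.1} =
      ⋂ n : ℕ, ⋃ q ∈ s, {z : Space d × Config d |
        z.1 ∈ Metric.ball q (1 / (n + 1 : ℝ)) ∧
          count (ballWindow q (1 / (n + 1 : ℝ))).1 z.2 ≠ 0} := by
    ext ⟨x, ω⟩
    simp only [Set.mem_ofPred_eq, Set.mem_iInter, Set.mem_iUnion, exists_prop]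
    constructor
    · intro hx n
      have hn : (0 : ℝ) < 1 / (n + 1 : ℝ) := Nat.one_div_pos_of_nat
      obtain ⟨q, hq, hqx⟩ := hsd.exists_dist_lt x hn
      refine ⟨q, hq, hqx, ?_⟩
      rw [count, ne_eq, Set.ncard_eq_zero (finite_inter_window ω _)]
      exact Set.Nonempty.ne_empty ⟨x, hx, hqx⟩
    · intro h
      rw [← (isClosed_config ω).closure_eq, Metric.mem_closure_iff]
      intro ε hε
      obtain ⟨n, hn⟩ := exists_nat_one_div_lt (half_pos hε)
      obtain ⟨q, -, hq, hc⟩ := h n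
      rw [count, ne_eq, Set.ncard_eq_zero (finite_inter_window ω _)] at hc
      obtain ⟨y, hy, hyq⟩ := Set.nonempty_iff_ne_empty.2 hc
      refine ⟨y, hy, ?_⟩
      have h1 : dist x q < 1 / (n + 1 : ℝ) := hq
      have h2 : dist y q < 1 / (n + 1 : ℝ) := hyq
      have h3 := dist_triangle_right x y q
      linarith
  rw [this]
  refine MeasurableSet.iInter fun n => MeasurableSet.biUnion hs fun q _ => ?_
  refine (measurable_fst measurableSet_ball).inter ?_
  exact ((measurable_count _).comp measurable_snd) (show MeasurableSet {k : ℕ | k ≠ 0} from trivial)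

/-- A count grows by one exactly when x lies in the window and is new, so measurability of the
membership relation is needed. -/
theorem measurable_ins : Measurable fun z : Space d × Config d => ins z.1 z.2 := by
  classical
  refine measurable_of_count fun B => ?_
  have : (fun z : Space d × Config d => count B.1 (ins z.1 z.2)) =
      fun z => count B.1 z.2 + if z.1 ∈ B.1 ∧ z.1 ∉ z.2.1 then 1 else 0 := by
    funext ⟨x, ω⟩
    simp only [count, ins]
    split_ifs with h
    · rw [Set.insert_inter_of_mem h.1, Set.ncard_insert_of_notMem (fun h' => h.2 h'.1)
        (finite_inter_window ω B)]
    · rw [add_zero]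
      congr 1
      ext y
      simp only [Set.mem_inter_iff, Set.mem_insert_iff]
      constructor
      · rintro ⟨rfl | hy, hB⟩
        · exact ⟨by_contra fun h' => h ⟨hB, h'⟩, hB⟩
        · exact ⟨hy, hB⟩
      · exact fun hy => ⟨Or.inr hy.1, hy.2⟩
  rw [this]
  refine ((measurable_count _).comp measurable_snd).add (Measurable.ite ?_ measurable_const
    measurable_const)
  exact (measurable_fst B.2.1).inter measurableSet_mem.compl

/-- The empty configuration. -/
abbrev emptyConfig (d : ℕ) : Config d := (ofFinite ∅ Set.finite_empty).1

theorem ofTuple_cons {k : ℕ} (x : Space d) (y : Fin k → Space d) :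
    ofTuple (Fin.cons x y : Fin (k + 1) → Space d) = ins x (ofTuple y) :=
  Config.ext fun z => by simp [ofTuple, ofFinite, ins, Fin.range_cons]

theorem ofTuple_zero (x : Fin 0 → Space d) : ofTuple x = emptyConfig d :=
  Config.ext fun z => by simp [ofTuple, ofFinite, emptyConfig]

theorem measurable_ofTuple {k : ℕ} : Measurable (ofTuple : (Fin k → Space d) → Config d) := by
  induction k with
  | zero =>
    have : (ofTuple : (Fin 0 → Space d) → Config d) = fun _ => emptyConfig d :=
      funext ofTuple_zero
    rw [this]
    exact measurable_const
  | succ k ih =>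
    have : (ofTuple : (Fin (k + 1) → Space d) → Config d) =
        fun x => ins (x 0) (ofTuple (Fin.tail x)) := by
      funext x
      rw [← ofTuple_cons, Fin.cons_self_tail]
    rw [this]
    have h : Measurable fun x : Fin (k + 1) → Space d => (Fin.tail x : Fin k → Space d) :=
      measurable_pi_lambda _ fun i => measurable_pi_apply _
    have h' : Measurable fun x : Fin (k + 1) → Space d => ofTuple (Fin.tail x : Fin k → Space d) :=
      ih.comp h
    have h0 : Measurable fun x : Fin (k + 1) → Space d => x 0 := measurable_pi_apply 0
    exact measurable_ins.comp (h0.prodMk h')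

theorem restrict_restrict_of_subset {S S' : Set (Space d)} (h : S ⊆ S') (ω : Config d) :
    restrict S (restrict S' ω) = restrict S ω :=
  Config.ext fun x => by
    simp only [restrict, Set.mem_inter_iff]
    exact ⟨fun hx => ⟨hx.1.1, hx.2⟩, fun hx => ⟨⟨hx.1, h hx.2⟩, hx.2⟩⟩

theorem glue_glue (Λ : Window d) (ω₁ ω₂ ω₃ : Config d) :
    glue Λ ω₁ (glue Λ ω₂ ω₃) = glue Λ ω₁ ω₃ :=
  Config.ext fun x => by
    simp only [glue, Set.mem_union, Set.mem_inter_iff, Set.mem_compl_iff]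
    tauto

theorem measurable_localEnergy {H : Energy d} (hH : Measurable H) (R : ℝ) (Λ : Window d) :
    Measurable (localEnergy H R Λ) := by
  have h1 : Measurable fun ω => H (finRestrict (Λ.thicken R) ω) :=
    hH.comp (measurable_finRestrict _)
  have h2 : Measurable fun ω => H (finRestrict ((Λ.thicken R).diff Λ) ω) :=
    hH.comp (measurable_finRestrict _)
  unfold localEnergy energyDiff esub
  refine Measurable.ite ?_ measurable_const ?_
  · exact (h1 (measurableSet_singleton _)).inter (h2 (measurableSet_singleton _))
  · simp only [sub_eq_add_neg]
    exact h1.add (continuous_neg.measurable.comp h2)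

theorem measurable_energy {H : Energy d} (hH : Measurable H) (Λ : Window d) :
    Measurable fun ω => H (finRestrict Λ ω) := hH.comp (measurable_finRestrict _)

theorem measurable_expNeg {α : Type*} [MeasurableSpace α] {f : α → EReal} (hf : Measurable f) :
    Measurable fun a => EReal.exp (-f a) :=
  (continuous_neg.measurable.comp hf).ereal_exp

end Configurations

section Poisson

variable {d : ℕ}

/-! ### The Poisson point process -/

/-- The additive monoid of measurable functions on configurations. -/
def MeasFun (d : ℕ) : AddSubmonoid (Config d → ℝ≥0∞) where
  carrier := {F | Measurable F}
  add_mem' h h' := Measurable.add h h'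
  zero_mem' := measurable_const

/-- A measurable function as an element of `MeasFun d`. -/
def toMeasFun (F : Config d → ℝ≥0∞) (hF : Measurable F) : MeasFun d := ⟨F, hF⟩

@[simp]
theorem coe_toMeasFun (F : Config d → ℝ≥0∞) (hF : Measurable F) : (toMeasFun F hF).1 = F := rfl

theorem end_mul_apply (f g : AddMonoid.End (MeasFun d)) (F : MeasFun d) :
    (f * g) F = f (g F) := rfl

theorem end_add_apply (f g : AddMonoid.End (MeasFun d)) (F : MeasFun d) (ω : Config d) :
    ((f + g) F).1 ω = (f F).1 ω + (g F).1 ω := rfl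

/-- Integration over the position in `S` of an additional point. -/
def addPoint (S : Set (Space d)) : AddMonoid.End (MeasFun d) where
  toFun F := ⟨fun ω => ∫⁻ x in S, F.1 (ins x ω),
    Measurable.lintegral_prod_right' (f := fun z : Config d × Space d => F.1 (ins z.2 z.1))
      (F.2.comp (measurable_ins.comp measurable_swap))⟩
  map_zero' := Subtype.ext (funext fun _ => lintegral_zero)
  map_add' F _ := Subtype.ext (funext fun _ =>
    lintegral_add_left (F.2.comp (measurable_ins.comp (measurable_id.prodMk measurable_const))) _)

theorem addPoint_apply (S : Set (Space d)) (F : MeasFun d) (ω : Config d) :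
    (addPoint S F).1 ω = ∫⁻ x in S, F.1 (ins x ω) := rfl

theorem ins_comm (x y : Space d) (ω : Config d) : ins x (ins y ω) = ins y (ins x ω) :=
  Subtype.ext (Set.insert_comm x y ω.1)

theorem addPoint_union {S T : Set (Space d)} (hT : MeasurableSet T) (h : Disjoint S T) :
    addPoint (S ∪ T) = addPoint S + addPoint T := by
  ext F ω
  simp only [addPoint_apply, end_add_apply, Measure.restrict_union h hT, lintegral_add_measure]

/-- Tonelli, since the order in which two points are inserted is irrelevant. -/
theorem commute_addPoint (S T : Set (Space d)) : Commute (addPoint S) (addPoint T) := by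
  ext F ω
  simp only [end_mul_apply, addPoint_apply]
  rw [lintegral_lintegral_swap]
  · simp only [ins_comm]
  · refine (F.2.comp ?_).aemeasurable
    exact measurable_ins.comp (measurable_snd.prodMk
      (measurable_ins.comp (measurable_fst.prodMk measurable_const)))

theorem addPoint_pow_empty (S : Set (Space d)) [IsFiniteMeasure (volume.restrict S)]
    (k : ℕ) (F : MeasFun d) :
    ((addPoint S ^ k) F).1 (emptyConfig d) =
      ∫⁻ x, F.1 (ofTuple x) ∂(Measure.pi fun _ : Fin k => (volume : Measure (Space d)).restrict S)
      := by
  induction k generalizing F with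
  | zero => simp [ofTuple_zero]
  | succ k ih =>
    rw [pow_succ, end_mul_apply, ih]
    have hmp := measurePreserving_piFinSuccAbove
      (fun _ : Fin (k + 1) => (volume : Measure (Space d)).restrict S) 0
    rw [← hmp.symm.lintegral_comp_emb (MeasurableEquiv.measurableEmbedding _), lintegral_prod_symm]
    · refine lintegral_congr fun y => ?_
      rw [addPoint_apply]
      refine lintegral_congr fun x => ?_
      rw [← ofTuple_cons]
      simp [MeasurableEquiv.piFinSuccAbove, Fin.insertNthEquiv]
    · exact ((F.2.comp measurable_ofTuple).comp (MeasurableEquiv.measurable _)).aemeasurable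

instance isFiniteMeasure_restrict_window (Λ : Window d) :
    IsFiniteMeasure ((volume : Measure (Space d)).restrict Λ.1) :=
  ⟨by rw [Measure.restrict_apply_univ]; exact Λ.2.2.measure_lt_top⟩

theorem ofReal_vol (Λ : Window d) : ENNReal.ofReal (vol Λ) = volume Λ.1 :=
  ENNReal.ofReal_toReal Λ.2.2.measure_lt_top.ne

theorem vol_nonneg (Λ : Window d) : 0 ≤ vol Λ := ENNReal.toReal_nonneg

/-- Poisson expectation is e^{-|Λ|} times the exponential series of the operator `addPoint`, applied
to F and evaluated at the empty configuration. Independence and translation covariance thereby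
become identities between commuting operators. -/
theorem lintegral_poisson (Λ : Window d) {F : Config d → ℝ≥0∞} (hF : Measurable F) :
    ∫⁻ ω, F ω ∂(poisson Λ) = ∑' k : ℕ, ENNReal.ofReal (Real.exp (-vol Λ)) /
      (k.factorial : ℝ≥0∞) * ((addPoint Λ.1 ^ k) (toMeasFun F hF)).1 (emptyConfig d) := by
  rw [poisson, lintegral_sum_measure]
  refine tsum_congr fun k => ?_
  rw [lintegral_smul_measure, lintegral_map hF measurable_ofTuple, addPoint_pow_empty,
    smul_eq_mul, coe_toMeasFun]

theorem measurableSet_subset {S : Set (Space d)} (hS : MeasurableSet S) :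
    MeasurableSet {ω : Config d | ω.1 ⊆ S} := by
  have : {ω : Config d | ω.1 ⊆ S} =
      ⋂ n : ℕ, {ω | count ((ballWindow 0 (n : ℝ)).inter Sᶜ hS.compl).1 ω = 0} := by
    ext ω
    simp only [Set.mem_ofPred_eq, Set.mem_iInter]
    constructor
    · intro h n
      rw [count, Set.ncard_eq_zero (finite_inter_window ω _), Set.eq_empty_iff_forall_notMem]
      rintro x ⟨hx, -, hx'⟩
      exact hx' (h hx)
    · intro h x hx
      by_contra hxS
      obtain ⟨n, hn⟩ := exists_nat_gt (dist x 0)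
      have := h n
      rw [count, Set.ncard_eq_zero (finite_inter_window ω _), Set.eq_empty_iff_forall_notMem]
        at this
      exact this x ⟨hx, hn, hxS⟩
  rw [this]
  exact MeasurableSet.iInter fun n => measurable_count _ (measurableSet_singleton 0)

theorem ae_poisson_subset (Λ : Window d) : ∀ᵐ ω ∂(poisson Λ), ω.1 ⊆ Λ.1 := by
  rw [poisson, Measure.ae_sum_iff]
  refine fun k => Measure.ae_smul_measure ?_ _
  rw [ae_map_iff measurable_ofTuple.aemeasurable (measurableSet_subset Λ.2.1),
    ← Measure.restrict_pi_pi]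
  refine (ae_restrict_mem (MeasurableSet.univ_pi fun _ => Λ.2.1)).mono fun x hx => ?_
  rintro _ ⟨i, rfl⟩
  exact hx i trivial

/-- For c = 1 this is the total mass of the Poisson process, for c = e^A an exponential moment of
its number of points. -/
theorem tsum_poisson (v c : ℝ) (hv : 0 ≤ v) (hc : 0 ≤ c) :
    ∑' k : ℕ, ENNReal.ofReal (Real.exp (-v)) / (k.factorial : ℝ≥0∞) *
      (ENNReal.ofReal c ^ k * ENNReal.ofReal v ^ k) = ENNReal.ofReal (Real.exp (v * (c - 1))) := by
  have h1 : ∀ k : ℕ, ENNReal.ofReal (Real.exp (-v)) / (k.factorial : ℝ≥0∞) *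
      (ENNReal.ofReal c ^ k * ENNReal.ofReal v ^ k) =
      ENNReal.ofReal (Real.exp (-v) * ((c * v) ^ k / k.factorial)) := by
    intro k
    rw [← mul_pow, ← ENNReal.ofReal_mul hc, ← ENNReal.ofReal_pow (by positivity),
      ← ENNReal.ofReal_natCast, ← ENNReal.ofReal_div_of_pos (by positivity),
      ← ENNReal.ofReal_mul (by positivity)]
    congr 1
    ring
  have h2 : HasSum (fun k : ℕ => Real.exp (-v) * ((c * v) ^ k / k.factorial))
      (Real.exp (-v) * Real.exp (c * v)) := by
    rw [Real.exp_eq_exp_ℝ]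
    exact (NormedSpace.expSeries_div_hasSum_exp (c * v)).mul_left _
  simp only [h1]
  rw [← ENNReal.ofReal_tsum_of_nonneg (fun k => by positivity) h2.summable, h2.tsum_eq,
    ← Real.exp_add]
  congr 2
  ring

instance isProbabilityMeasure_poisson (Λ : Window d) : IsProbabilityMeasure (poisson Λ) := by
  constructor
  have h := lintegral_poisson Λ (F := fun _ => 1) measurable_const
  simp only [addPoint_pow_empty, coe_toMeasFun, lintegral_one, Measure.pi_univ, Measure.restrict_apply_univ,
    Finset.prod_const, Finset.card_univ, Fintype.card_fin] at h
  have h' := tsum_poisson (vol Λ) 1 (vol_nonneg Λ) zero_le_one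
  simp only [ENNReal.ofReal_one, one_pow, one_mul, ofReal_vol, sub_self, mul_zero,
    Real.exp_zero] at h'
  rw [h, h']

theorem lintegral_exp_count_poisson_le (Λ : Window d) (A : ℝ) :
    ∫⁻ ω, ENNReal.ofReal (Real.exp A) ^ (count Λ.1 ω) ∂(poisson Λ) ≤
      ENNReal.ofReal (Real.exp (vol Λ * (Real.exp (max A 0) - 1))) := by
  have hm : Measurable fun ω : Config d => ENNReal.ofReal (Real.exp A) ^ (count Λ.1 ω) :=
    (measurable_from_top (f := fun k : ℕ => ENNReal.ofReal (Real.exp A) ^ k)).comp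
      (measurable_count Λ)
  rw [lintegral_poisson Λ hm, ← tsum_poisson _ _ (vol_nonneg Λ) (Real.exp_pos _).le]
  refine ENNReal.tsum_le_tsum fun k => mul_le_mul_right ?_ _
  rw [addPoint_pow_empty]
  -- Entries of a tuple may coincide, so the count is only at most k; replacing A by `max A 0` makes
  -- the power increasing in the exponent.
  have h1 : ∀ x : Fin k → Space d, ENNReal.ofReal (Real.exp A) ^ (count Λ.1 (ofTuple x)) ≤
      ENNReal.ofReal (Real.exp (max A 0)) ^ k := by
    intro x
    have hk : count Λ.1 (ofTuple x) ≤ k := by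
      refine (Set.ncard_le_ncard Set.inter_subset_left (Set.finite_range x)).trans ?_
      rw [← Set.image_univ]
      refine (Set.ncard_image_le Set.finite_univ).trans ?_
      simp
    refine (pow_le_pow_left₀ zero_le (ENNReal.ofReal_le_ofReal
      (Real.exp_le_exp.2 (le_max_left A 0))) _).trans (pow_le_pow_right₀ ?_ hk)
    rw [← ENNReal.ofReal_one]
    exact ENNReal.ofReal_le_ofReal (Real.one_le_exp (le_max_right A 0))
  refine (lintegral_mono h1).trans ?_
  simp [Measure.pi_univ, ofReal_vol]

/-- Only the term k = 0 is kept: there is no point with probability e^{-|Λ|}. -/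
theorem poisson_lintegral_ge (Λ : Window d) {F : Config d → ℝ≥0∞} (hF : Measurable F) :
    ENNReal.ofReal (Real.exp (-vol Λ)) * F (emptyConfig d) ≤ ∫⁻ ω, F ω ∂(poisson Λ) := by
  rw [lintegral_poisson Λ hF]
  refine le_trans (le_of_eq ?_) (ENNReal.le_tsum 0)
  simp

/-- Points added in Λ join the inner component of a glued configuration and leave the outer one
alone. -/
theorem addPoint_pow_glue (Λ : Window d) (k : ℕ) (F : MeasFun d) (ω₁ ω₂ : Config d) :
    ((addPoint Λ.1 ^ k) F).1 (glue Λ ω₁ ω₂) =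
      ((addPoint Λ.1 ^ k) (toMeasFun (fun ω => F.1 (glue Λ ω ω₂))
        (F.2.comp (measurable_glue_left Λ ω₂)))).1 ω₁ := by
  induction k generalizing ω₁ with
  | zero => rfl
  | succ k ih =>
    rw [pow_succ', end_mul_apply, end_mul_apply, addPoint_apply,
      addPoint_apply]
    refine setLIntegral_congr_fun Λ.2.1 fun x hx => ?_
    simp only [← ih]
    refine congrArg _ ?_
    refine Config.ext fun y => ?_
    simp only [ins, glue, Set.mem_insert_iff, Set.mem_union, Set.mem_inter_iff, Set.mem_compl_iff]
    constructor
    · rintro (rfl | h)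
      · exact Or.inl ⟨Or.inl rfl, hx⟩
      · tauto
    · tauto

theorem glue_empty_of_subset {Λ : Window d} {ω : Config d} (h : ω.1 ⊆ Λ.1ᶜ) :
    glue Λ (emptyConfig d) ω = ω :=
  Config.ext fun x => by
    simp only [glue, emptyConfig, ofFinite, Set.mem_union, Set.mem_inter_iff,
      Set.mem_empty_iff_false, false_and, false_or, and_iff_left_iff_imp]
    exact fun hx => h hx

theorem vol_add_vol_diff {Λ Λ₁ : Window d} (h : Λ₁.1 ⊆ Λ.1) :
    vol Λ₁ + vol (Λ.diff Λ₁) = vol Λ := by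
  have h1 : volume Λ.1 = volume Λ₁.1 + volume (Λ.diff Λ₁).1 := by
    have : Λ.1 = Λ₁.1 ∪ (Λ.diff Λ₁).1 := (Set.union_sdiff_cancel h).symm
    conv_lhs => rw [this]
    exact measure_union disjoint_sdiff_self_right (Λ.diff Λ₁).2.1
  rw [vol, vol, vol, h1, ENNReal.toReal_add Λ₁.2.2.measure_lt_top.ne
    (Λ.diff Λ₁).2.2.measure_lt_top.ne]

theorem tsum_prod_eq_tsum_sum_antidiagonal (f : ℕ × ℕ → ℝ≥0∞) :
    ∑' p, f p = ∑' k, ∑ m ∈ Finset.HasAntidiagonal.antidiagonal k, f m := by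
  rw [← (Finset.HasAntidiagonal.sigmaAntidiagonalEquivProd (A := ℕ)).tsum_eq f, ENNReal.tsum_sigma']
  refine tsum_congr fun k => ?_
  rw [tsum_fintype, ← Finset.sum_coe_sort (Finset.HasAntidiagonal.antidiagonal k) f]
  rfl

theorem end_nsmul_apply (n : ℕ) (f : AddMonoid.End (MeasFun d)) (F : MeasFun d) (ω : Config d) :
    ((n • f) F).1 ω = n * (f F).1 ω := by
  induction n with
  | zero => simp only [zero_nsmul, Nat.cast_zero, zero_mul]; rfl
  | succ n ih => rw [succ_nsmul, end_add_apply, ih, Nat.cast_succ, add_mul, one_mul]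

theorem end_sum_apply {ι : Type*} (s : Finset ι) (f : ι → AddMonoid.End (MeasFun d))
    (F : MeasFun d) (ω : Config d) : ((∑ i ∈ s, f i) F).1 ω = ∑ i ∈ s, (f i F).1 ω := by
  classical
  induction s using Finset.induction_on with
  | empty => rfl
  | insert i s hi ih => rw [Finset.sum_insert hi, Finset.sum_insert hi, end_add_apply, ih]

/-- The restrictions of the Poisson point process to disjoint windows are independent. -/
theorem lintegral_poisson_split {Λ Λ₁ : Window d} (h : Λ₁.1 ⊆ Λ.1) {F : Config d → ℝ≥0∞}
    (hF : Measurable F) :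
    ∫⁻ ω, F ω ∂(poisson Λ) =
      ∫⁻ ω₂, ∫⁻ ω₁, F (glue Λ₁ ω₁ ω₂) ∂(poisson Λ₁) ∂(poisson (Λ.diff Λ₁)) := by
  set Λ₂ := Λ.diff Λ₁ with hΛ₂
  -- The outer configuration has no point in Λ₁, so the inner integral is the series in `addPoint
  -- Λ₁.1` evaluated at it.
  have hinner : ∀ᵐ ω₂ ∂(poisson Λ₂), ∫⁻ ω₁, F (glue Λ₁ ω₁ ω₂) ∂(poisson Λ₁) =
      ∑' i : ℕ, ENNReal.ofReal (Real.exp (-vol Λ₁)) / (i.factorial : ℝ≥0∞) *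
        ((addPoint Λ₁.1 ^ i) (toMeasFun F hF)).1 ω₂ := by
    filter_upwards [ae_poisson_subset Λ₂] with ω₂ hω₂
    rw [lintegral_poisson Λ₁ (F := fun ω₁ => F (glue Λ₁ ω₁ ω₂))
      (hF.comp (measurable_glue_left Λ₁ ω₂))]
    refine tsum_congr fun i => ?_
    have := addPoint_pow_glue Λ₁ i (toMeasFun F hF) (emptyConfig d) ω₂
    rw [glue_empty_of_subset (hω₂.trans fun x hx => hx.2)] at this
    rw [this]
    rfl
  rw [lintegral_congr_ae hinner, lintegral_tsum fun i =>
    (((addPoint Λ₁.1 ^ i) (toMeasFun F hF)).2.const_mul _).aemeasurable]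
  have houter : ∀ i : ℕ, ∫⁻ ω₂, ENNReal.ofReal (Real.exp (-vol Λ₁)) / (i.factorial : ℝ≥0∞) *
        ((addPoint Λ₁.1 ^ i) (toMeasFun F hF)).1 ω₂ ∂(poisson Λ₂) =
      ∑' j : ℕ, ENNReal.ofReal (Real.exp (-vol Λ₁)) / (i.factorial : ℝ≥0∞) *
        (ENNReal.ofReal (Real.exp (-vol Λ₂)) / (j.factorial : ℝ≥0∞) *
          ((addPoint Λ₁.1 ^ i * addPoint Λ₂.1 ^ j) (toMeasFun F hF)).1 (emptyConfig d)) := by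
    intro i
    rw [lintegral_const_mul _ ((addPoint Λ₁.1 ^ i) (toMeasFun F hF)).2,
      lintegral_poisson Λ₂ ((addPoint Λ₁.1 ^ i) (toMeasFun F hF)).2,
      ← ENNReal.tsum_mul_left]
    refine tsum_congr fun j => ?_
    rw [((commute_addPoint Λ₁.1 Λ₂.1).pow_pow i j).eq, end_mul_apply]
    rfl
  simp only [houter]
  -- This is exp(S + T) = exp(S) exp(T) for commuting operators: the double series is regrouped
  -- along i + j = k and compared with the binomial expansion of the k-th power.
  rw [← ENNReal.tsum_prod (f := fun i j : ℕ =>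
      ENNReal.ofReal (Real.exp (-vol Λ₁)) / (i.factorial : ℝ≥0∞) *
        (ENNReal.ofReal (Real.exp (-vol Λ₂)) / (j.factorial : ℝ≥0∞) *
          ((addPoint Λ₁.1 ^ i * addPoint Λ₂.1 ^ j) (toMeasFun F hF)).1 (emptyConfig d))),
    tsum_prod_eq_tsum_sum_antidiagonal, lintegral_poisson Λ hF]
  refine tsum_congr fun k => ?_
  have hΛ : Λ.1 = Λ₁.1 ∪ Λ₂.1 := (Set.union_sdiff_cancel h).symm
  rw [hΛ, addPoint_union Λ₂.2.1 disjoint_sdiff_self_right,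
    (commute_addPoint Λ₁.1 Λ₂.1).add_pow', ← vol_add_vol_diff h, neg_add, Real.exp_add,
    ENNReal.ofReal_mul (Real.exp_pos _).le, end_sum_apply, Finset.mul_sum]
  refine Finset.sum_congr rfl fun m hm => ?_
  obtain ⟨i, j⟩ := m
  have hk : i + j = k := by simpa using hm
  subst hk
  have hc : ((i + j).choose i : ℝ≥0∞) * (i.factorial * j.factorial) = (i + j).factorial := by
    have := Nat.add_choose_mul_factorial_mul_factorial i j
    rw [← Nat.choose_symm_add] at this
    rw [← mul_assoc]
    exact_mod_cast this
  have hi : (i.factorial : ℝ≥0∞) ≠ 0 := by simp [Nat.factorial_ne_zero]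
  have hj : (j.factorial : ℝ≥0∞) ≠ 0 := by simp [Nat.factorial_ne_zero]
  have hch : ((i + j).choose i : ℝ≥0∞) ≠ 0 := by
    simp [(Nat.choose_pos (Nat.le_add_right i j)).ne']
  rw [end_nsmul_apply, ← hc, div_eq_mul_inv, div_eq_mul_inv, div_eq_mul_inv,
    ENNReal.mul_inv (Or.inl hch) (Or.inl (ENNReal.natCast_ne_top _)),
    ENNReal.mul_inv (Or.inl hi) (Or.inl (ENNReal.natCast_ne_top _))]
  generalize ((addPoint Λ₁.1 ^ i * addPoint Λ₂.1 ^ j) (toMeasFun F hF)).1 (emptyConfig d) = X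
  generalize ENNReal.ofReal (Real.exp (-vol Λ₁)) = a
  generalize ENNReal.ofReal (Real.exp (-vol Λ₂)) = b
  calc a * b * (((i + j).choose i : ℝ≥0∞)⁻¹ * ((i.factorial : ℝ≥0∞)⁻¹ * (j.factorial : ℝ≥0∞)⁻¹)) *
        ((i + j).choose i * X)
      = (((i + j).choose i : ℝ≥0∞)⁻¹ * (i + j).choose i) *
        (a * (i.factorial : ℝ≥0∞)⁻¹ * (b * (j.factorial : ℝ≥0∞)⁻¹ * X)) := by ring
    _ = _ := by rw [ENNReal.inv_mul_cancel hch (ENNReal.natCast_ne_top _), one_mul]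

/-! ### Translation of the Poisson process -/

theorem vol_translate (u : Space d) (Λ : Window d) : vol (Λ.translate u) = vol Λ := by
  simp only [vol, Window.translate, measure_preimage_add_right]

theorem shift_ins (u x : Space d) (ω : Config d) :
    shift u (ins x ω) = ins (x + u) (shift u ω) :=
  Subtype.ext (Set.image_insert_eq)

theorem addPoint_pow_translate (u : Space d) (Λ : Window d) (k : ℕ) (F : MeasFun d)
    (ω : Config d) :
    ((addPoint (Λ.translate u).1 ^ k) F).1 (shift u ω) =
      ((addPoint Λ.1 ^ k) (toMeasFun (fun ω => F.1 (shift u ω))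
        (F.2.comp (measurable_shift u)))).1 ω := by
  induction k generalizing ω with
  | zero => rfl
  | succ k ih =>
    rw [pow_succ', end_mul_apply, pow_succ', end_mul_apply, addPoint_apply,
      addPoint_apply, ← lintegral_indicator (Λ.translate u).2.1, ← lintegral_indicator Λ.2.1,
      ← lintegral_add_right_eq_self _ u]
    refine lintegral_congr fun x => ?_
    by_cases hx : x ∈ Λ.1
    · rw [Set.indicator_of_mem hx, Set.indicator_of_mem (by simpa [mem_translate] using hx),
        ← shift_ins, ih]
    · rw [Set.indicator_of_notMem hx, Set.indicator_of_notMem (by simpa [mem_translate] using hx)]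

theorem shift_empty (u : Space d) : shift u (emptyConfig d) = emptyConfig d :=
  Config.ext fun x => by simp [mem_shift, emptyConfig, ofFinite]

theorem lintegral_poisson_translate (u : Space d) (Λ : Window d) {F : Config d → ℝ≥0∞}
    (hF : Measurable F) :
    ∫⁻ ω, F ω ∂(poisson (Λ.translate u)) = ∫⁻ ω, F (shift u ω) ∂(poisson Λ) := by
  rw [lintegral_poisson _ hF, 
    lintegral_poisson _ (F := fun ω => F (shift u ω)) (hF.comp (measurable_shift u))]
  refine tsum_congr fun k => ?_
  rw [vol_translate]
  congr 1
  have := addPoint_pow_translate u Λ k (toMeasFun F hF) (emptyConfig d)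
  rw [shift_empty] at this
  exact this

end Poisson

section FiniteRange

variable {d : ℕ}

/-! ### Energies of finite range -/

/-- The standing assumptions on an energy of range `R`. -/
structure IsAdmissible (H : Energy d) (R : ℝ) : Prop where
  meas : Measurable H
  stat : IsStationaryEnergy H
  her : IsHereditary H
  nondeg : IsNonDegenerate H
  stable : IsStable H
  range_nonneg : 0 ≤ R
  range : HasRange H R

/-- The Boltzmann weight `exp(-H(ω_Λ))`. -/
def boltz (H : Energy d) (Λ : Window d) (ω : Config d) : ℝ≥0∞ :=
  EReal.exp (-H (finRestrict Λ ω))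

theorem finRestrict_congr {Λ Λ' : Window d} {ω ω' : Config d}
    (h : ∀ x, (x ∈ ω.1 ∧ x ∈ Λ.1) ↔ (x ∈ ω'.1 ∧ x ∈ Λ'.1)) :
    finRestrict Λ ω = finRestrict Λ' ω' :=
  Subtype.ext (Config.ext h)

theorem boltz_congr (H : Energy d) {Λ Λ' : Window d} {ω ω' : Config d}
    (h : ∀ x, (x ∈ ω.1 ∧ x ∈ Λ.1) ↔ (x ∈ ω'.1 ∧ x ∈ Λ'.1)) :
    boltz H Λ ω = boltz H Λ' ω' := by
  rw [boltz, finRestrict_congr h, boltz]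

theorem mem_glue {Λ : Window d} {ω' ω : Config d} {x : Space d} :
    x ∈ (glue Λ ω' ω).1 ↔ (x ∈ ω'.1 ∧ x ∈ Λ.1) ∨ (x ∈ ω.1 ∧ x ∉ Λ.1) := Iff.rfl

theorem mem_diff {Λ Λ' : Window d} {x : Space d} : x ∈ (Λ'.diff Λ).1 ↔ x ∈ Λ'.1 ∧ x ∉ Λ.1 := Iff.rfl

/-- The union of two windows. -/
def Window.union (Λ Λ' : Window d) : Window d :=
  ⟨Λ.1 ∪ Λ'.1, Λ.2.1.union Λ'.2.1, Λ.2.2.union Λ'.2.2⟩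

theorem add_closedBall_subset_thicken (Λ : Window d) (R : ℝ) :
    Λ.1 + Metric.closedBall 0 R ⊆ (Λ.thicken R).1 := by
  rintro _ ⟨a, ha, b, hb, rfl⟩
  refine Metric.mem_cthickening_of_dist_le _ a R _ ha ?_
  simpa [dist_eq_norm] using hb

theorem subset_thicken (Λ : Window d) (R : ℝ) : Λ.1 ⊆ (Λ.thicken R).1 :=
  Metric.self_subset_cthickening _

theorem exists_window_superset (Λ : Window d) : ∃ n : ℕ, Λ.1 ⊆ (cube d n).1 := by
  obtain ⟨r, hr⟩ := Λ.2.2.subset_closedBall 0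
  obtain ⟨n, hn⟩ := exists_nat_ge r
  refine ⟨n, fun x hx i => ?_⟩
  have h1 : ‖x‖ ≤ r := by simpa using hr hx
  have h2 := PiLp.norm_apply_le x i
  rw [Real.norm_eq_abs] at h2
  exact abs_le.1 (h2.trans (h1.trans hn))

theorem cube_mono {m n : ℕ} (h : m ≤ n) : (cube d m).1 ⊆ (cube d n).1 := by
  intro x hx i
  have h1 := hx i
  have h2 : (m : ℝ) ≤ n := by exact_mod_cast h
  exact ⟨by linarith [h1.1], by linarith [h1.2]⟩

theorem thicken_cube_subset (m r : ℕ) {R : ℝ} (hR : 0 ≤ R) (hr : R < r) :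
    ((cube d m).thicken R).1 ⊆ (cube d (m + r)).1 := by
  intro x hx i
  have h := Metric.cthickening_subset_iUnion_closedBall_of_lt (cube d m).1
    (hR.trans_lt hr) hr hx
  simp only [Set.mem_iUnion, exists_prop] at h
  obtain ⟨y, hy, hxy⟩ := h
  have h1 : ‖x - y‖ ≤ r := by simpa [dist_eq_norm] using hxy
  have h2 := (PiLp.norm_apply_le (x - y) i).trans h1
  rw [Real.norm_eq_abs, abs_le] at h2
  have h3 := hy i
  simp only [PiLp.sub_apply] at h2
  push_cast
  exact ⟨by linarith [h3.1], by linarith [h3.2]⟩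

namespace IsAdmissible

variable {H : Energy d} {R : ℝ}

theorem ne_bot (hH : IsAdmissible H R) (ω : FinConfig d) : H ω ≠ ⊥ := by
  obtain ⟨A, -, hA⟩ := hH.stable
  intro h
  have := hA ω
  rw [h, le_bot_iff] at this
  exact EReal.coe_ne_bot _ this

theorem energy_empty (hH : IsAdmissible H R) {ω : FinConfig d} (h : ω.1.1 = ∅) : H ω = 0 := by
  rw [← hH.nondeg.2]
  congr 1
  exact Subtype.ext (Subtype.ext h)

/-- Heredity adds one point; the missing points are added one by one. -/
theorem top_of_subset (hH : IsAdmissible H R) {ω ω' : FinConfig d} (h : ω.1.1 ⊆ ω'.1.1)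
    (hω : H ω = ⊤) : H ω' = ⊤ := by
  have key : ∀ s : Set (Space d), s.Finite → ∀ ω' : FinConfig d, ω'.1.1 = ω.1.1 ∪ s →
      H ω' = ⊤ := by
    intro s hs
    induction s, hs using Set.Finite.induction_on with
    | empty =>
      intro ω' h'
      rw [← hω]
      congr 1
      exact Subtype.ext (Subtype.ext (by simpa using h'))
    | @insert a s _ hs ih =>
      intro ω' h'
      have h1 := ih (ofFinite (ω.1.1 ∪ s) (ω.2.union hs)) rfl
      rw [← hH.her a _ h1]
      congr 1
      refine Subtype.ext (Subtype.ext ?_)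
      rw [h', Set.union_insert]
      rfl
  exact key ω'.1.1 ω'.2 ω' (Set.union_eq_self_of_subset_left h).symm

theorem lt_top_of_subset (hH : IsAdmissible H R) {ω ω' : FinConfig d} (h : ω.1.1 ⊆ ω'.1.1)
    (hω : H ω' < ⊤) : H ω < ⊤ :=
  lt_top_iff_ne_top.2 fun h' => hω.ne (hH.top_of_subset h h')

theorem finiteEnergy_of_subset (hH : IsAdmissible H R) {ω ω' : Config d} (h : ω.1 ⊆ ω'.1)
    (hω : ω' ∈ finiteEnergy H) : ω ∈ finiteEnergy H := fun Λ =>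
  hH.lt_top_of_subset (ω := finRestrict Λ ω) (ω' := finRestrict Λ ω') (fun _ hx => ⟨h hx.1, hx.2⟩) (hω Λ)

theorem finiteEnergy_of_window (hH : IsAdmissible H R) {ω : Config d} {Λ : Window d}
    (h : ω.1 ⊆ Λ.1) (hω : H (finRestrict Λ ω) < ⊤) : ω ∈ finiteEnergy H := fun Λ' =>
  hH.lt_top_of_subset (ω := finRestrict Λ' ω) (ω' := finRestrict Λ ω) (fun _ hx => ⟨hx.1, h hx.1⟩) hω

theorem mem_finiteEnergy_iff (hH : IsAdmissible H R) {ω : Config d} :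
    ω ∈ finiteEnergy H ↔ ∀ n : ℕ, H (finRestrict (cube d n) ω) < ⊤ := by
  refine ⟨fun h n => h _, fun h Λ => ?_⟩
  obtain ⟨n, hn⟩ := exists_window_superset Λ
  exact hH.lt_top_of_subset (ω := finRestrict Λ ω) (ω' := finRestrict (cube d n) ω)
    (fun x hx => ⟨hx.1, hn hx.2⟩) (h n)

theorem boltz_eq_zero_iff (H : Energy d) {Λ : Window d} {ω : Config d} :
    boltz H Λ ω = 0 ↔ H (finRestrict Λ ω) = ⊤ := by
  rw [boltz, EReal.exp_eq_zero_iff, EReal.neg_eq_bot_iff]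

theorem boltz_ne_top (hH : IsAdmissible H R) (Λ : Window d) (ω : Config d) :
    boltz H Λ ω ≠ ⊤ := by
  rw [boltz, ne_eq, EReal.exp_eq_top_iff, EReal.neg_eq_top_iff]
  exact hH.ne_bot _

theorem measurable_boltz (hH : IsAdmissible H R) (Λ : Window d) : Measurable (boltz H Λ) :=
  measurable_expNeg (measurable_energy hH.meas Λ)

theorem boltz_empty (hH : IsAdmissible H R) (Λ : Window d) {ω : Config d}
    (h : ω.1 ∩ Λ.1 = ∅) : boltz H Λ ω = 1 := by
  rw [boltz, hH.energy_empty h, neg_zero, EReal.exp_zero]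

/-- Finite energy outside Λ rules out the convention ∞ − ∞ = 0, so the energies subtract as they
should; if the total energy is infinite, both sides vanish. -/
theorem boltz_mul_exp (hH : IsAdmissible H R) {Λ Λ' : Window d} {ω : Config d}
    (h : H (finRestrict (Λ'.diff Λ) ω) < ⊤) :
    boltz H Λ' ω = boltz H (Λ'.diff Λ) ω * EReal.exp (-energyDiff H Λ Λ' ω) := by
  have h1 := hH.ne_bot (finRestrict (Λ'.diff Λ) ω)
  rw [boltz, boltz, energyDiff, esub, if_neg (fun h' => h.ne h'.2), ← EReal.exp_add]
  congr 1
  generalize H (finRestrict (Λ'.diff Λ) ω) = b at h h1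
  generalize H (finRestrict Λ' ω) = a
  lift b to ℝ using ⟨h.ne, h1⟩
  induction a with
  | bot => simp
  | top => simp
  | coe a =>
    norm_cast
    ring

/-- The local energy may be computed in every window containing the thickening of `Λ`. -/
theorem boltz_eq_mul (hH : IsAdmissible H R) {Λ Λ' : Window d} {ω : Config d}
    (h : restrict Λ.1ᶜ ω ∈ finiteEnergy H) (hΛ : (Λ.thicken R).1 ⊆ Λ'.1) :
    boltz H Λ' ω = boltz H (Λ'.diff Λ) ω * EReal.exp (-localEnergy H R Λ ω) := by
  rw [localEnergy, hH.range ω Λ (Λ.thicken R) Λ' h (add_closedBall_subset_thicken Λ R)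
    ((add_closedBall_subset_thicken Λ R).trans hΛ)]
  refine hH.boltz_mul_exp (hH.lt_top_of_subset (ω' := finRestrict Λ' (restrict Λ.1ᶜ ω))
    (fun x hx => ⟨⟨hx.1, hx.2.2⟩, hx.2.1⟩) (h _))

/-- The energy of an isolated part of a configuration. -/
theorem energyDiff_isolated (hH : IsAdmissible H R) {B Λ' : Window d} {ω : Config d}
    (h : restrict B.1ᶜ ω ∈ finiteEnergy H) (hΛ : (B.thicken R).1 ⊆ Λ'.1)
    (hiso : ∀ x ∈ ω.1, x ∈ (B.thicken R).1 → x ∈ B.1) :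
    energyDiff H B Λ' ω = H (finRestrict B ω) := by
  rw [hH.range ω B Λ' (B.thicken R) h ((add_closedBall_subset_thicken B R).trans hΛ)
    (add_closedBall_subset_thicken B R), energyDiff]
  have h1 : finRestrict (B.thicken R) ω = finRestrict B ω := finRestrict_congr fun x =>
    ⟨fun hx => ⟨hx.1, hiso x hx.1 hx.2⟩, fun hx => ⟨hx.1, subset_thicken B R hx.2⟩⟩
  have h2 : H (finRestrict ((B.thicken R).diff B) ω) = 0 := by
    refine hH.energy_empty (Set.eq_empty_iff_forall_notMem.2 ?_)
    rintro x ⟨hx, hx', hx''⟩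
    exact hx'' (hiso x hx hx')
  rw [h1, h2, esub, if_neg (by simp), sub_zero]

/-- The points of η in B and those of ξ beyond the thickening of B do not interact. -/
theorem boltz_glue_isolated (hH : IsAdmissible H R) {B Λ : Window d} (hB : B.1 ⊆ Λ.1)
    {η ξ : Config d} (hξ : ξ.1 ⊆ (Λ.diff (B.thicken R)).1) :
    boltz H Λ (glue B η ξ) = boltz H (Λ.diff (B.thicken R)) ξ * boltz H B η := by
  set Λ' := Λ.diff (B.thicken R)
  -- The thickening of B may stick out of Λ, but the glued configuration has no points there, so the
  -- larger window changes nothing and the range property applies.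
  set V := Λ.union (B.thicken R)
  have hξB : ∀ x ∈ ξ.1, x ∉ B.1 := fun x hx hxB => (hξ hx).2 (subset_thicken B R hxB)
  have h1 : boltz H Λ (glue B η ξ) = boltz H V (glue B η ξ) := boltz_congr H fun x => by
    refine and_congr_right fun hx => ⟨Or.inl, fun _ => ?_⟩
    rcases hx with hx | hx
    · exact hB hx.2
    · exact (hξ hx.1).1
  -- Finite range is only available when the outer configuration has finite energy; otherwise both
  -- sides are zero by heredity.
  by_cases htop : H (finRestrict Λ' ξ) = ⊤
  · rw [(boltz_eq_zero_iff H).2 htop, zero_mul, boltz_eq_zero_iff]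
    exact hH.top_of_subset (ω := finRestrict Λ' ξ) (fun x hx => ⟨Or.inr ⟨hx.1, hξB x hx.1⟩, (hξ hx.1).1⟩) htop
  · have hfin : restrict B.1ᶜ (glue B η ξ) ∈ finiteEnergy H := by
      refine hH.finiteEnergy_of_subset ?_
        (hH.finiteEnergy_of_window hξ (lt_top_iff_ne_top.2 htop))
      rintro x ⟨hx | hx, hx'⟩
      · exact absurd hx.2 hx'
      · exact hx.1
    have hV : (B.thicken R).1 ⊆ V.1 := Set.subset_union_right
    rw [h1, hH.boltz_mul_exp (Λ := B) (hH.lt_top_of_subset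
      (ω' := finRestrict V (restrict B.1ᶜ (glue B η ξ)))
      (fun x hx => ⟨⟨hx.1, hx.2.2⟩, hx.2.1⟩) (hfin V)), hH.energyDiff_isolated hfin hV]
    · congr 1
      · refine boltz_congr H fun x => ⟨?_, fun hx => ?_⟩
        · rintro ⟨hx | hx, -, hxB⟩
          · exact absurd hx.2 hxB
          · exact ⟨hx.1, hξ hx.1⟩
        · exact ⟨Or.inr ⟨hx.1, hξB x hx.1⟩, Or.inl (hξ hx.1).1, hξB x hx.1⟩
      · exact boltz_congr H (Λ := B) (Λ' := B) fun x =>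
          and_congr_left fun hxB => by simp [mem_glue, hxB]
    · rintro x (hx | hx) hxt
      · exact hx.2
      · exact absurd hxt (hξ hx.1).2

/-- Points of η in B are out of reach of the boundary condition outside Λ. Within the thickening of
Λ, removing B or removing Λ leaves the same points, so the local energy may be computed for B. -/
theorem localEnergy_glue_isolated (hH : IsAdmissible H R) {B Λ : Window d}
    (hB : (B.thicken R).1 ⊆ Λ.1) {η ω : Config d} (hη : η.1 ⊆ B.1)
    (hω : restrict Λ.1ᶜ ω ∈ finiteEnergy H) :
    localEnergy H R Λ (glue Λ η ω) = H (finRestrict B η) := by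
  have hBΛ : B.1 ⊆ Λ.1 := (subset_thicken B R).trans hB
  have h1 : finRestrict B η = finRestrict B (glue Λ η ω) := finRestrict_congr fun x =>
    and_congr_left fun hx => by simp [mem_glue, hBΛ hx]
  rw [h1, ← hH.energyDiff_isolated (Λ' := Λ.thicken R), localEnergy, energyDiff, energyDiff]
  · congr 2
    refine finRestrict_congr fun x => ?_
    rw [mem_glue, mem_diff, mem_diff]
    constructor
    · rintro ⟨hx | hx, hx'⟩
      · exact absurd hx.2 hx'.2
      · exact ⟨Or.inr hx, hx'.1, fun h => hx.2 (hBΛ h)⟩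
    · rintro ⟨hx | hx, hx'⟩
      · exact absurd (hη hx.1) hx'.2
      · exact ⟨Or.inr hx, hx'.1, hx.2⟩
  · refine hH.finiteEnergy_of_subset ?_ hω
    rintro x ⟨hx | hx, hx'⟩
    · exact absurd (hη hx.1) hx'
    · exact hx
  · exact hB.trans (subset_thicken Λ R)
  · rintro x (hx | hx) hxt
    · exact hη hx.1
    · exact absurd (hB hxt) hx.2

theorem exists_boltz_le (hH : IsAdmissible H R) : ∃ A : ℝ, 0 < A ∧ ∀ (Λ : Window d) (ω : Config d),
    boltz H Λ ω ≤ ENNReal.ofReal (Real.exp A) ^ (count Λ.1 ω) := by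
  obtain ⟨A, hA0, hA⟩ := hH.stable
  refine ⟨A, hA0, fun Λ ω => ?_⟩
  have h1 := hA (finRestrict Λ ω)
  rw [boltz, ← ENNReal.ofReal_pow (Real.exp_pos _).le, ← Real.exp_nat_mul, ← EReal.exp_coe]
  refine EReal.exp_monotone ?_
  rw [EReal.neg_le, ← EReal.coe_neg]
  convert h1 using 3
  rw [mul_comm]
  rfl

end IsAdmissible

end FiniteRange

/-! ### The Donsker–Varadhan formula -/

section DonskerVaradhan

open InformationTheory

variable {α : Type*} [MeasurableSpace α] {μ ν : Measure α}

/-- The form in which log y ≤ y − 1 is integrated, both for the Donsker–Varadhan inequality and for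
the upper bound for Gibbs measures. -/
theorem integral_nonpos_of_le_sub_one [IsProbabilityMeasure μ] {Y : α → ℝ≥0∞}
    (hY : AEMeasurable Y μ) (hY1 : ∫⁻ x, Y x ∂μ ≤ 1) {u : α → ℝ} (hu : Integrable u μ)
    (h : ∀ᵐ x ∂μ, u x ≤ (Y x).toReal - 1) : ∫ x, u x ∂μ ≤ 0 := by
  have hfin : ∫⁻ x, Y x ∂μ ≠ ⊤ := (hY1.trans_lt ENNReal.one_lt_top).ne
  have hint := integrable_toReal_of_lintegral_ne_top hY hfin
  have hint1 : Integrable (fun x => (Y x).toReal - 1) μ := hint.sub (integrable_const 1)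
  refine (integral_mono_ae hu hint1 h).trans ?_
  have h1 : ∫ x, ((Y x).toReal - 1) ∂μ = ∫ x, (Y x).toReal ∂μ - 1 := by
    rw [integral_sub hint (integrable_const 1)]
    simp
  rw [h1, integral_toReal hY (ae_lt_top' hY hfin)]
  have := ENNReal.toReal_mono ENNReal.one_ne_top hY1
  simp only [ENNReal.toReal_one] at this
  linarith

/-- The Donsker–Varadhan inequality. -/
theorem integral_log_le_klDiv_add_log [IsProbabilityMeasure μ] [IsProbabilityMeasure ν]
    (hkl : klDiv μ ν ≠ ⊤) {W : α → ℝ≥0∞} (hW : Measurable W)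
    (hZ : ∫⁻ x, W x ∂ν ≠ 0) (hZ' : ∫⁻ x, W x ∂ν ≠ ⊤)
    (hWpos : ∀ᵐ x ∂μ, W x ≠ 0 ∧ W x ≠ ⊤) (hint : Integrable (fun x => Real.log (W x).toReal) μ) :
    ∫ x, Real.log (W x).toReal ∂μ ≤
      (klDiv μ ν).toReal + Real.log (∫⁻ x, W x ∂ν).toReal := by
  obtain ⟨hac, hllr⟩ := klDiv_ne_top_iff.1 hkl
  set Z := ∫⁻ x, W x ∂ν with hZdef
  have hf := Measure.measurable_rnDeriv μ ν
  have hZpos : 0 < Z.toReal := ENNReal.toReal_pos hZ hZ'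
  have hYm : Measurable fun x => W x / (Z * μ.rnDeriv ν x) := hW.div (hf.const_mul _)
  -- The ratio of the normalized weight W / Z to the density of μ has μ-mean at most one; mass of W
  -- where the density vanishes is lost.
  have h1 : ∫⁻ x, W x / (Z * μ.rnDeriv ν x) ∂μ ≤ 1 := by
    rw [← lintegral_rnDeriv_mul hac hYm.aemeasurable]
    calc ∫⁻ x, μ.rnDeriv ν x * (W x / (Z * μ.rnDeriv ν x)) ∂ν
        ≤ ∫⁻ x, W x / Z ∂ν := by
          refine lintegral_mono_ae ?_
          filter_upwards [Measure.rnDeriv_lt_top μ ν] with x hx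
          rcases eq_or_ne (μ.rnDeriv ν x) 0 with h0 | h0
          · simp [h0]
          · rw [div_eq_mul_inv, ENNReal.mul_inv (Or.inl hZ) (Or.inl hZ'), div_eq_mul_inv]
            calc μ.rnDeriv ν x * (W x * (Z⁻¹ * (μ.rnDeriv ν x)⁻¹))
                = W x * Z⁻¹ * (μ.rnDeriv ν x * (μ.rnDeriv ν x)⁻¹) := by ring
              _ = W x * Z⁻¹ := by rw [ENNReal.mul_inv_cancel h0 hx.ne, mul_one]
              _ ≤ _ := le_rfl
      _ = 1 := by
          simp only [div_eq_mul_inv]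
          rw [lintegral_mul_const _ hW, ENNReal.mul_inv_cancel hZ hZ']
  have h2 : ∫ x, (Real.log (W x).toReal - Real.log Z.toReal - llr μ ν x) ∂μ ≤ 0 := by
    refine integral_nonpos_of_le_sub_one hYm.aemeasurable h1
      ((hint.sub (integrable_const _)).sub hllr) ?_
    filter_upwards [hWpos, Measure.rnDeriv_pos hac, hac (Measure.rnDeriv_lt_top μ ν)]
      with x hx hf0 hft
    have hWx : 0 < (W x).toReal := ENNReal.toReal_pos hx.1 hx.2
    have hfx : 0 < (μ.rnDeriv ν x).toReal := ENNReal.toReal_pos hf0.ne' hft.ne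
    have := Real.log_le_sub_one_of_pos (x := (W x / (Z * μ.rnDeriv ν x)).toReal) (by
      rw [ENNReal.toReal_div, ENNReal.toReal_mul]
      positivity)
    rw [ENNReal.toReal_div, ENNReal.toReal_mul, Real.log_div hWx.ne' (by positivity),
      Real.log_mul hZpos.ne' hfx.ne'] at this
    rw [llr, ENNReal.toReal_div, ENNReal.toReal_mul]
    linarith
  have h3 : ∫ x, (Real.log (W x).toReal - Real.log Z.toReal - llr μ ν x) ∂μ =
      ∫ x, Real.log (W x).toReal ∂μ - Real.log Z.toReal - ∫ x, llr μ ν x ∂μ := by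
    have hint1 : Integrable (fun x => Real.log (W x).toReal - Real.log Z.toReal) μ :=
      hint.sub (integrable_const _)
    rw [integral_sub hint1 hllr, integral_sub hint (integrable_const _)]
    simp
  rw [toReal_klDiv_of_measure_eq hac (by simp)]
  linarith

/-- Truncation of a density at the levels `exp (-n)` and `exp n`. -/
def clampExp (n : ℕ) (y : ℝ) : ℝ := max (Real.exp (-n)) (min y (Real.exp n))

theorem clampExp_pos (n : ℕ) (y : ℝ) : 0 < clampExp n y := lt_max_of_lt_left (Real.exp_pos _)

theorem clampExp_le (n : ℕ) (y : ℝ) : clampExp n y ≤ Real.exp n :=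
  max_le (Real.exp_le_exp.2 (by linarith [Nat.cast_nonneg (α := ℝ) n])) (min_le_right _ _)

theorem le_clampExp (n : ℕ) (y : ℝ) : Real.exp (-n) ≤ clampExp n y := le_max_left _ _

theorem measurable_clampExp (n : ℕ) : Measurable (clampExp n) :=
  measurable_const.max (measurable_id.min measurable_const)

theorem abs_log_clampExp_le (n : ℕ) (y : ℝ) : |Real.log (clampExp n y)| ≤ n := by
  rw [abs_le]
  constructor
  · rw [Real.le_log_iff_exp_le (clampExp_pos n y)]
    exact le_clampExp n y
  · rw [Real.log_le_iff_le_exp (clampExp_pos n y)]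
    exact clampExp_le n y

/-- With g the truncation of y, the expression is `klFun g` plus (y − g) log g. Truncation raises y
only where log g ≤ 0 and lowers it only where log g ≥ 0, so both terms are nonnegative. -/
theorem mul_log_clampExp_nonneg (n : ℕ) (y : ℝ) :
    0 ≤ y * Real.log (clampExp n y) - clampExp n y + 1 := by
  have hn : (0 : ℝ) ≤ n := Nat.cast_nonneg n
  have h := klFun_nonneg (clampExp_pos n y).le
  rw [klFun] at h
  suffices clampExp n y * Real.log (clampExp n y) ≤ y * Real.log (clampExp n y) by linarith
  rcases le_total y (Real.exp (-n)) with h1 | h1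
  · have h2 : clampExp n y = Real.exp (-n) :=
      max_eq_left ((min_le_left _ _).trans h1)
    rw [h2, Real.log_exp]
    nlinarith
  · rcases le_total y (Real.exp n) with h2 | h2
    · have h3 : clampExp n y = y := by
        rw [clampExp, min_eq_left h2, max_eq_right h1]
      rw [h3]
    · have h3 : clampExp n y = Real.exp n := by
        rw [clampExp, min_eq_right h2, max_eq_right (Real.exp_le_exp.2 (by linarith))]
      rw [h3, Real.log_exp]
      nlinarith

theorem tendsto_mul_log_clampExp {y : ℝ} (hy : 0 ≤ y) :
    Tendsto (fun n => y * Real.log (clampExp n y) - clampExp n y + 1) atTop (𝓝 (klFun y)) := by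
  have hE : Tendsto (fun n : ℕ => Real.exp (-(n : ℝ))) atTop (𝓝 0) :=
    Real.tendsto_exp_neg_atTop_nhds_zero.comp tendsto_natCast_atTop_atTop
  rcases hy.eq_or_lt with rfl | hy
  · have : (fun n : ℕ => (0 : ℝ) * Real.log (clampExp n 0) - clampExp n 0 + 1) =
        fun n : ℕ => 1 - Real.exp (-(n : ℝ)) := by
      funext n
      have h2 : clampExp n 0 = Real.exp (-n) :=
        max_eq_left ((min_le_left _ _).trans (Real.exp_pos _).le)
      rw [h2]
      ring
    rw [this, klFun_zero]
    simpa using hE.const_sub 1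
  · refine tendsto_const_nhds.congr' ?_
    have h1 := hE.eventually_le_const hy
    have h2 : ∀ᶠ n : ℕ in atTop, y ≤ Real.exp n := (Real.tendsto_exp_atTop.comp
      (tendsto_natCast_atTop_atTop (R := ℝ))).eventually_ge_atTop y
    filter_upwards [h1, h2] with n h1 h2
    have h3 : clampExp n y = y := by
      rw [clampExp, min_eq_left h2, max_eq_right h1]
    rw [h3, klFun]
    ring

/-- On a ν-null set charged by μ, a constant test function can make the first integral any c, while
e^F still has ν-integral one. -/
theorem exists_bounded_of_not_ac [IsProbabilityMeasure μ] [IsProbabilityMeasure ν]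
    (h : ¬ μ ≪ ν) (c : ℝ) :
    ∃ F : α → ℝ, Measurable F ∧ (∃ C, ∀ x, |F x| ≤ C) ∧
      c ≤ ∫ x, F x ∂μ - Real.log (∫ x, Real.exp (F x) ∂ν) := by
  classical
  have : ∃ s, MeasurableSet s ∧ ν s = 0 ∧ μ s ≠ 0 := by
    by_contra! hcon
    exact h (Measure.AbsolutelyContinuous.mk fun s hs hν => hcon s hs hν)
  obtain ⟨s, hs, hν, hμ⟩ := this
  have hpos : 0 < μ.real s := ENNReal.toReal_pos hμ (measure_ne_top μ s)
  refine ⟨s.indicator fun _ => c / μ.real s, measurable_const.indicator hs,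
    ⟨|c / μ.real s|, fun x => ?_⟩, ?_⟩
  · by_cases hx : x ∈ s
    · rw [Set.indicator_of_mem hx]
    · rw [Set.indicator_of_notMem hx, abs_zero]
      exact abs_nonneg _
  · have h1 : ∫ x, Real.exp (s.indicator (fun _ => c / μ.real s) x) ∂ν = 1 := by
      have : (fun x => Real.exp (s.indicator (fun _ => c / μ.real s) x)) =ᵐ[ν] fun _ => 1 := by
        filter_upwards [measure_eq_zero_iff_ae_notMem.1 hν] with x hx
        rw [Set.indicator_of_notMem hx, Real.exp_zero]
      rw [integral_congr_ae this]
      simp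
    rw [h1, Real.log_one, sub_zero, integral_indicator_const _ hs, smul_eq_mul,
      mul_div_cancel₀ _ hpos.ne']

/-- Every number below the relative entropy is attained in the Donsker–Varadhan formula. -/
theorem exists_bounded_of_lt_klDiv [IsProbabilityMeasure μ] [IsProbabilityMeasure ν] {c : ℝ}
    (hc : ENNReal.ofReal c < klDiv μ ν) :
    ∃ F : α → ℝ, Measurable F ∧ (∃ C, ∀ x, |F x| ≤ C) ∧
      c ≤ ∫ x, F x ∂μ - Real.log (∫ x, Real.exp (F x) ∂ν) := by
  by_cases hac : μ ≪ ν
  swap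
  · exact exists_bounded_of_not_ac hac c
  set f : α → ℝ := fun x => (μ.rnDeriv ν x).toReal with hf
  have hfm : Measurable f := (Measure.measurable_rnDeriv μ ν).ennreal_toReal
  have hfint : Integrable f ν := Measure.integrable_toReal_rnDeriv
  have hf0 : ∀ x, 0 ≤ f x := fun x => ENNReal.toReal_nonneg
  have hgm : ∀ n, Measurable fun x => clampExp n (f x) := fun n => (measurable_clampExp n).comp hfm
  have hlm : ∀ n, Measurable fun x => Real.log (clampExp n (f x)) := fun n => (hgm n).log
  have hgint : ∀ n, Integrable (fun x => clampExp n (f x)) ν := fun n =>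
    Integrable.of_bound (hgm n).aestronglyMeasurable (Real.exp n) (ae_of_all _ fun x => by
      rw [Real.norm_eq_abs, abs_of_pos (clampExp_pos n _)]
      exact clampExp_le n _)
  have hlint : ∀ n, Integrable (fun x => f x * Real.log (clampExp n (f x))) ν := fun n =>
    hfint.mul_bdd (c := n) (hlm n).aestronglyMeasurable
      (ae_of_all _ fun x => abs_log_clampExp_le n _)
  set φ : ℕ → α → ℝ := fun n x => f x * Real.log (clampExp n (f x)) - clampExp n (f x) + 1 with hφ
  have hφint : ∀ n, Integrable (φ n) ν := fun n =>
    ((hlint n).sub (hgint n)).add (integrable_const 1)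
  -- The truncated integrands converge pointwise to `klFun f`, whose integral is the relative
  -- entropy; by Fatou some truncation level already exceeds c.
  have hfatou : klDiv μ ν ≤ liminf (fun n => ∫⁻ x, ENNReal.ofReal (φ n x) ∂ν) atTop := by
    rw [klDiv_eq_lintegral_klFun_of_ac hac]
    refine le_trans (le_of_eq ?_) (lintegral_liminf_le fun n =>
      ((((hfm.mul (hlm n)).sub (hgm n)).add measurable_const).ennreal_ofReal))
    refine lintegral_congr fun x => ?_
    exact ((ENNReal.continuous_ofReal.tendsto _).comp
      (tendsto_mul_log_clampExp (hf0 x))).liminf_eq.symm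
  obtain ⟨n, hn⟩ := (eventually_lt_of_lt_liminf (hc.trans_le hfatou)).exists
  rw [← ofReal_integral_eq_lintegral_ofReal (hφint n)
    (ae_of_all _ fun x => mul_log_clampExp_nonneg n (f x))] at hn
  have hcn : c < ∫ x, φ n x ∂ν := (ENNReal.ofReal_lt_ofReal_iff'.1 hn).1
  refine ⟨fun x => Real.log (clampExp n (f x)), hlm n, ⟨n, fun x => abs_log_clampExp_le n _⟩, ?_⟩
  have h1 : ∫ x, φ n x ∂ν = ∫ x, Real.log (clampExp n (f x)) ∂μ -
      ∫ x, clampExp n (f x) ∂ν + 1 := by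
    have h2 := integral_rnDeriv_smul (μ := μ) (ν := ν) hac
      (f := fun x => Real.log (clampExp n (f x)))
    simp only [smul_eq_mul] at h2
    simp only [hφ]
    have h3 : Integrable (fun x => f x * Real.log (clampExp n (f x)) - clampExp n (f x)) ν :=
      (hlint n).sub (hgint n)
    rw [integral_add h3 (integrable_const 1),
      integral_sub (hlint n) (hgint n), h2]
    simp
  -- For F = log g with g the truncated density, e^F = g, and 1 − ∫ g dν ≤ −log ∫ g dν turns the
  -- bound on ∫ φ dν into the Donsker–Varadhan form.
  simp only [Real.exp_log (clampExp_pos _ _)]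
  have hpos : 0 < ∫ x, clampExp n (f x) ∂ν := by
    refine (Real.exp_pos (-n)).trans_le ?_
    have := integral_mono (μ := ν) (integrable_const (Real.exp (-n))) (hgint n)
      fun x => le_clampExp n (f x)
    simpa using this
  linarith [Real.log_le_sub_one_of_pos hpos]

end DonskerVaradhan

section Blocks

/-! ### Blocks of cubes and limits along cubes -/

theorem tendsto_blockCount_div (d s : ℕ) :
    Tendsto (fun n : ℕ => (((2 * n / s : ℕ) : ℝ) / (2 * n : ℝ)) ^ d) atTop
      (𝓝 ((1 / s : ℝ) ^ d)) := by
  have h1 := (tendsto_nat_floor_mul_div_atTop (R := ℝ) (a := 1 / s) (by positivity)).comp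
    (tendsto_natCast_atTop_atTop (R := ℝ))
  have h2 := h1.comp (tendsto_id.const_mul_atTop' (r := 2) two_pos : Tendsto (fun n : ℕ => 2 * n)
    atTop atTop)
  refine (h2.congr fun n => ?_).pow d
  simp only [Function.comp_apply]
  rw [one_div_mul_eq_div, Nat.floor_div_eq_div]
  push_cast
  rfl

/-- A superadditivity lemma for sequences indexed by cubes. -/
theorem exists_tendsto_of_block_le (d g : ℕ) (hg : 0 < g) (a : ℕ → ℝ≥0∞)
    (h : ∀ m n q : ℕ, q * (2 * m + g) ≤ 2 * n → (q : ℝ≥0∞) ^ d * a m ≤ a n) :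
    ∃ L : ℝ≥0∞, Tendsto (fun n : ℕ => a n / ENNReal.ofReal ((2 * n : ℝ) ^ d)) atTop (𝓝 L) := by
  set b : ℕ → ℝ≥0∞ := fun n => a n / ENNReal.ofReal ((2 * n : ℝ) ^ d) with hb
  set L := liminf b atTop with hL
  -- Fix m and fill the cube of side 2n with ⌊2n/(2m+g)⌋^d blocks; then let n tend to infinity.
  have key : ∀ m : ℕ, a m ≤ ENNReal.ofReal ((2 * m + g : ℝ) ^ d) * L := by
    intro m
    have hs : (0 : ℝ) < ((2 * m + g : ℕ) : ℝ) := by exact_mod_cast (by lia)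
    have ht : Tendsto (fun n : ℕ => ENNReal.ofReal
        ((((2 * n / (2 * m + g) : ℕ) : ℝ) / (2 * n : ℝ)) ^ d) * a m) atTop
        (𝓝 (ENNReal.ofReal ((1 / ((2 * m + g : ℕ) : ℝ)) ^ d) * a m)) := by
      refine ENNReal.Tendsto.mul_const
        ((ENNReal.continuous_ofReal.tendsto _).comp (tendsto_blockCount_div d (2 * m + g)))
        (Or.inl ?_)
      rw [ne_eq, ENNReal.ofReal_eq_zero, not_le]
      positivity
    have hle : ENNReal.ofReal ((1 / ((2 * m + g : ℕ) : ℝ)) ^ d) * a m ≤ L := by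
      rw [← ht.liminf_eq]
      refine liminf_le_liminf ?_
      filter_upwards [eventually_gt_atTop 0] with n hn
      have hn' : (0 : ℝ) < 2 * n := by positivity
      rw [hb, div_pow, ENNReal.ofReal_div_of_pos (by positivity)]
      simp only [div_eq_mul_inv]
      rw [mul_right_comm]
      refine mul_le_mul_left ?_ _
      rw [ENNReal.ofReal_pow (by positivity), ENNReal.ofReal_natCast]
      exact h m n _ (Nat.div_mul_le_self _ _)
    calc a m = ENNReal.ofReal ((2 * m + g : ℝ) ^ d) *
          (ENNReal.ofReal ((1 / ((2 * m + g : ℕ) : ℝ)) ^ d) * a m) := by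
          rw [← mul_assoc, ← ENNReal.ofReal_mul (by positivity), ← mul_pow]
          push_cast at hs ⊢
          rw [mul_one_div_cancel hs.ne', one_pow, ENNReal.ofReal_one, one_mul]
      _ ≤ _ := mul_le_mul_right hle _
  -- The gaps of width g cost the factor ((2n+g)/(2n))^d, which tends to one.
  refine ⟨L, tendsto_of_le_liminf_of_limsup_le le_rfl ?_⟩
  have ht : Tendsto (fun n : ℕ => ENNReal.ofReal (((2 * n + g : ℝ) / (2 * n)) ^ d) * L) atTop
      (𝓝 L) := by
    have h1 : Tendsto (fun n : ℕ => ((2 * n + g : ℝ) / (2 * n)) ^ d) atTop (𝓝 1) := by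
      have h2 : Tendsto (fun n : ℕ => 1 + (g / 2 : ℝ) / n) atTop (𝓝 (1 + 0)) :=
        (tendsto_const_div_atTop_nhds_zero_nat _).const_add 1
      rw [add_zero] at h2
      have h3 := h2.pow d
      rw [one_pow] at h3
      refine h3.congr' ?_
      filter_upwards [eventually_gt_atTop 0] with n hn
      have hn' : (0 : ℝ) < n := by exact_mod_cast hn
      congr 1
      field_simp
    have h4 := ENNReal.Tendsto.mul_const (b := L)
      ((ENNReal.continuous_ofReal.tendsto _).comp h1) (Or.inl (by simp))
    simpa using h4
  rw [← ht.limsup_eq]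
  refine limsup_le_limsup ?_
  filter_upwards [eventually_gt_atTop 0] with n hn
  have hn' : (0 : ℝ) < 2 * n := by positivity
  rw [hb, div_pow, ENNReal.ofReal_div_of_pos (by positivity)]
  simp only [div_eq_mul_inv]
  rw [mul_right_comm]
  exact mul_le_mul_left (key n) _

variable {d : ℕ}

theorem vol_cube (d n : ℕ) : vol (cube d n) = (2 * n : ℝ) ^ d := by
  have h1 : (cube d n).1 = (WithLp.ofLp : Space d → (Fin d → ℝ)) ⁻¹'
      (Set.Icc (fun _ => -(n : ℝ)) fun _ => (n : ℝ)) := by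
    ext x
    simp [cube, Pi.le_def, forall_and]
  rw [vol, h1, (PiLp.volume_preserving_ofLp (Fin d)).measure_preimage
    measurableSet_Icc.nullMeasurableSet, Real.volume_Icc_pi_toReal]
  · simp only [sub_neg_eq_add, Finset.prod_const, Finset.card_univ, Fintype.card_fin]
    ring
  · intro i
    have : (0 : ℝ) ≤ n := Nat.cast_nonneg n
    simp only
    linarith

theorem vol_cube_pos (d : ℕ) {n : ℕ} (hn : 0 < n) : 0 < vol (cube d n) := by
  rw [vol_cube]
  positivity

/-- Centers of a regular array of cubes of side `2 m` with gaps `g` in the cube `[-n, n]^d`. -/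
def blockCenter (n m g : ℕ) {q : ℕ} (z : Fin d → Fin q) : Space d :=
  WithLp.toLp 2 fun i => -(n : ℝ) + m + (z i : ℕ) * (2 * m + g)

/-- The cubes of a regular array. -/
def block (n m g : ℕ) {q : ℕ} (z : Fin d → Fin q) : Window d :=
  (cube d m).translate (blockCenter n m g z)

theorem mem_block {n m g q : ℕ} {z : Fin d → Fin q} {x : Space d} :
    x ∈ (block n m g z).1 ↔ ∀ i, |x i - (-(n : ℝ) + m + (z i : ℕ) * (2 * m + g))| ≤ m := by
  simp [block, Window.translate, cube, blockCenter, abs_le, sub_eq_add_neg]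

theorem block_subset {n m g q : ℕ} (h : q * (2 * m + g) ≤ 2 * n) (z : Fin d → Fin q) :
    (block n m g z).1 ⊆ (cube d n).1 := by
  intro x hx i
  have h1 := abs_le.1 (mem_block.1 hx i)
  have h2 : (((z i : ℕ) : ℝ) + 1) * (2 * m + g) ≤ 2 * n := by
    have h3 : ((z i : ℕ) + 1) * (2 * m + g) ≤ 2 * n :=
      (Nat.mul_le_mul_right _ (z i).2).trans h
    exact_mod_cast h3
  have h4 : (0 : ℝ) ≤ (z i : ℕ) * (2 * m + g) := by positivity
  have h5 : (0 : ℝ) ≤ g := Nat.cast_nonneg g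
  constructor <;> nlinarith

/-- In a coordinate where the indices differ, the centres are at least 2m + g apart, whereas a
common point would bring them closer than that. -/
theorem disjoint_thicken_block {n m g q : ℕ} {R : ℝ} (hR : 0 ≤ R) (hg : R < g)
    {z z' : Fin d → Fin q} (hz : z ≠ z') :
    Disjoint ((block n m g z).thicken R).1 (block n m g z').1 := by
  rw [Set.disjoint_left]
  intro x hx hx'
  -- The closed thickening is covered by closed balls of any radius strictly larger than R.
  obtain ⟨R', hR', hRg⟩ := exists_between hg
  have h := Metric.cthickening_subset_iUnion_closedBall_of_lt (block n m g z).1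
    (hR.trans_lt hR') hR' hx
  simp only [Set.mem_iUnion, exists_prop] at h
  obtain ⟨y, hy, hxy⟩ := h
  have h1 : ‖x - y‖ ≤ R' := by simpa [dist_eq_norm] using hxy
  obtain ⟨i, hi⟩ := Function.ne_iff.1 hz
  have h2 := (PiLp.norm_apply_le (x - y) i).trans h1
  rw [Real.norm_eq_abs, PiLp.sub_apply] at h2
  have h3 := mem_block.1 hy i
  have h4 := mem_block.1 hx' i
  have h5 : (1 : ℝ) ≤ |((z i : ℕ) : ℝ) - ((z' i : ℕ) : ℝ)| := by
    have : ((z i : ℕ) : ℤ) - ((z' i : ℕ) : ℤ) ≠ 0 := by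
      intro h0
      exact hi (Fin.ext (by lia))
    exact_mod_cast Int.one_le_abs this
  have h6 : (2 * m + g : ℝ) ≤ |(((z i : ℕ) : ℝ) - ((z' i : ℕ) : ℝ)) * (2 * m + g)| := by
    rw [abs_mul, abs_of_nonneg (by positivity : (0 : ℝ) ≤ 2 * m + g)]
    have : (0 : ℝ) ≤ 2 * m + g := by positivity
    nlinarith
  rw [abs_le] at h2 h3 h4
  rcases abs_cases ((((z i : ℕ) : ℝ) - ((z' i : ℕ) : ℝ)) * (2 * m + g)) with h7 | h7 <;>
    nlinarith

theorem disjoint_block {n m g q : ℕ} (hg : 0 < g) {z z' : Fin d → Fin q} (hz : z ≠ z') :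
    Disjoint (block n m g z).1 (block n m g z').1 :=
  (disjoint_thicken_block le_rfl (by exact_mod_cast hg) hz).mono_left (subset_thicken _ _)

end Blocks

section Pressure

variable {d : ℕ}

/-! ### The pressure -/

theorem glue_empty_right_of_subset {Λ : Window d} {ω : Config d} (h : ω.1 ⊆ Λ.1) :
    glue Λ ω (emptyConfig d) = ω :=
  Config.ext fun x => by
    simp only [glue, emptyConfig, ofFinite, Set.mem_union, Set.mem_inter_iff,
      Set.mem_empty_iff_false, false_and, or_false, and_iff_left_iff_imp]
    exact fun hx => h hx

/-- Without its normalization, the Poisson integral over the smaller window is the part of the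
larger one carried by configurations with no point in the difference. -/
theorem exp_vol_mul_lintegral_poisson_mono {Λ Λ' : Window d} (h : Λ'.1 ⊆ Λ.1)
    {F : Config d → ℝ≥0∞} (hF : Measurable F) :
    ENNReal.ofReal (Real.exp (vol Λ')) * ∫⁻ ω, F ω ∂(poisson Λ') ≤
      ENNReal.ofReal (Real.exp (vol Λ)) * ∫⁻ ω, F ω ∂(poisson Λ) := by
  have hm : Measurable fun ω₂ => ∫⁻ ω₁, F (glue Λ' ω₁ ω₂) ∂(poisson Λ') :=
    Measurable.lintegral_prod_right' (f := fun z : Config d × Config d => F (glue Λ' z.2 z.1))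
      (hF.comp ((measurable_glue Λ').comp measurable_swap))
  have h1 := poisson_lintegral_ge (Λ.diff Λ') hm
  have h2 : ∫⁻ ω₁, F (glue Λ' ω₁ (emptyConfig d)) ∂(poisson Λ') = ∫⁻ ω, F ω ∂(poisson Λ') := by
    refine lintegral_congr_ae ?_
    filter_upwards [ae_poisson_subset Λ'] with ω hω
    rw [glue_empty_right_of_subset hω]
  rw [lintegral_poisson_split h hF]
  refine le_trans (le_of_eq ?_) (mul_le_mul_right h1 _)
  rw [h2, ← mul_assoc, ← ENNReal.ofReal_mul (Real.exp_pos _).le, ← Real.exp_add,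
    ← vol_add_vol_diff h]
  congr 3
  ring

/-- The partition function with free boundary condition, with respect to the unnormalized
Poisson process. -/
def freeZ (H : Energy d) (Λ : Window d) : ℝ≥0∞ :=
  ENNReal.ofReal (Real.exp (vol Λ)) * ∫⁻ ω, boltz H Λ ω ∂(poisson Λ)

namespace IsAdmissible

variable {H : Energy d} {R : ℝ}

/-- The empty configuration alone contributes one. -/
theorem one_le_freeZ (hH : IsAdmissible H R) (Λ : Window d) : 1 ≤ freeZ H Λ := by
  have h1 := poisson_lintegral_ge Λ (hH.measurable_boltz Λ)
  rw [hH.boltz_empty Λ (ω := emptyConfig d) (Set.empty_inter _), mul_one] at h1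
  refine le_trans (le_of_eq ?_) (mul_le_mul_right h1 _)
  rw [← ENNReal.ofReal_mul (Real.exp_pos _).le, ← Real.exp_add]
  simp

theorem exists_freeZ_le (hH : IsAdmissible H R) :
    ∃ C : ℝ, ∀ Λ, freeZ H Λ ≤ ENNReal.ofReal (Real.exp (vol Λ * C)) := by
  obtain ⟨A, hA0, hA⟩ := hH.exists_boltz_le
  refine ⟨Real.exp (max A 0), fun Λ => ?_⟩
  refine (mul_le_mul_right ((lintegral_mono (hA Λ)).trans
    (lintegral_exp_count_poisson_le Λ A)) _).trans (le_of_eq ?_)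
  rw [← ENNReal.ofReal_mul (Real.exp_pos _).le, ← Real.exp_add]
  congr 2
  ring

theorem freeZ_ne_top (hH : IsAdmissible H R) (Λ : Window d) : freeZ H Λ ≠ ⊤ := by
  obtain ⟨C, hC⟩ := hH.exists_freeZ_le
  exact ((hC Λ).trans_lt ENNReal.ofReal_lt_top).ne

theorem boltz_translate (hH : IsAdmissible H R) (u : Space d) (Λ : Window d) (ω : Config d) :
    boltz H (Λ.translate u) (shift u ω) = boltz H Λ ω := by
  rw [boltz, boltz, hH.stat (finRestrict Λ ω) u]
  congr 3
  refine Subtype.ext (Config.ext fun x => ?_)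
  change x ∈ (shift u ω).1 ∩ (Λ.translate u).1 ↔ x ∈ (shift u (restrict Λ.1 ω)).1
  rw [mem_shift, Set.mem_inter_iff, mem_shift]
  rfl

theorem freeZ_translate (hH : IsAdmissible H R) (u : Space d) (Λ : Window d) :
    freeZ H (Λ.translate u) = freeZ H Λ := by
  rw [freeZ, freeZ, vol_translate, lintegral_poisson_translate u Λ (hH.measurable_boltz _)]
  simp only [hH.boltz_translate]

/-- Configurations with points in the corridor between B and the rest of the window are discarded;
for the others the Boltzmann weight factorizes. -/
theorem freeZ_mul_le (hH : IsAdmissible H R) {B Λ : Window d} (hB : B.1 ⊆ Λ.1) :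
    freeZ H B * freeZ H (Λ.diff (B.thicken R)) ≤ freeZ H Λ := by
  set Λ' := Λ.diff (B.thicken R) with hΛ'
  have hsub : Λ'.1 ⊆ (Λ.diff B).1 := fun x hx => ⟨hx.1, fun h => hx.2 (subset_thicken B R h)⟩
  have hm : Measurable fun ω₂ => ∫⁻ ω₁, boltz H Λ (glue B ω₁ ω₂) ∂(poisson B) :=
    Measurable.lintegral_prod_right'
      (f := fun z : Config d × Config d => boltz H Λ (glue B z.2 z.1))
      ((hH.measurable_boltz Λ).comp ((measurable_glue B).comp measurable_swap))
  have h1 := exp_vol_mul_lintegral_poisson_mono hsub hm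
  have h2 : ∫⁻ ω₂, ∫⁻ ω₁, boltz H Λ (glue B ω₁ ω₂) ∂(poisson B) ∂(poisson Λ') =
      (∫⁻ ω, boltz H Λ' ω ∂(poisson Λ')) * ∫⁻ ω, boltz H B ω ∂(poisson B) := by
    rw [← lintegral_mul_const _ (hH.measurable_boltz Λ')]
    refine lintegral_congr_ae ?_
    filter_upwards [ae_poisson_subset Λ'] with ξ hξ
    rw [← lintegral_const_mul _ (hH.measurable_boltz B)]
    exact lintegral_congr fun η => hH.boltz_glue_isolated hB hξ
  calc freeZ H B * freeZ H Λ' = ENNReal.ofReal (Real.exp (vol B)) *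
        (ENNReal.ofReal (Real.exp (vol Λ')) *
          ((∫⁻ ω, boltz H Λ' ω ∂(poisson Λ')) * ∫⁻ ω, boltz H B ω ∂(poisson B))) := by
        rw [freeZ, freeZ]
        ring
    _ ≤ ENNReal.ofReal (Real.exp (vol B)) * (ENNReal.ofReal (Real.exp (vol (Λ.diff B))) *
          ∫⁻ ω₂, ∫⁻ ω₁, boltz H Λ (glue B ω₁ ω₂) ∂(poisson B) ∂(poisson (Λ.diff B))) := by
        rw [← h2]
        exact mul_le_mul_right h1 _
    _ = freeZ H Λ := by
        rw [← lintegral_poisson_split hB (hH.measurable_boltz Λ), ← mul_assoc,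
          ← ENNReal.ofReal_mul (Real.exp_pos _).le, ← Real.exp_add, vol_add_vol_diff hB, freeZ]

/-- Blocks are split off one at a time; the remaining ones avoid the thickening of the block just
removed. -/
theorem prod_freeZ_le (hH : IsAdmissible H R) {ι : Type*} (B : ι → Window d) (J : Finset ι)
    (hB : ∀ i j, i ≠ j → Disjoint ((B i).thicken R).1 (B j).1) (Λ : Window d)
    (hΛ : ∀ i ∈ J, (B i).1 ⊆ Λ.1) : ∏ i ∈ J, freeZ H (B i) ≤ freeZ H Λ := by
  classical
  induction J using Finset.induction_on generalizing Λ with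
  | empty => simpa using hH.one_le_freeZ Λ
  | insert i J hi ih =>
    rw [Finset.prod_insert hi]
    refine le_trans (mul_le_mul_right (ih (Λ.diff ((B i).thicken R)) fun j hj x hx => ?_) _)
      (hH.freeZ_mul_le (hΛ i (Finset.mem_insert_self i J)))
    exact ⟨hΛ j (Finset.mem_insert_of_mem hj) hx, fun hx' =>
      Set.disjoint_left.1 (hB i j (fun h => hi (h ▸ hj))) hx' hx⟩

theorem log_freeZ_nonneg (hH : IsAdmissible H R) (Λ : Window d) :
    0 ≤ Real.log (freeZ H Λ).toReal := by
  refine Real.log_nonneg ?_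
  have := ENNReal.toReal_mono (hH.freeZ_ne_top Λ) (hH.one_le_freeZ Λ)
  simpa using this

theorem log_freeZ_mono (hH : IsAdmissible H R) {Λ : Window d} {z : ℝ≥0∞} (h : freeZ H Λ ≤ z)
    (hz : z ≠ ⊤) : Real.log (freeZ H Λ).toReal ≤ Real.log z.toReal := by
  refine Real.log_le_log ?_ (ENNReal.toReal_mono hz h)
  exact ENNReal.toReal_pos (zero_lt_one.trans_le (hH.one_le_freeZ Λ)).ne' (hH.freeZ_ne_top Λ)

theorem exists_tendsto_log_freeZ (hH : IsAdmissible H R) :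
    ∃ L : ℝ, Tendsto (fun n : ℕ => Real.log (freeZ H (cube d n)).toReal / vol (cube d n)) atTop
      (𝓝 L) := by
  -- Gaps wider than the range, so that blocks do not interact.
  obtain ⟨g, hg⟩ := exists_nat_gt R
  have hg0 : 0 < g := by exact_mod_cast hH.range_nonneg.trans_lt hg
  obtain ⟨C, hC⟩ := hH.exists_freeZ_le
  obtain ⟨L, hL⟩ := exists_tendsto_of_block_le d g hg0
    (fun n => ENNReal.ofReal (Real.log (freeZ H (cube d n)).toReal)) (by
      intro m n q hq
      have h1 := hH.prod_freeZ_le (fun z : Fin d → Fin q => block n m g z) Finset.univ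
        (fun z z' hz => disjoint_thicken_block hH.range_nonneg hg hz) (cube d n)
        (fun z _ => block_subset hq z)
      simp only [block, hH.freeZ_translate, Finset.prod_const, Finset.card_univ,
        Fintype.card_pi, Fintype.card_fin] at h1
      rw [← ENNReal.ofReal_natCast, ← ENNReal.ofReal_pow (Nat.cast_nonneg q),
        ← ENNReal.ofReal_mul (by positivity)]
      refine ENNReal.ofReal_le_ofReal ?_
      have h2 := ENNReal.toReal_mono (hH.freeZ_ne_top _) h1
      have h3 : 0 < (freeZ H (cube d m)).toReal :=
        ENNReal.toReal_pos (zero_lt_one.trans_le (hH.one_le_freeZ _)).ne' (hH.freeZ_ne_top _)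
      rw [ENNReal.toReal_pow] at h2
      have h4 := Real.log_le_log (by positivity) h2
      rw [Real.log_pow] at h4
      push_cast at h4
      exact h4)
  have hL' : L ≠ ⊤ := by
    have : L ≤ ENNReal.ofReal C := by
      refine le_of_tendsto hL ?_
      filter_upwards [eventually_gt_atTop 0] with n hn
      rw [← vol_cube, ← ENNReal.ofReal_div_of_pos (vol_cube_pos d hn)]
      refine ENNReal.ofReal_le_ofReal ?_
      rw [div_le_iff₀ (vol_cube_pos d hn)]
      refine (hH.log_freeZ_mono (hC _) ENNReal.ofReal_ne_top).trans ?_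
      rw [ENNReal.toReal_ofReal (Real.exp_pos _).le, Real.log_exp, mul_comm]
    exact (this.trans_lt ENNReal.ofReal_lt_top).ne
  refine ⟨L.toReal, ((ENNReal.tendsto_toReal hL').comp hL).congr fun n => ?_⟩
  rw [Function.comp_apply, ENNReal.toReal_div, ENNReal.toReal_ofReal (hH.log_freeZ_nonneg _),
    ENNReal.toReal_ofReal (by positivity), vol_cube]

theorem partitionFn_empty (hH : IsAdmissible H R) (Λ : Window d) :
    partitionFn H R Λ (emptyConfig d) = ∫⁻ ω, boltz H Λ ω ∂(poisson Λ) := by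
  rw [partitionFn]
  refine lintegral_congr fun η => ?_
  have h1 : finRestrict (Λ.thicken R) (glue Λ η (emptyConfig d)) = finRestrict Λ η :=
    finRestrict_congr fun x => by
      rw [mem_glue]
      constructor
      · rintro ⟨hx | hx, -⟩
        · exact hx
        · exact absurd hx.1 (Set.notMem_empty x)
      · exact fun hx => ⟨Or.inl hx, subset_thicken Λ R hx.2⟩
  have h2 : H (finRestrict ((Λ.thicken R).diff Λ) (glue Λ η (emptyConfig d))) = 0 := by
    refine hH.energy_empty (Set.eq_empty_iff_forall_notMem.2 ?_)
    rintro x ⟨hx | hx, hx'⟩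
    · exact hx'.2 hx.2
    · exact Set.notMem_empty x hx.1
  rw [localEnergy, energyDiff, h1, h2, esub, if_neg (by simp), sub_zero, boltz]

theorem log_lintegral_boltz (hH : IsAdmissible H R) (Λ : Window d) :
    Real.log (∫⁻ ω, boltz H Λ ω ∂(poisson Λ)).toReal =
      Real.log (freeZ H Λ).toReal - vol Λ := by
  have h1 : ∫⁻ ω, boltz H Λ ω ∂(poisson Λ) =
      ENNReal.ofReal (Real.exp (-vol Λ)) * freeZ H Λ := by
    rw [freeZ, ← mul_assoc, ← ENNReal.ofReal_mul (Real.exp_pos _).le, ← Real.exp_add]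
    simp
  rw [h1, ENNReal.toReal_mul, ENNReal.toReal_ofReal (Real.exp_pos _).le, Real.log_mul
    (Real.exp_pos _).ne' (ENNReal.toReal_pos (zero_lt_one.trans_le (hH.one_le_freeZ _)).ne'
      (hH.freeZ_ne_top _)).ne', Real.log_exp]
  ring

theorem lintegral_boltz_ne_zero (hH : IsAdmissible H R) (Λ : Window d) :
    ∫⁻ ω, boltz H Λ ω ∂(poisson Λ) ≠ 0 := by
  intro h
  have := hH.one_le_freeZ Λ
  rw [freeZ, h, mul_zero] at this
  simp at this

theorem lintegral_boltz_ne_top (hH : IsAdmissible H R) (Λ : Window d) :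
    ∫⁻ ω, boltz H Λ ω ∂(poisson Λ) ≠ ⊤ := by
  intro h
  refine hH.freeZ_ne_top Λ ?_
  rw [freeZ, h, ENNReal.mul_top]
  simpa using Real.exp_pos _

theorem hasPressure (hH : IsAdmissible H R) {L : ℝ}
    (hL : Tendsto (fun n : ℕ => Real.log (freeZ H (cube d n)).toReal / vol (cube d n)) atTop
      (𝓝 L)) : HasPressure H R (L - 1) := by
  have h1 := EReal.tendsto_coe.2 (hL.sub_const 1)
  refine h1.congr' ?_
  filter_upwards [eventually_gt_atTop 0] with n hn
  change _ = ENNReal.log (partitionFn H R (cube d n) (emptyConfig d)) / (vol (cube d n) : EReal)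
  rw [hH.partitionFn_empty, ENNReal.log_pos_real (hH.lintegral_boltz_ne_zero _)
    (hH.lintegral_boltz_ne_top _), hH.log_lintegral_boltz, ← EReal.coe_div, sub_div,
    div_self (vol_cube_pos d hn).ne']

end IsAdmissible

end Pressure

section SpecificEntropy

variable {d : ℕ}

/-! ### Local functions and the specific entropy -/

/-- `f` depends only on the points in `S`. -/
def IsLocalOn {β : Type*} (S : Set (Space d)) (f : Config d → β) : Prop :=
  ∀ ω, f (restrict S ω) = f ω

theorem IsLocalOn.congr {β : Type*} {S : Set (Space d)} {f : Config d → β} (hf : IsLocalOn S f)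
    {ω ω' : Config d} (h : restrict S ω = restrict S ω') : f ω = f ω' := by
  rw [← hf ω, h, hf ω']

theorem IsLocalOn.mono {β : Type*} {S S' : Set (Space d)} {f : Config d → β} (hf : IsLocalOn S f)
    (h : S ⊆ S') : IsLocalOn S' f := fun ω => by
  rw [← hf, restrict_restrict_of_subset h, hf]

theorem restrict_shift_neg (a : Space d) (Λ : Window d) (ω : Config d) :
    restrict Λ.1 (shift (-a) ω) = shift (-a) (restrict (Λ.translate a).1 ω) :=
  Config.ext fun x => by
    rw [mem_shift]
    simp [restrict, mem_shift, mem_translate]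

theorem IsLocalOn.shift {β : Type*} {Λ : Window d} {f : Config d → β} (hf : IsLocalOn Λ.1 f)
    (a : Space d) : IsLocalOn (Λ.translate a).1 fun ω => f (shift (-a) ω) := fun ω => by
  simp only
  rw [← restrict_shift_neg, hf]

theorem isLocalOn_comp_restrict {β : Type*} (S : Set (Space d)) (f : Config d → β) :
    IsLocalOn S fun ω => f (restrict S ω) := fun ω => by
  simp only
  rw [restrict_restrict_of_subset subset_rfl]

theorem restrict_glue_of_subset {Λ : Window d} {S : Set (Space d)} (h : S ⊆ Λ.1)
    (η ξ : Config d) : restrict S (glue Λ η ξ) = restrict S η :=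
  Config.ext fun x => by
    simp only [restrict, glue, Set.mem_inter_iff, Set.mem_union, Set.mem_compl_iff]
    refine and_congr_left fun hx => ?_
    simp [h hx]

theorem restrict_glue_of_disjoint {Λ : Window d} {S : Set (Space d)} (h : Disjoint Λ.1 S)
    (η ξ : Config d) : restrict S (glue Λ η ξ) = restrict S ξ :=
  Config.ext fun x => by
    simp only [restrict, glue, Set.mem_inter_iff, Set.mem_union, Set.mem_compl_iff]
    refine and_congr_left fun hx => ?_
    simp [Set.disjoint_right.1 h hx]

theorem restrict_of_subset {S : Set (Space d)} {ω : Config d} (h : ω.1 ⊆ S) :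
    restrict S ω = ω := Subtype.ext (Set.inter_eq_left.2 h)

/-- Functions of the restrictions to disjoint windows are independent under the Poisson process. -/
theorem lintegral_prod_poisson {ι : Type*} (B : ι → Window d) (J : Finset ι)
    (hB : ∀ i j, i ≠ j → Disjoint (B i).1 (B j).1) (W : ι → Config d → ℝ≥0∞)
    (hW : ∀ i, Measurable (W i)) (hloc : ∀ i, IsLocalOn (B i).1 (W i)) (Λ : Window d)
    (hΛ : ∀ i ∈ J, (B i).1 ⊆ Λ.1) :
    ∫⁻ ω, ∏ i ∈ J, W i ω ∂(poisson Λ) = ∏ i ∈ J, ∫⁻ ω, W i ω ∂(poisson (B i)) := by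
  classical
  induction J using Finset.induction_on generalizing Λ with
  | empty => simp
  | insert i J hi ih =>
    have hne : ∀ j ∈ J, i ≠ j := fun j hj h => hi (h ▸ hj)
    rw [lintegral_poisson_split (hΛ i (Finset.mem_insert_self i J))
      (Finset.measurable_fun_prod _ fun j _ => hW j), Finset.prod_insert hi,
      ← ih (Λ.diff (B i)) fun j hj x hx => ⟨hΛ j (Finset.mem_insert_of_mem hj) hx,
        Set.disjoint_right.1 (hB i j (hne j hj)) hx⟩, ← lintegral_const_mul _
        (Finset.measurable_fun_prod _ fun j _ => hW j)]
    refine lintegral_congr fun ξ => ?_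
    rw [← lintegral_mul_const _ (hW i)]
    refine lintegral_congr fun η => ?_
    rw [Finset.prod_insert hi]
    congr 1
    · exact (hloc i).congr (restrict_glue_of_subset subset_rfl η ξ)
    · exact Finset.prod_congr rfl fun j hj =>
        (hloc j).congr (restrict_glue_of_disjoint (hB i j (hne j hj)) η ξ)

theorem IsStationaryFI.integral_shift {P : Measure (Config d)} (hP : IsStationaryFI P)
    {f : Config d → ℝ} (hf : Measurable f) (u : Space d) :
    ∫ ω, f (shift u ω) ∂P = ∫ ω, f ω ∂P := by
  conv_rhs => rw [← hP.stationary u]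
  rw [integral_map (measurable_shift u).aemeasurable hf.aestronglyMeasurable]

/-- The restriction of `P` to the cube `[-n, n]^d`. -/
abbrev cubeLaw (P : Measure (Config d)) (n : ℕ) : Measure (Config d) :=
  P.map (restrict (cube d n).1)

theorem isProbabilityMeasure_cubeLaw {P : Measure (Config d)} (hP : IsStationaryFI P) (n : ℕ) :
    IsProbabilityMeasure (cubeLaw P n) :=
  have := hP.prob
  Measure.isProbabilityMeasure_map (measurable_restrict (cube d n).2.1).aemeasurable

/-- Each translate depends only on points in a block inside the large cube, so `cubeLaw` and P give
it the same mean, and stationarity makes these means equal. -/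
theorem integral_sum_shift {P : Measure (Config d)} (hP : IsStationaryFI P) {m n g q : ℕ}
    (hq : q * (2 * m + g) ≤ 2 * n) {f : Config d → ℝ} (hf : Measurable f)
    (hb : ∃ C, ∀ ω, |f ω| ≤ C) (hloc : IsLocalOn (cube d m).1 f) :
    Integrable (fun ω => ∑ z : Fin d → Fin q, f (shift (-blockCenter n m g z) ω)) (cubeLaw P n) ∧
    ∫ ω, ∑ z : Fin d → Fin q, f (shift (-blockCenter n m g z) ω) ∂(cubeLaw P n) =
      (q : ℝ) ^ d * ∫ ω, f ω ∂P := by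
  have := isProbabilityMeasure_cubeLaw hP n
  obtain ⟨C, hC⟩ := hb
  have hm : ∀ u : Space d, Measurable fun ω => f (shift u ω) := fun u => hf.comp (measurable_shift u)
  have hint : ∀ u : Space d, Integrable (fun ω => f (shift u ω)) (cubeLaw P n) := fun u =>
    Integrable.of_bound (hm u).aestronglyMeasurable C (ae_of_all _ fun ω => hC _)
  refine ⟨integrable_finsetSum _ fun z _ => hint _, ?_⟩
  rw [integral_finsetSum _ fun z _ => hint _]
  have h1 : ∀ z : Fin d → Fin q,
      ∫ ω, f (shift (-blockCenter n m g z) ω) ∂(cubeLaw P n) = ∫ ω, f ω ∂P := by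
    intro z
    rw [integral_map (measurable_restrict (cube d n).2.1).aemeasurable
      (hm _).aestronglyMeasurable, ← hP.integral_shift hf (-blockCenter n m g z)]
    refine integral_congr_ae (ae_of_all _ fun ω => ?_)
    exact (hloc.shift (blockCenter n m g z)).mono (block_subset hq z) ω
  simp [h1]

/-- Superadditivity of relative entropy with a product reference measure. No independence of the
blocks under P is needed: expectations of sums add up, and only the Poisson exponential moment has
to factorize. -/
theorem block_mul_klDiv_le {P : Measure (Config d)} (hP : IsStationaryFI P) {m n g q : ℕ}
    (hg : 0 < g) (hq : q * (2 * m + g) ≤ 2 * n) :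
    (q : ℝ≥0∞) ^ d * InformationTheory.klDiv (cubeLaw P m) (poisson (cube d m)) ≤
      InformationTheory.klDiv (cubeLaw P n) (poisson (cube d n)) := by
  have := isProbabilityMeasure_cubeLaw hP n
  have := isProbabilityMeasure_cubeLaw hP m
  have hPp := hP.prob
  by_contra! hlt
  have hfin : InformationTheory.klDiv (cubeLaw P n) (poisson (cube d n)) ≠ ⊤ := hlt.ne_top
  have hN0 : (q : ℝ≥0∞) ^ d ≠ 0 := by
    intro h
    rw [h, zero_mul] at hlt
    exact not_lt_zero hlt
  have hNt : (q : ℝ≥0∞) ^ d ≠ ⊤ := ENNReal.pow_ne_top (ENNReal.natCast_ne_top q)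
  have hlt' : InformationTheory.klDiv (cubeLaw P n) (poisson (cube d n)) / (q : ℝ≥0∞) ^ d <
      InformationTheory.klDiv (cubeLaw P m) (poisson (cube d m)) := by
    rwa [ENNReal.div_lt_iff (Or.inl hN0) (Or.inl hNt), mul_comm]
  obtain ⟨c, -, hc1, hc2⟩ := ENNReal.lt_iff_exists_real_btwn.1 hlt'
  obtain ⟨F, hFm, ⟨C, hC⟩, hF⟩ := exists_bounded_of_lt_klDiv hc2
  -- F may depend on points outside the small cube; restricting first makes its translates local
  -- without changing the integrals involved.
  set G : Config d → ℝ := fun ω => F (restrict (cube d m).1 ω) with hG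
  have hGm : Measurable G := hFm.comp (measurable_restrict (cube d m).2.1)
  have hGloc : IsLocalOn (cube d m).1 G := isLocalOn_comp_restrict _ F
  obtain ⟨hint, hsum⟩ := integral_sum_shift hP hq hGm ⟨C, fun ω => hC _⟩ hGloc
  set W : (Fin d → Fin q) → Config d → ℝ≥0∞ := fun z ω =>
    ENNReal.ofReal (Real.exp (G (shift (-blockCenter n m g z) ω))) with hW
  have hWm : ∀ z, Measurable (W z) := fun z =>
    (hGm.comp (measurable_shift _)).exp.ennreal_ofReal
  have hlog : ∀ ω, Real.log (∏ z, W z ω).toReal =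
      ∑ z : Fin d → Fin q, G (shift (-blockCenter n m g z) ω) := by
    intro ω
    rw [hW, ← ENNReal.ofReal_prod_of_nonneg fun _ _ => (Real.exp_pos _).le,
      ENNReal.toReal_ofReal (Finset.prod_nonneg fun _ _ => (Real.exp_pos _).le), ← Real.exp_sum,
      Real.log_exp]
  have hE : Integrable (fun ω => Real.exp (F ω)) (poisson (cube d m)) :=
    Integrable.of_bound hFm.exp.aestronglyMeasurable (Real.exp C) (ae_of_all _ fun ω => by
      rw [Real.norm_eq_abs, Real.abs_exp]
      exact Real.exp_le_exp.2 ((le_abs_self _).trans (hC ω)))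
  have hEpos : 0 < ∫ ω, Real.exp (F ω) ∂(poisson (cube d m)) := integral_exp_pos hE
  have hZ : ∫⁻ ω, ∏ z, W z ω ∂(poisson (cube d n)) =
      ENNReal.ofReal (∫ ω, Real.exp (F ω) ∂(poisson (cube d m))) ^ q ^ d := by
    rw [lintegral_prod_poisson (fun z => block n m g z) Finset.univ
      (fun z z' hz => disjoint_block hg hz) W hWm
      (fun z ω => by
        have := hGloc.shift (blockCenter n m g z) ω
        simp only at this
        simp only [hW, block, this]) (cube d n) (fun z _ => block_subset hq z)]
    have h1 : ∀ z, ∫⁻ ω, W z ω ∂(poisson (block n m g z)) =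
        ENNReal.ofReal (∫ ω, Real.exp (F ω) ∂(poisson (cube d m))) := by
      intro z
      rw [block, lintegral_poisson_translate _ _ (hWm z),
        ofReal_integral_eq_lintegral_ofReal hE (ae_of_all _ fun _ => (Real.exp_pos _).le)]
      refine lintegral_congr_ae ?_
      filter_upwards [ae_poisson_subset (cube d m)] with ω hω
      simp only [hW, hG]
      rw [shift_neg_shift, restrict_of_subset hω]
    simp [h1]
  have hDV := integral_log_le_klDiv_add_log hfin (W := fun ω => ∏ z, W z ω)
    (Finset.measurable_fun_prod _ fun z _ => hWm z)
    (by rw [hZ]; exact pow_ne_zero _ (by simpa using hEpos))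
    (by rw [hZ]; exact ENNReal.pow_ne_top ENNReal.ofReal_ne_top)
    (ae_of_all _ fun ω => ⟨Finset.prod_ne_zero_iff.2 fun z _ => by
      simp only [hW]; simpa using Real.exp_pos _,
      ENNReal.prod_ne_top fun z _ => ENNReal.ofReal_ne_top⟩)
    (by simpa only [hlog] using hint)
  simp only [hlog] at hDV
  rw [hsum, hZ, ENNReal.toReal_pow, ENNReal.toReal_ofReal hEpos.le, Real.log_pow] at hDV
  have hmap : ∫ ω, F ω ∂(cubeLaw P m) = ∫ ω, G ω ∂P :=
    integral_map (measurable_restrict (cube d m).2.1).aemeasurable hFm.aestronglyMeasurable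
  rw [hmap] at hF
  rw [ENNReal.div_lt_iff (Or.inl hN0) (Or.inl hNt)] at hc1
  have hq0 : (0 : ℝ) < (q : ℝ) ^ d := by
    have : q ^ d ≠ 0 := by exact_mod_cast hN0
    exact_mod_cast Nat.pos_of_ne_zero this
  have hc3 : (InformationTheory.klDiv (cubeLaw P n) (poisson (cube d n))).toReal <
      c * (q : ℝ) ^ d := by
    rw [← ENNReal.ofReal_natCast, ← ENNReal.ofReal_pow (Nat.cast_nonneg q),
      ← ENNReal.ofReal_mul' hq0.le] at hc1
    exact ENNReal.toReal_lt_of_lt_ofReal hc1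
  push_cast at hDV
  nlinarith

theorem ereal_coe_div {v : ℝ} (hv : 0 < v) (a : ℝ≥0∞) :
    ((a / ENNReal.ofReal v : ℝ≥0∞) : EReal) = (a : EReal) / (v : EReal) := by
  induction a with
  | top =>
    rw [ENNReal.top_div_of_ne_top ENNReal.ofReal_ne_top, EReal.coe_ennreal_top,
      EReal.top_div_of_pos_ne_top (by exact_mod_cast hv) (EReal.coe_ne_top v)]
  | coe a =>
    have h1 : ((a : ℝ≥0∞) / ENNReal.ofReal v) = ENNReal.ofReal ((a : ℝ) / v) := by
      rw [ENNReal.ofReal_div_of_pos hv, ENNReal.ofReal_coe_nnreal]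
    rw [h1, EReal.coe_ennreal_ofReal, max_eq_left (by positivity), EReal.coe_div]
    rfl

theorem exists_hasSpecificEntropy {P : Measure (Config d)} (hP : IsStationaryFI P) :
    ∃ I : EReal, 0 ≤ I ∧ HasSpecificEntropy P I := by
  obtain ⟨L, hL⟩ := exists_tendsto_of_block_le d 1 one_pos
    (fun n => InformationTheory.klDiv (cubeLaw P n) (poisson (cube d n)))
    fun m n q hq => block_mul_klDiv_le hP one_pos hq
  refine ⟨L, EReal.coe_ennreal_nonneg L, (EReal.tendsto_coe_ennreal.2 hL).congr' ?_⟩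
  filter_upwards [eventually_gt_atTop 0] with n hn
  rw [← vol_cube, ereal_coe_div (vol_cube_pos d hn)]

end SpecificEntropy

section MeanEnergy

variable {d : ℕ}

/-! ### Expected number of points and mean energy -/

theorem measurableSet_unitCube (d : ℕ) : MeasurableSet (unitCube d) := by
  simp only [unitCube, Set.ofPred_forall]
  exact MeasurableSet.iInter fun i =>
    measurableSet_Icc.preimage (EuclideanSpace.proj (𝕜 := ℝ) i).continuous.measurable

theorem unitCube_subset_cube (d : ℕ) : unitCube d ⊆ (cube d 1).1 := by
  intro x hx i
  have := hx i
  simp only [Nat.cast_one]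
  exact ⟨by linarith [this.1], this.2⟩

/-- The unit cube as a window. -/
def unitWindow (d : ℕ) : Window d :=
  ⟨unitCube d, measurableSet_unitCube d, (cube d 1).2.2.subset (unitCube_subset_cube d)⟩

/-- The lower corners of the unit cubes that tile `[-n, n]^d`. -/
def corner (n : ℕ) (z : Fin d → Fin (2 * n)) : Space d :=
  WithLp.toLp 2 fun i => -(n : ℝ) + (z i : ℕ)

theorem cube_subset_iUnion {n : ℕ} (hn : 0 < n) {x : Space d} (hx : x ∈ (cube d n).1) :
    ∃ z : Fin d → Fin (2 * n), x ∈ ((unitWindow d).translate (corner n z)).1 := by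
  -- The minimum matters on the face where the coordinate equals n and the floor is 2n.
  refine ⟨fun i => ⟨min ⌊x i + n⌋₊ (2 * n - 1), by lia⟩, ?_⟩
  intro i
  have h1 := hx i
  have h0 : 0 ≤ x i + n := by linarith [h1.1]
  have h2 := Nat.floor_le h0
  have h3 := Nat.lt_floor_add_one (x i + n)
  have h4 : ((2 * n - 1 : ℕ) : ℝ) = 2 * n - 1 := by
    rw [Nat.cast_sub (by lia)]
    push_cast
    ring
  simp only [corner, PiLp.add_apply, PiLp.neg_apply, Nat.cast_min, h4, Set.mem_Icc]
  rcases le_total (⌊x i + n⌋₊ : ℝ) (2 * n - 1) with h5 | h5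
  · rw [min_eq_left h5]
    constructor <;> linarith
  · rw [min_eq_right h5]
    constructor <;> linarith [h1.2]

theorem measurable_natCast_count (Λ : Window d) : Measurable fun ω => (count Λ.1 ω : ℝ≥0∞) :=
  (measurable_from_top (f := fun k : ℕ => (k : ℝ≥0∞))).comp (measurable_count Λ)

theorem IsStationaryFI.lintegral_count_translate {P : Measure (Config d)} (hP : IsStationaryFI P)
    (Λ : Window d) (a : Space d) :
    ∫⁻ ω, (count (Λ.translate a).1 ω : ℝ≥0∞) ∂P = ∫⁻ ω, (count Λ.1 ω : ℝ≥0∞) ∂P := by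
  conv_lhs => rw [← hP.stationary a]
  rw [lintegral_map (measurable_natCast_count _) (measurable_shift a)]
  refine lintegral_congr fun ω => ?_
  rw [← count_shift a Λ.1 ω]
  rfl

theorem IsStationaryFI.exists_lintegral_count_le {P : Measure (Config d)}
    (hP : IsStationaryFI P) : ∃ ρ : ℝ, 0 ≤ ρ ∧ ∀ n : ℕ, 0 < n →
      ∫⁻ ω, (count (cube d n).1 ω : ℝ≥0∞) ∂P ≤ ENNReal.ofReal (vol (cube d n) * ρ) := by
  refine ⟨(∫⁻ ω, (count (unitCube d) ω : ℝ≥0∞) ∂P).toReal, ENNReal.toReal_nonneg, fun n hn => ?_⟩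
  have h1 : ∀ ω : Config d, (count (cube d n).1 ω : ℝ≥0∞) ≤
      ∑ z : Fin d → Fin (2 * n), (count ((unitWindow d).translate (corner n z)).1 ω : ℝ≥0∞) := by
    intro ω
    have h2 : ω.1 ∩ (cube d n).1 ⊆ ⋃ z ∈ (Finset.univ : Finset (Fin d → Fin (2 * n))),
        (ω.1 ∩ ((unitWindow d).translate (corner n z)).1) := by
      rintro x ⟨hx, hx'⟩
      obtain ⟨z, hz⟩ := cube_subset_iUnion hn hx'
      exact Set.mem_biUnion (Finset.mem_univ z) ⟨hx, hz⟩
    have h3 := (Set.ncard_le_ncard h2 (Set.Finite.biUnion (Finset.finite_toSet _)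
      fun z _ => finite_inter_window ω _)).trans (Finset.set_ncard_biUnion_le _ _)
    exact_mod_cast h3
  refine (lintegral_mono h1).trans ?_
  rw [lintegral_finsetSum _ fun z _ => measurable_natCast_count _]
  simp only [hP.lintegral_count_translate]
  rw [vol_cube, ENNReal.ofReal_mul (by positivity), ENNReal.ofReal_toReal hP.intensity.ne]
  refine le_of_eq ?_
  simp only [Finset.sum_const, Finset.card_univ, Fintype.card_pi, Fintype.card_fin,
    Finset.prod_const, nsmul_eq_mul]
  congr 1
  rw [ENNReal.ofReal_pow (by positivity)]
  push_cast
  congr 1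
  rw [ENNReal.ofReal_mul two_pos.le]
  simp

theorem eintegral_eq_integral {P : Measure (Config d)} {f : Config d → EReal} (hf : Measurable f)
    (h1 : ∫⁻ ω, (f ω).toENNReal ∂P ≠ ⊤) (h2 : ∫⁻ ω, (-f ω).toENNReal ∂P ≠ ⊤) :
    (∀ᵐ ω ∂P, f ω ≠ ⊤ ∧ f ω ≠ ⊥) ∧ Integrable (fun ω => (f ω).toReal) P ∧
      eintegral P f = ((∫ ω, (f ω).toReal ∂P : ℝ) : EReal) := by
  have hm1 : Measurable fun ω => (f ω).toENNReal := hf.ereal_toENNReal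
  have hm2 : Measurable fun ω => (-f ω).toENNReal :=
    (continuous_neg.measurable.comp hf).ereal_toENNReal
  have hae : ∀ᵐ ω ∂P, f ω ≠ ⊤ ∧ f ω ≠ ⊥ := by
    filter_upwards [ae_lt_top hm1 h1, ae_lt_top hm2 h2] with ω hω hω'
    constructor
    · intro h
      simp [h] at hω
    · intro h
      simp [h] at hω'
  have he1 : ∫⁻ ω, ENNReal.ofReal (f ω).toReal ∂P = ∫⁻ ω, (f ω).toENNReal ∂P := by
    refine lintegral_congr_ae ?_
    filter_upwards [hae] with ω hω
    rw [EReal.toENNReal_of_ne_top hω.1]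
  have he2 : ∫⁻ ω, ENNReal.ofReal (-(f ω).toReal) ∂P = ∫⁻ ω, (-f ω).toENNReal ∂P := by
    refine lintegral_congr_ae ?_
    filter_upwards [hae] with ω hω
    rw [EReal.toENNReal_of_ne_top (by simpa using hω.2), EReal.toReal_neg_eq]
  have hint : Integrable (fun ω => (f ω).toReal) P := by
    refine ⟨hf.ereal_toReal.aestronglyMeasurable, ?_⟩
    rw [hasFiniteIntegral_iff_norm]
    have h3 : ∀ x : ℝ, ENNReal.ofReal ‖x‖ = ENNReal.ofReal x + ENNReal.ofReal (-x) := by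
      intro x
      rw [Real.norm_eq_abs]
      rcases le_total 0 x with hx | hx
      · rw [abs_of_nonneg hx, ENNReal.ofReal_of_nonpos (neg_nonpos.2 hx), add_zero]
      · rw [abs_of_nonpos hx, ENNReal.ofReal_of_nonpos hx, zero_add]
    simp only [h3]
    rw [lintegral_add_left hf.ereal_toReal.ennreal_ofReal, he1, he2]
    exact ENNReal.add_lt_top.2 ⟨lt_top_iff_ne_top.2 h1, lt_top_iff_ne_top.2 h2⟩
  refine ⟨hae, hint, ?_⟩
  rw [integral_eq_lintegral_pos_part_sub_lintegral_neg_part hint, he1, he2, eintegral]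
  rw [EReal.coe_sub, EReal.coe_ennreal_toReal h1, EReal.coe_ennreal_toReal h2]

/-- An infinite negative part makes the value ⊥, even when the positive part is infinite too. Thus a
finite limit of such integrals per volume carries eventual integrability with it. -/
theorem lintegral_ne_top_of_eintegral {P : Measure (Config d)} {f : Config d → EReal}
    (h : eintegral P f ≠ ⊤) (h' : eintegral P f ≠ ⊥) :
    ∫⁻ ω, (f ω).toENNReal ∂P ≠ ⊤ ∧ ∫⁻ ω, (-f ω).toENNReal ∂P ≠ ⊤ := by
  rw [eintegral] at h h'
  have h2 : ∫⁻ ω, (-f ω).toENNReal ∂P ≠ ⊤ := by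
    intro h2
    rw [h2] at h'
    simp at h'
  refine ⟨fun h1 => ?_, h2⟩
  rw [h1, ← EReal.coe_ennreal_toReal h2] at h
  simp at h

namespace IsAdmissible

variable {H : Energy d} {R : ℝ}

theorem exists_negPart_le (hH : IsAdmissible H R) : ∃ A : ℝ, 0 < A ∧
    ∀ (Λ : Window d) (ω : Config d),
      (-H (finRestrict Λ ω)).toENNReal ≤ ENNReal.ofReal A * (count Λ.1 ω : ℝ≥0∞) := by
  obtain ⟨A, hA0, hA⟩ := hH.stable
  refine ⟨A, hA0, fun Λ ω => ?_⟩
  have h1 : -H (finRestrict Λ ω) ≤ ((A * (count Λ.1 ω : ℝ) : ℝ) : EReal) := by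
    rw [EReal.neg_le, ← EReal.coe_neg]
    exact hA (finRestrict Λ ω)
  refine (EReal.toENNReal_le_toENNReal h1).trans (le_of_eq ?_)
  rw [EReal.toENNReal_of_ne_top (EReal.coe_ne_top _), EReal.toReal_coe,
    ENNReal.ofReal_mul hA0.le, ENNReal.ofReal_natCast]

theorem exists_lintegral_negPart_le (hH : IsAdmissible H R) {P : Measure (Config d)}
    (hP : IsStationaryFI P) : ∃ C : ℝ, 0 ≤ C ∧ ∀ n : ℕ, 0 < n →
      ∫⁻ ω, (-H (finRestrict (cube d n) ω)).toENNReal ∂P ≤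
        ENNReal.ofReal (vol (cube d n) * C) := by
  obtain ⟨A, hA0, hA⟩ := hH.exists_negPart_le
  obtain ⟨ρ, hρ, h⟩ := hP.exists_lintegral_count_le
  refine ⟨A * ρ, by positivity, fun n hn => (lintegral_mono (hA _)).trans ?_⟩
  rw [lintegral_const_mul _ (measurable_natCast_count (cube d n))]
  refine (mul_le_mul_right (h n hn) _).trans (le_of_eq ?_)
  rw [← ENNReal.ofReal_mul hA0.le]
  congr 1
  ring

/-- Stability and finite intensity bound the energy per volume below, so entropy plus energy is
never ∞ − ∞. -/
theorem meanEnergy_ne_bot (hH : IsAdmissible H R) {P : Measure (Config d)}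
    (hP : IsStationaryFI P) {h : EReal} (hh : HasMeanEnergy H P h) : h ≠ ⊥ := by
  obtain ⟨C, hC0, hC⟩ := hH.exists_lintegral_negPart_le hP
  have h1 : ((-C : ℝ) : EReal) ≤ h := by
    refine ge_of_tendsto hh ?_
    filter_upwards [eventually_gt_atTop 0] with n hn
    have hv := vol_cube_pos d hn
    rw [EReal.le_div_iff_mul_le (by exact_mod_cast hv) (EReal.coe_ne_top _), ← EReal.coe_mul,
      eintegral]
    have h2 : ((∫⁻ ω, (-H (finRestrict (cube d n) ω)).toENNReal ∂P : ℝ≥0∞) : EReal) ≤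
        ((vol (cube d n) * C : ℝ) : EReal) := by
      refine (EReal.coe_ennreal_le_coe_ennreal_iff.2 (hC n hn)).trans (le_of_eq ?_)
      rw [EReal.coe_ennreal_ofReal, max_eq_left (by positivity)]
    have h3 : ((-C * vol (cube d n) : ℝ) : EReal) = 0 - ((vol (cube d n) * C : ℝ) : EReal) := by
      rw [zero_sub, ← EReal.coe_neg]
      congr 1
      ring
    rw [h3]
    exact EReal.sub_le_sub (EReal.coe_ennreal_nonneg _) h2
  intro hb
  rw [hb, le_bot_iff] at h1
  exact EReal.coe_ne_bot _ h1

end IsAdmissible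

end MeanEnergy

section GibbsKernel

variable {d : ℕ}

/-! ### Gibbs kernels and the entropy gap -/

theorem isLocalOn_localEnergy (H : Energy d) (R : ℝ) (Λ : Window d) :
    IsLocalOn (Λ.thicken R).1 (localEnergy H R Λ) := fun ω => by
  have h1 : finRestrict (Λ.thicken R) (restrict (Λ.thicken R).1 ω) = finRestrict (Λ.thicken R) ω :=
    Subtype.ext (restrict_restrict_of_subset subset_rfl ω)
  have h2 : finRestrict ((Λ.thicken R).diff Λ) (restrict (Λ.thicken R).1 ω) =
      finRestrict ((Λ.thicken R).diff Λ) ω :=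
    Subtype.ext (restrict_restrict_of_subset Set.sdiff_subset ω)
  rw [localEnergy, energyDiff, h1, h2]
  rfl

theorem glue_restrict {Λ : Window d} {S : Set (Space d)} (h : Λ.1 ⊆ S) (η ξ : Config d) :
    glue Λ η (restrict S ξ) = restrict S (glue Λ η ξ) :=
  Config.ext fun x => by
    simp only [glue, restrict, Set.mem_union, Set.mem_inter_iff, Set.mem_compl_iff]
    constructor
    · rintro (hx | hx)
      · exact ⟨Or.inl hx, h hx.2⟩
      · exact ⟨Or.inr ⟨hx.1.1, hx.2⟩, hx.1.2⟩
    · rintro ⟨hx | hx, hS⟩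
      · exact Or.inl hx
      · exact Or.inr ⟨⟨hx.1, hS⟩, hx.2⟩

theorem isLocalOn_partitionFn (H : Energy d) (R : ℝ) (Λ : Window d) :
    IsLocalOn (Λ.thicken R).1 (partitionFn H R Λ) := fun ω => by
  simp only [partitionFn]
  refine lintegral_congr fun η => ?_
  rw [glue_restrict (subset_thicken Λ R), isLocalOn_localEnergy]

theorem isLocalOn_localDensity (H : Energy d) (R : ℝ) (Λ : Window d) :
    IsLocalOn (Λ.thicken R).1 (localDensity H R Λ) := fun ω => by
  rw [localDensity, isLocalOn_partitionFn, isLocalOn_localEnergy, localDensity]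

theorem partitionFn_glue (H : Energy d) (R : ℝ) (Λ : Window d) (η ξ : Config d) :
    partitionFn H R Λ (glue Λ η ξ) = partitionFn H R Λ ξ := by
  simp only [partitionFn, glue_glue]

theorem restrict_compl_glue (Λ : Window d) (η ξ : Config d) :
    restrict Λ.1ᶜ (glue Λ η ξ) = restrict Λ.1ᶜ ξ :=
  restrict_glue_of_disjoint disjoint_compl_right η ξ

theorem measurable_localDensity {H : Energy d} (hH : Measurable H) (R : ℝ) (Λ : Window d) :
    Measurable (localDensity H R Λ) := by
  refine (measurable_expNeg (measurable_localEnergy hH R Λ)).div ?_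
  exact Measurable.lintegral_prod_right'
    (f := fun z : Config d × Config d => EReal.exp (-localEnergy H R Λ (glue Λ z.2 z.1)))
    ((measurable_expNeg (measurable_localEnergy hH R Λ)).comp
      ((measurable_glue Λ).comp measurable_swap))

/-- The probability that the Gibbs kernel in `Λ` with boundary condition `ξ` gives to `A`. -/
def gibbsKernel (H : Energy d) (R : ℝ) (Λ : Window d) (A : Set (Config d)) (ξ : Config d) : ℝ≥0∞ :=
  ∫⁻ η, A.indicator 1 (glue Λ η ξ) * localDensity H R Λ (glue Λ η ξ) ∂(poisson Λ)

theorem gibbsKernel_eq_div {H : Energy d} (hH : Measurable H) (R : ℝ) (Λ : Window d)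
    {A : Set (Config d)} (hA : MeasurableSet A) (ξ : Config d) :
    gibbsKernel H R Λ A ξ = (∫⁻ η, A.indicator 1 (glue Λ η ξ) *
      EReal.exp (-localEnergy H R Λ (glue Λ η ξ)) ∂(poisson Λ)) / partitionFn H R Λ ξ := by
  rw [gibbsKernel, div_eq_mul_inv, ← lintegral_mul_const]
  · simp only [localDensity, partitionFn_glue, div_eq_mul_inv, mul_assoc]
  · exact (((measurable_const (a := (1 : ℝ≥0∞))).indicator hA).mul
      (measurable_expNeg (measurable_localEnergy hH R Λ))).comp (measurable_glue_left Λ ξ)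

/-- True for every boundary condition, also when the partition function is 0 or ∞, because a / a ≤ 1
always holds in `ℝ≥0∞`. -/
theorem gibbsKernel_le_one {H : Energy d} (hH : Measurable H) (R : ℝ) (Λ : Window d)
    {A : Set (Config d)} (hA : MeasurableSet A) (ξ : Config d) : gibbsKernel H R Λ A ξ ≤ 1 := by
  rw [gibbsKernel_eq_div hH R Λ hA]
  refine le_trans (ENNReal.div_le_div_right (lintegral_mono fun η => ?_) _)
    (ENNReal.div_self_le_one (a := partitionFn H R Λ ξ))
  refine (mul_le_mul_left (Set.indicator_le_self' (by simp) _) _).trans ?_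
  simp

theorem gibbsKernel_glue (H : Energy d) (R : ℝ) (Λ : Window d) (A : Set (Config d))
    (η ξ : Config d) : gibbsKernel H R Λ A (glue Λ η ξ) = gibbsKernel H R Λ A ξ := by
  simp only [gibbsKernel, glue_glue]

theorem measurable_gibbsKernel {H : Energy d} (hH : Measurable H) (R : ℝ) (Λ : Window d)
    {A : Set (Config d)} (hA : MeasurableSet A) : Measurable (gibbsKernel H R Λ A) :=
  Measurable.lintegral_prod_right'
    (f := fun z : Config d × Config d => A.indicator 1 (glue Λ z.2 z.1) *
      localDensity H R Λ (glue Λ z.2 z.1))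
    ((((measurable_const (a := (1 : ℝ≥0∞))).indicator hA).mul
      (measurable_localDensity hH R Λ)).comp ((measurable_glue Λ).comp measurable_swap))

theorem isLocalOn_gibbsKernel (H : Energy d) (R : ℝ) (Λ : Window d) {A : Set (Config d)}
    {S : Set (Space d)} (hS : (Λ.thicken R).1 ⊆ S) (hA : IsLocalOn S (· ∈ A)) :
    IsLocalOn S (gibbsKernel H R Λ A) := fun ω => by
  classical
  simp only [gibbsKernel]
  refine lintegral_congr fun η => ?_
  rw [glue_restrict ((subset_thicken Λ R).trans hS), (isLocalOn_localDensity H R Λ).mono hS]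
  congr 1
  have := hA (glue Λ η ω)
  simp only [eq_iff_iff] at this
  simp only [Set.indicator_apply, this, Pi.one_apply]

/-! ### Bounds on partition functions and the entropy gap -/

namespace IsAdmissible

variable {H : Energy d} {R : ℝ}

theorem exp_localEnergy_ne_top (hH : IsAdmissible H R) {Λ : Window d} {ω : Config d}
    (h : restrict Λ.1ᶜ ω ∈ finiteEnergy H) :
    EReal.exp (-localEnergy H R Λ ω) ≠ ⊤ := by
  have h1 := hH.boltz_eq_mul h (subset_refl (Λ.thicken R).1)
  intro htop
  rw [htop, ENNReal.mul_top] at h1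
  · exact hH.boltz_ne_top _ _ h1
  · rw [ne_eq, boltz_eq_zero_iff]
    exact (hH.lt_top_of_subset (ω := finRestrict ((Λ.thicken R).diff Λ) ω)
      (ω' := finRestrict (Λ.thicken R) (restrict Λ.1ᶜ ω))
      (fun x hx => ⟨⟨hx.1, hx.2.2⟩, hx.2.1⟩) (h _)).ne

/-- Keep only configurations whose points all lie in B: they do not feel the boundary condition, so
the bound is uniform in it. -/
theorem freeZ_le_partitionFn (hH : IsAdmissible H R) {B Λ : Window d}
    (hB : (B.thicken R).1 ⊆ Λ.1) {ω : Config d} (hω : restrict Λ.1ᶜ ω ∈ finiteEnergy H) :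
    freeZ H B ≤ ENNReal.ofReal (Real.exp (vol Λ)) * partitionFn H R Λ ω := by
  have hm : Measurable fun η => EReal.exp (-localEnergy H R Λ (glue Λ η ω)) :=
    (measurable_expNeg (measurable_localEnergy hH.meas R Λ)).comp (measurable_glue_left Λ ω)
  refine le_trans (le_of_eq ?_) (exp_vol_mul_lintegral_poisson_mono
    ((subset_thicken B R).trans hB) hm)
  rw [freeZ]
  congr 1
  refine lintegral_congr_ae ?_
  filter_upwards [ae_poisson_subset B] with η hη
  rw [hH.localEnergy_glue_isolated hB hη hω, boltz]

/-- The empty window. -/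
def _root_.GibbsPP.emptyWindow (d : ℕ) : Window d :=
  ⟨∅, MeasurableSet.empty, Bornology.isBounded_empty⟩

theorem partitionFn_ne_zero (hH : IsAdmissible H R) {Λ : Window d} {ω : Config d}
    (hω : restrict Λ.1ᶜ ω ∈ finiteEnergy H) : partitionFn H R Λ ω ≠ 0 := by
  intro h
  have h1 := (hH.one_le_freeZ (emptyWindow d)).trans
    (hH.freeZ_le_partitionFn (B := emptyWindow d) (Λ := Λ)
      (by simp [emptyWindow, Window.thicken]) hω)
  rw [h, mul_zero] at h1
  simp at h1

/-- Stability bounds the weight in the thickened window by c^N, N being the number of points;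
dividing by the positive weight b of the fixed outer points leaves an exponential moment of the
Poisson count. -/
theorem partitionFn_ne_top (hH : IsAdmissible H R) {Λ : Window d} {ω : Config d}
    (hω : restrict Λ.1ᶜ ω ∈ finiteEnergy H) : partitionFn H R Λ ω ≠ ⊤ := by
  obtain ⟨A, hA0, hA⟩ := hH.exists_boltz_le
  set V := Λ.thicken R with hV
  set b := boltz H (V.diff Λ) ω with hb
  have hb0 : b ≠ 0 := by
    rw [hb, ne_eq, boltz_eq_zero_iff]
    exact (hH.lt_top_of_subset (ω := finRestrict (V.diff Λ) ω)
      (ω' := finRestrict V (restrict Λ.1ᶜ ω)) (fun x hx => ⟨⟨hx.1, hx.2.2⟩, hx.2.1⟩) (hω _)).ne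
  have hbt : b ≠ ⊤ := hH.boltz_ne_top _ _
  set c := ENNReal.ofReal (Real.exp A) with hc
  have hle : ∀ η : Config d, EReal.exp (-localEnergy H R Λ (glue Λ η ω)) ≤
      b⁻¹ * (c ^ count (V.diff Λ).1 ω) * c ^ count Λ.1 η := by
    intro η
    have h1 := hH.boltz_eq_mul (Λ := Λ) (ω := glue Λ η ω)
      (by rwa [restrict_compl_glue]) (subset_refl V.1)
    have h2 : boltz H (V.diff Λ) (glue Λ η ω) = b := boltz_congr H fun x => by
      refine and_congr_left fun hx => ?_
      simp [mem_glue, hx.2]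
    have h3 : count V.1 (glue Λ η ω) = count Λ.1 η + count (V.diff Λ).1 ω := by
      rw [count_glue]
      congr 2
      exact Set.inter_eq_right.2 (subset_thicken Λ R)
    have h4 := hA V (glue Λ η ω)
    rw [h1, h2, h3, pow_add] at h4
    calc EReal.exp (-localEnergy H R Λ (glue Λ η ω))
        = b⁻¹ * (b * EReal.exp (-localEnergy H R Λ (glue Λ η ω))) := by
          rw [← mul_assoc, ENNReal.inv_mul_cancel hb0 hbt, one_mul]
      _ ≤ b⁻¹ * (c ^ count Λ.1 η * c ^ count (V.diff Λ).1 ω) := mul_le_mul_right h4 _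
      _ = _ := by ring
  have h5 := lintegral_mono (μ := poisson Λ) hle
  refine ((h5.trans (le_of_eq (lintegral_const_mul _
    ((measurable_from_top (f := fun k : ℕ => c ^ k)).comp (measurable_count Λ))))).trans_lt ?_).ne
  refine ENNReal.mul_lt_top (ENNReal.mul_lt_top (ENNReal.inv_lt_top.2 (pos_iff_ne_zero.2 hb0))
    (ENNReal.pow_lt_top ENNReal.ofReal_lt_top)) ?_
  exact (lintegral_exp_count_poisson_le Λ A).trans_lt ENNReal.ofReal_lt_top

/-- A density `u` with conditional mean one in `Λ` does not change weighted integrals. -/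
theorem lintegral_mul_boltz_glue (hH : IsAdmissible H R) {Λ V : Window d}
    (hΛ : (Λ.thicken R).1 ⊆ V.1) {U : Config d → ℝ≥0∞} (hU : Measurable U)
    (hav : ∀ ξ, restrict Λ.1ᶜ ξ ∈ finiteEnergy H →
      ∫⁻ η, U (glue Λ η ξ) * EReal.exp (-localEnergy H R Λ (glue Λ η ξ)) ∂(poisson Λ) =
        partitionFn H R Λ ξ) {ξ : Config d} (hξ : ξ.1 ⊆ (V.diff Λ).1) :
    ∫⁻ η, U (glue Λ η ξ) * boltz H V (glue Λ η ξ) ∂(poisson Λ) =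
      ∫⁻ η, boltz H V (glue Λ η ξ) ∂(poisson Λ) := by
  by_cases htop : H (finRestrict V ξ) = ⊤
  · have h0 : ∀ η, boltz H V (glue Λ η ξ) = 0 := fun η => by
      rw [boltz_eq_zero_iff]
      exact hH.top_of_subset (ω := finRestrict V ξ)
        (fun x hx => ⟨Or.inr ⟨hx.1, (hξ hx.1).2⟩, hx.2⟩) htop
    simp [h0]
  · have hfin : restrict Λ.1ᶜ ξ ∈ finiteEnergy H :=
      hH.finiteEnergy_of_subset Set.inter_subset_left
        (hH.finiteEnergy_of_window (hξ.trans Set.sdiff_subset) (lt_top_iff_ne_top.2 htop))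
    have h1 : ∀ η, boltz H V (glue Λ η ξ) = boltz H (V.diff Λ) ξ *
        EReal.exp (-localEnergy H R Λ (glue Λ η ξ)) := fun η => by
      rw [hH.boltz_eq_mul (by rwa [restrict_compl_glue]) hΛ]
      congr 1
      refine boltz_congr H fun x => and_congr_left fun hx => ?_
      simp [mem_glue, hx.2]
    have hem : Measurable fun η => EReal.exp (-localEnergy H R Λ (glue Λ η ξ)) :=
      (measurable_expNeg (measurable_localEnergy hH.meas R Λ)).comp (measurable_glue_left Λ ξ)
    have hUem : Measurable fun η => U (glue Λ η ξ) *
        EReal.exp (-localEnergy H R Λ (glue Λ η ξ)) :=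
      (hU.comp (measurable_glue_left Λ ξ)).mul hem
    simp only [h1, mul_left_comm (U _)]
    rw [lintegral_const_mul _ hUem, hav ξ hfin, lintegral_const_mul _ hem, partitionFn]

theorem _root_.GibbsPP.shift_glue (a : Space d) (Λ : Window d) (η ξ : Config d) :
    shift a (glue Λ η (shift (-a) ξ)) = glue (Λ.translate a) (shift a η) ξ :=
  Config.ext fun x => by
    simp [mem_shift, mem_glue, mem_translate]

/-- Stationarity of H carries the identity for Λ to its translates. -/
theorem lintegral_mul_boltz_glue_translate (hH : IsAdmissible H R) {Λ C V : Window d} (a : Space d)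
    (hΛ : (Λ.thicken R).1 ⊆ C.1) (hC : (C.translate a).1 ⊆ V.1) {U : Config d → ℝ≥0∞}
    (hU : Measurable U)
    (hav : ∀ ξ, restrict Λ.1ᶜ ξ ∈ finiteEnergy H →
      ∫⁻ η, U (glue Λ η ξ) * EReal.exp (-localEnergy H R Λ (glue Λ η ξ)) ∂(poisson Λ) =
        partitionFn H R Λ ξ) {ξ : Config d} (hξ : ξ.1 ⊆ (V.diff (Λ.translate a)).1) :
    ∫⁻ η, U (shift (-a) (glue (Λ.translate a) η ξ)) * boltz H V (glue (Λ.translate a) η ξ)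
        ∂(poisson (Λ.translate a)) =
      ∫⁻ η, boltz H V (glue (Λ.translate a) η ξ) ∂(poisson (Λ.translate a)) := by
  set V' := V.translate (-a) with hV'
  have hVV : V'.translate a = V := by
    refine Subtype.ext (Set.ext fun x => ?_)
    simp [hV', mem_translate]
  have hb : ∀ θ, boltz H V (shift a θ) = boltz H V' θ := fun θ => by
    rw [← hH.boltz_translate a V' θ, hVV]
  have hmb : Measurable fun η => boltz H V (glue (Λ.translate a) η ξ) :=
    (hH.measurable_boltz V).comp (measurable_glue_left _ ξ)
  have hUmb : Measurable fun η => U (shift (-a) (glue (Λ.translate a) η ξ)) *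
      boltz H V (glue (Λ.translate a) η ξ) :=
    ((hU.comp (measurable_shift _)).comp (measurable_glue_left _ ξ)).mul hmb
  rw [lintegral_poisson_translate a Λ hmb, lintegral_poisson_translate a Λ hUmb]
  simp only [← shift_glue, hb, shift_neg_shift]
  refine hH.lintegral_mul_boltz_glue (fun x hx => ?_) hU hav fun x hx => ?_
  · refine hC ?_
    simpa [mem_translate] using hΛ hx
  · rw [mem_shift] at hx
    have h1 := hξ hx
    rw [mem_diff, mem_translate] at h1
    rw [mem_diff, hV', mem_translate]
    refine ⟨h1.1, ?_⟩
    simpa using h1.2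

/-- With the points outside one translate of Λ fixed, the factors of the other blocks are constant,
and this block's factor averages to one against the Gibbs weight. Each factor can thus be removed in
turn, although the blocks interact. -/
theorem lintegral_prod_mul_boltz (hH : IsAdmissible H R) {ι : Type*} (a : ι → Space d)
    {Λ C V : Window d} (hΛ : (Λ.thicken R).1 ⊆ C.1)
    (hdisj : ∀ i j, i ≠ j → Disjoint (C.translate (a i)).1 (C.translate (a j)).1)
    {U : Config d → ℝ≥0∞} (hU : Measurable U) (hloc : IsLocalOn C.1 U)
    (hav : ∀ ξ, restrict Λ.1ᶜ ξ ∈ finiteEnergy H →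
      ∫⁻ η, U (glue Λ η ξ) * EReal.exp (-localEnergy H R Λ (glue Λ η ξ)) ∂(poisson Λ) =
        partitionFn H R Λ ξ) (J : Finset ι) (hJ : ∀ i ∈ J, (C.translate (a i)).1 ⊆ V.1) :
    ∫⁻ ω, (∏ i ∈ J, U (shift (-a i) ω)) * boltz H V ω ∂(poisson V) =
      ∫⁻ ω, boltz H V ω ∂(poisson V) := by
  classical
  induction J using Finset.induction_on with
  | empty => simp
  | insert i J hi ih =>
    have hUm : ∀ j, Measurable fun ω => U (shift (-a j) ω) := fun j => hU.comp (measurable_shift _)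
    have hprod : ∀ J : Finset ι, Measurable fun ω =>
        (∏ j ∈ J, U (shift (-a j) ω)) * boltz H V ω := fun J =>
      (Finset.measurable_fun_prod _ fun j _ => hUm j).mul (hH.measurable_boltz V)
    have hsub : (Λ.translate (a i)).1 ⊆ (C.translate (a i)).1 := fun x hx =>
      hΛ (subset_thicken Λ R hx)
    have hsubV := hsub.trans (hJ i (Finset.mem_insert_self i J))
    rw [← ih fun j hj => hJ j (Finset.mem_insert_of_mem hj),
      lintegral_poisson_split hsubV (hprod _), lintegral_poisson_split hsubV (hprod _)]
    refine lintegral_congr_ae ?_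
    filter_upwards [ae_poisson_subset (V.diff (Λ.translate (a i)))] with ξ hξ
    have hconst : ∀ η, ∏ j ∈ J, U (shift (-a j) (glue (Λ.translate (a i)) η ξ)) =
        ∏ j ∈ J, U (shift (-a j) ξ) := fun η =>
      Finset.prod_congr rfl fun j hj => (hloc.shift (a j)).congr
        (restrict_glue_of_disjoint
          ((hdisj i j (fun h => hi (h ▸ hj))).mono_left hsub) η ξ)
    simp only [Finset.prod_insert hi, hconst]
    have hmb : Measurable fun η => boltz H V (glue (Λ.translate (a i)) η ξ) :=
      (hH.measurable_boltz V).comp (measurable_glue_left _ ξ)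
    have hUmb : Measurable fun η => U (shift (-a i) (glue (Λ.translate (a i)) η ξ)) *
        boltz H V (glue (Λ.translate (a i)) η ξ) :=
      ((hUm i).comp (measurable_glue_left _ ξ)).mul hmb
    rw [lintegral_const_mul _ hmb, ← hH.lintegral_mul_boltz_glue_translate (a i) hΛ
      (hJ i (Finset.mem_insert_self i J)) hU hav hξ, ← lintegral_const_mul _ hUmb]
    exact lintegral_congr fun η => by ring

/-- The entropy gap: `u` is a local density with conditional mean one. -/
theorem block_mul_integral_log_le (hH : IsAdmissible H R) {P : Measure (Config d)}
    (hP : IsStationaryFI P) {m n g q : ℕ} (hg : 0 < g) (hq : q * (2 * m + g) ≤ 2 * n)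
    {Λ : Window d} (hΛ : (Λ.thicken R).1 ⊆ (cube d m).1) {u : Config d → ℝ} (hu : Measurable u)
    (hloc : IsLocalOn (cube d m).1 u) (hu1 : ∀ ω, 1 / 2 ≤ u ω) (hu2 : ∀ ω, u ω ≤ 2)
    (hav : ∀ ξ, restrict Λ.1ᶜ ξ ∈ finiteEnergy H →
      ∫⁻ η, ENNReal.ofReal (u (glue Λ η ξ)) * EReal.exp (-localEnergy H R Λ (glue Λ η ξ))
        ∂(poisson Λ) = partitionFn H R Λ ξ)
    (hkl : InformationTheory.klDiv (cubeLaw P n) (poisson (cube d n)) ≠ ⊤)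
    (h1 : ∫⁻ ω, (H (finRestrict (cube d n) ω)).toENNReal ∂P ≠ ⊤)
    (h2 : ∫⁻ ω, (-H (finRestrict (cube d n) ω)).toENNReal ∂P ≠ ⊤) :
    (q : ℝ) ^ d * ∫ ω, Real.log (u ω) ∂P ≤
      (InformationTheory.klDiv (cubeLaw P n) (poisson (cube d n))).toReal +
        ∫ ω, (H (finRestrict (cube d n) ω)).toReal ∂P +
        Real.log (∫⁻ ω, boltz H (cube d n) ω ∂(poisson (cube d n))).toReal := by
  have := isProbabilityMeasure_cubeLaw hP n
  have hmr := measurable_restrict (d := d) (cube d n).2.1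
  obtain ⟨hfin, hint, -⟩ := eintegral_eq_integral (measurable_energy hH.meas (cube d n)) h1 h2
  have hEloc : IsLocalOn (cube d n).1 fun ω => H (finRestrict (cube d n) ω) := fun ω => by
    simp only
    congr 1
    exact Subtype.ext (restrict_restrict_of_subset subset_rfl ω)
  have hEm := measurable_energy hH.meas (cube d n)
  have hfin' : ∀ᵐ ω ∂(cubeLaw P n), H (finRestrict (cube d n) ω) ≠ ⊤ := by
    refine (ae_map_iff hmr.aemeasurable (hEm (measurableSet_singleton ⊤)).compl).2 ?_
    filter_upwards [hfin] with ω hω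
    exact fun h => hω.1 ((hEloc ω).symm.trans h)
  have hint' : Integrable (fun ω => (H (finRestrict (cube d n) ω)).toReal) (cubeLaw P n) := by
    rw [integrable_map_measure hEm.ereal_toReal.aestronglyMeasurable hmr.aemeasurable]
    refine hint.congr (ae_of_all _ fun ω => ?_)
    exact congrArg EReal.toReal (hEloc ω).symm
  have heq' : ∫ ω, (H (finRestrict (cube d n) ω)).toReal ∂(cubeLaw P n) =
      ∫ ω, (H (finRestrict (cube d n) ω)).toReal ∂P := by
    rw [integral_map hmr.aemeasurable hEm.ereal_toReal.aestronglyMeasurable]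
    exact integral_congr_ae (ae_of_all _ fun ω => congrArg EReal.toReal (hEloc ω))
  have hu0 : ∀ ω, 0 < u ω := fun ω => by linarith [hu1 ω]
  have hlogb : ∀ ω, |Real.log (u ω)| ≤ Real.log 2 := fun ω => by
    rw [abs_le]
    refine ⟨?_, Real.log_le_log (hu0 ω) (hu2 ω)⟩
    rw [← Real.log_inv]
    exact Real.log_le_log (by norm_num) (by linarith [hu1 ω])
  obtain ⟨hsint, hsum⟩ := integral_sum_shift hP hq (f := fun ω => Real.log (u ω)) hu.log
    ⟨_, hlogb⟩ (fun ω => by simp only [hloc ω])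
  set U : Config d → ℝ≥0∞ := fun ω => ENNReal.ofReal (u ω) with hU
  have hUm : Measurable U := hu.ennreal_ofReal
  -- The Donsker–Varadhan weight: its logarithm is the sum of the log u over the blocks minus the
  -- energy, and its Poisson integral is the unperturbed partition function.
  set W : Config d → ℝ≥0∞ := fun ω =>
    (∏ z : Fin d → Fin q, U (shift (-blockCenter n m g z) ω)) * boltz H (cube d n) ω with hW
  have hZ : ∫⁻ ω, W ω ∂(poisson (cube d n)) = ∫⁻ ω, boltz H (cube d n) ω ∂(poisson (cube d n)) :=
    hH.lintegral_prod_mul_boltz (fun z : Fin d → Fin q => blockCenter n m g z) hΛ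
      (fun z z' hz => disjoint_block hg hz) hUm (fun ω => by simp only [hU, hloc ω]) hav
      Finset.univ (fun z _ => block_subset hq z)
  have hlog : ∀ ω, H (finRestrict (cube d n) ω) ≠ ⊤ → Real.log (W ω).toReal =
      (∑ z : Fin d → Fin q, Real.log (u (shift (-blockCenter n m g z) ω))) -
        (H (finRestrict (cube d n) ω)).toReal := by
    intro ω hω
    have h3 : boltz H (cube d n) ω =
        ENNReal.ofReal (Real.exp (-(H (finRestrict (cube d n) ω)).toReal)) := by
      have hbot := hH.ne_bot (finRestrict (cube d n) ω)
      rw [boltz]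
      generalize H (finRestrict (cube d n) ω) = x at hω hbot
      lift x to ℝ using ⟨hω, hbot⟩
      rw [← EReal.coe_neg, EReal.exp_coe, EReal.toReal_coe]
    simp only [hW, h3, hU]
    rw [ENNReal.toReal_mul, ENNReal.toReal_prod, ENNReal.toReal_ofReal (Real.exp_pos _).le,
      Real.log_mul _ (Real.exp_pos _).ne', Real.log_exp, Real.log_prod]
    · simp only [ENNReal.toReal_ofReal (hu0 _).le]
      ring
    · exact fun z _ => by simpa [ENNReal.toReal_ofReal (hu0 _).le] using (hu0 _).ne'
    · exact Finset.prod_ne_zero_iff.2 fun z _ => by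
        simpa [ENNReal.toReal_ofReal (hu0 _).le] using (hu0 _).ne'
  have hlogae : (fun ω => Real.log (W ω).toReal) =ᵐ[cubeLaw P n] fun ω =>
      (∑ z : Fin d → Fin q, Real.log (u (shift (-blockCenter n m g z) ω))) -
        (H (finRestrict (cube d n) ω)).toReal := by
    filter_upwards [hfin'] with ω hω
    exact hlog ω hω
  have hDV := integral_log_le_klDiv_add_log hkl (W := W)
    ((Finset.measurable_fun_prod _ fun z _ => hUm.comp (measurable_shift _)).mul
      (hH.measurable_boltz _))
    (by rw [hZ]; exact hH.lintegral_boltz_ne_zero _) (by rw [hZ]; exact hH.lintegral_boltz_ne_top _)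
    (by
      filter_upwards [hfin'] with ω hω
      refine ⟨mul_ne_zero (Finset.prod_ne_zero_iff.2 fun z _ => ?_)
        ((boltz_eq_zero_iff H).not.2 hω), ENNReal.mul_ne_top
          (ENNReal.prod_ne_top fun z _ => ENNReal.ofReal_ne_top) (hH.boltz_ne_top _ _)⟩
      simpa [hU] using hu0 _)
    ((hsint.sub hint').congr hlogae.symm)
  rw [integral_congr_ae hlogae, integral_sub hsint hint', hsum, hZ, heq'] at hDV
  linarith

end IsAdmissible

end GibbsKernel

section Resampling

variable {d : ℕ}

/-! ### Gibbs measures as invariant measures -/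

/-- The law obtained from `P` by resampling the points in `Λ` with the Gibbs kernel. -/
def resample (H : Energy d) (R : ℝ) (Λ : Window d) (P : Measure (Config d)) :
    Measure (Config d) :=
  ((P.prod (poisson Λ)).withDensity fun z => localDensity H R Λ (glue Λ z.2 z.1)).map
    fun z => glue Λ z.2 z.1

theorem measurable_glue_swap (Λ : Window d) :
    Measurable fun z : Config d × Config d => glue Λ z.2 z.1 :=
  (measurable_glue Λ).comp measurable_swap

/-- The local events. -/
def localEvents (d : ℕ) : Set (Set (Config d)) :=
  {A | MeasurableSet A ∧ ∃ n : ℕ, IsLocalOn (cube d n).1 (· ∈ A)}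

theorem generateFrom_localEvents (d : ℕ) :
    instMeasurableSpaceConfig d = MeasurableSpace.generateFrom (localEvents d) := by
  refine le_antisymm (iSup_le fun Λ => ?_) (MeasurableSpace.generateFrom_le fun A hA => hA.1)
  rintro _ ⟨s, -, rfl⟩
  refine MeasurableSpace.measurableSet_generateFrom ⟨measurable_count Λ trivial, ?_⟩
  obtain ⟨n, hn⟩ := exists_window_superset Λ
  refine ⟨n, fun ω => ?_⟩
  have : count Λ.1 (restrict (cube d n).1 ω) = count Λ.1 ω := by
    simp only [count, restrict]
    rw [Set.inter_assoc, Set.inter_eq_right.2 hn]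
  simp [this]

theorem isPiSystem_localEvents (d : ℕ) : IsPiSystem (localEvents d) := by
  rintro A ⟨hA, m, hm⟩ B ⟨hB, n, hn⟩ -
  refine ⟨hA.inter hB, max m n, fun ω => ?_⟩
  have h1 := (hm.mono (cube_mono (le_max_left m n))) ω
  have h2 := (hn.mono (cube_mono (le_max_right m n))) ω
  simp only [Set.mem_inter_iff]
  rw [h1, h2]

theorem compl_mem_localEvents {A : Set (Config d)} (hA : A ∈ localEvents d) :
    Aᶜ ∈ localEvents d := by
  obtain ⟨hA, m, hm⟩ := hA
  refine ⟨hA.compl, m, fun ω => ?_⟩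
  exact congrArg Not (hm ω)

namespace IsAdmissible

variable {H : Energy d} {R : ℝ}

theorem lintegral_resample (hH : IsAdmissible H R) (Λ : Window d) {P : Measure (Config d)}
    [IsProbabilityMeasure P] {F : Config d → ℝ≥0∞} (hF : Measurable F) :
    ∫⁻ ω, F ω ∂(resample H R Λ P) =
      ∫⁻ ω, ∫⁻ η, F (glue Λ η ω) * localDensity H R Λ (glue Λ η ω) ∂(poisson Λ) ∂P := by
  have hdm : Measurable fun z : Config d × Config d => localDensity H R Λ (glue Λ z.2 z.1) :=
    (measurable_localDensity hH.meas R Λ).comp (measurable_glue_swap Λ)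
  have hFm : Measurable fun z : Config d × Config d => F (glue Λ z.2 z.1) :=
    hF.comp (measurable_glue_swap Λ)
  rw [resample, lintegral_map hF (measurable_glue_swap Λ),
    lintegral_withDensity_eq_lintegral_mul _ hdm hFm, lintegral_prod _ (hdm.mul hFm).aemeasurable]
  simp only [Pi.mul_apply, mul_comm]

theorem resample_apply (hH : IsAdmissible H R) (Λ : Window d) {P : Measure (Config d)}
    [IsProbabilityMeasure P] {A : Set (Config d)} (hA : MeasurableSet A) :
    resample H R Λ P A = ∫⁻ ω, gibbsKernel H R Λ A ω ∂P := by
  rw [← lintegral_indicator_one hA, hH.lintegral_resample Λ (measurable_one.indicator hA)]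
  rfl

theorem finiteEnergy_restrict (hH : IsAdmissible H R) {ω : Config d} (h : ω ∈ finiteEnergy H)
    (S : Set (Space d)) : restrict S ω ∈ finiteEnergy H :=
  hH.finiteEnergy_of_subset Set.inter_subset_left h

theorem gibbsKernel_univ (hH : IsAdmissible H R) (Λ : Window d) {ω : Config d}
    (h : ω ∈ finiteEnergy H) : gibbsKernel H R Λ Set.univ ω = 1 := by
  rw [gibbsKernel_eq_div hH.meas R Λ MeasurableSet.univ]
  have hr := hH.finiteEnergy_restrict h Λ.1ᶜ
  simp only [Set.indicator_univ, Pi.one_apply, one_mul]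
  exact ENNReal.div_self (hH.partitionFn_ne_zero hr) (hH.partitionFn_ne_top hr)

theorem isProbabilityMeasure_resample (hH : IsAdmissible H R) (Λ : Window d)
    {P : Measure (Config d)} [IsProbabilityMeasure P] (hfin : ∀ᵐ ω ∂P, ω ∈ finiteEnergy H) :
    IsProbabilityMeasure (resample H R Λ P) := by
  constructor
  rw [hH.resample_apply Λ MeasurableSet.univ]
  have : gibbsKernel H R Λ Set.univ =ᵐ[P] fun _ => 1 := by
    filter_upwards [hfin] with ω hω
    exact hH.gibbsKernel_univ Λ hω
  rw [lintegral_congr_ae this]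
  simp

theorem integral_resample (hH : IsAdmissible H R) (Λ : Window d)
    {P : Measure (Config d)} [IsProbabilityMeasure P] (hfin : ∀ᵐ ω ∂P, ω ∈ finiteEnergy H)
    {g : Config d → ℝ} (hg : Measurable g) (hb : ∃ C, ∀ ω, |g ω| ≤ C) :
    ∫ ω, g ω ∂(resample H R Λ P) = ∫ ω, ∫ η, g (glue Λ η ω) *
      (localDensity H R Λ (glue Λ η ω)).toReal ∂(poisson Λ) ∂P := by
  have hprob := hH.isProbabilityMeasure_resample Λ hfin
  obtain ⟨C, hC⟩ := hb
  have hgint : Integrable g (resample H R Λ P) :=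
    Integrable.of_bound hg.aestronglyMeasurable C (ae_of_all _ hC)
  have hdm : Measurable fun z : Config d × Config d => localDensity H R Λ (glue Λ z.2 z.1) :=
    (measurable_localDensity hH.meas R Λ).comp (measurable_glue_swap Λ)
  -- Finiteness of the density matters because the DLR equation uses its `toReal`, which would turn
  -- ∞ into 0.
  have hdt : ∀ᵐ z ∂(P.prod (poisson Λ)), localDensity H R Λ (glue Λ z.2 z.1) < ⊤ := by
    have h1 : ∀ᵐ z ∂(P.prod (poisson Λ)), z.1 ∈ finiteEnergy H :=
      Measure.quasiMeasurePreserving_fst.ae hfin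
    filter_upwards [h1] with z hz
    have hr : restrict Λ.1ᶜ (glue Λ z.2 z.1) ∈ finiteEnergy H := by
      rw [restrict_compl_glue]
      exact hH.finiteEnergy_restrict hz _
    exact ENNReal.div_lt_top (hH.exp_localEnergy_ne_top hr) (hH.partitionFn_ne_zero hr)
  have hgm := (measurable_glue_swap Λ)
  rw [resample, integrable_map_measure hg.aestronglyMeasurable hgm.aemeasurable,
    integrable_withDensity_iff_integrable_smul' hdm hdt] at hgint
  rw [resample, integral_map hgm.aemeasurable hg.aestronglyMeasurable,
    integral_withDensity_eq_integral_toReal_smul hdm hdt]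
  simp only [smul_eq_mul, Function.comp_apply] at hgint ⊢
  rw [integral_prod _ hgint]
  simp only [mul_comm]

theorem isGibbs_of_resample_eq (hH : IsAdmissible H R) {P : Measure (Config d)}
    (hP : IsProbabilityMeasure P) (hfin : ∀ᵐ ω ∂P, ω ∈ finiteEnergy H)
    (h : ∀ Λ, resample H R Λ P = P) : IsGibbs H R P where
  prob := hP
  finite := hfin
  dlr Λ g hg hb := by rw [← hH.integral_resample Λ hfin hg hb, h Λ]

/-- Indicators are bounded test functions, so the DLR equation says precisely that resampling
preserves P. -/
theorem resample_eq_of_isGibbs (hH : IsAdmissible H R) {P : Measure (Config d)}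
    (hP : IsGibbs H R P) (Λ : Window d) : resample H R Λ P = P := by
  have := hP.prob
  have := hH.isProbabilityMeasure_resample Λ hP.finite
  refine Measure.ext fun A hA => ?_
  have hg : Measurable (A.indicator (1 : Config d → ℝ)) := measurable_one.indicator hA
  have hb : ∃ C, ∀ ω, |A.indicator (1 : Config d → ℝ) ω| ≤ C := ⟨1, fun ω => by
    by_cases hω : ω ∈ A <;> simp [hω]⟩
  have h1 := hP.dlr Λ _ hg hb
  rw [← hH.integral_resample Λ hP.finite hg hb, integral_indicator_one hA,
    integral_indicator_one hA] at h1
  exact ((measureReal_eq_measureReal_iff).1 h1).symm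

/-! ### Equality implies the Gibbs property -/

/-- A positive ∫ log u dP would give an excess free energy per volume of at least (2m+1)^{-d} ∫ log
u dP in the limit. -/
theorem integral_log_nonpos (hH : IsAdmissible H R) {P : Measure (Config d)}
    (hP : IsStationaryFI P)
    (hfin : ∀ᶠ n : ℕ in atTop,
      InformationTheory.klDiv (cubeLaw P n) (poisson (cube d n)) ≠ ⊤ ∧
      ∫⁻ ω, (H (finRestrict (cube d n) ω)).toENNReal ∂P ≠ ⊤ ∧
      ∫⁻ ω, (-H (finRestrict (cube d n) ω)).toENNReal ∂P ≠ ⊤)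
    (hlim : Tendsto (fun n : ℕ =>
      ((InformationTheory.klDiv (cubeLaw P n) (poisson (cube d n))).toReal +
        ∫ ω, (H (finRestrict (cube d n) ω)).toReal ∂P +
        Real.log (∫⁻ ω, boltz H (cube d n) ω ∂(poisson (cube d n))).toReal) / vol (cube d n))
      atTop (𝓝 0))
    {m : ℕ} {Λ : Window d} (hΛ : (Λ.thicken R).1 ⊆ (cube d m).1) {u : Config d → ℝ}
    (hu : Measurable u)
    (hloc : IsLocalOn (cube d m).1 u) (hu1 : ∀ ω, 1 / 2 ≤ u ω) (hu2 : ∀ ω, u ω ≤ 2)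
    (hav : ∀ ξ, restrict Λ.1ᶜ ξ ∈ finiteEnergy H →
      ∫⁻ η, ENNReal.ofReal (u (glue Λ η ξ)) * EReal.exp (-localEnergy H R Λ (glue Λ η ξ))
        ∂(poisson Λ) = partitionFn H R Λ ξ) :
    ∫ ω, Real.log (u ω) ∂P ≤ 0 := by
  have h1 := (tendsto_blockCount_div d (2 * m + 1)).mul_const (∫ ω, Real.log (u ω) ∂P)
  have h2 := le_of_tendsto_of_tendsto h1 hlim (by
    filter_upwards [hfin, eventually_gt_atTop 0] with n hn hn0
    have h3 := hH.block_mul_integral_log_le hP one_pos (q := 2 * n / (2 * m + 1))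
      (Nat.div_mul_le_self _ _) hΛ hu hloc hu1 hu2 hav hn.1 hn.2.1 hn.2.2
    rw [vol_cube, div_pow, div_mul_eq_mul_div]
    exact div_le_div_of_nonneg_right h3 (by positivity))
  have h4 : (0 : ℝ) < (1 / ((2 * m + 1 : ℕ) : ℝ)) ^ d := by positivity
  by_contra! hcon
  exact absurd h2 (not_le.2 (mul_pos h4 hcon))

/-- A perturbation of the constant density one with conditional mean one in `Λ`. -/
def _root_.GibbsPP.tilt (H : Energy d) (R : ℝ) (Λ : Window d) (A : Set (Config d)) (t : ℝ)
    (ω : Config d) : ℝ :=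
  1 + t * (A.indicator 1 ω - (gibbsKernel H R Λ A ω).toReal)

theorem abs_indicator_sub_gibbsKernel_le (hH : IsAdmissible H R) (Λ : Window d)
    {A : Set (Config d)} (hA : MeasurableSet A) (ω : Config d) :
    |A.indicator (1 : Config d → ℝ) ω - (gibbsKernel H R Λ A ω).toReal| ≤ 1 := by
  have h1 : (gibbsKernel H R Λ A ω).toReal ≤ 1 := by
    have := ENNReal.toReal_mono ENNReal.one_ne_top (gibbsKernel_le_one hH.meas R Λ hA ω)
    simpa using this
  have h2 : 0 ≤ (gibbsKernel H R Λ A ω).toReal := ENNReal.toReal_nonneg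
  rw [abs_le]
  by_cases hω : ω ∈ A
  · simp only [Set.indicator_of_mem hω, Pi.one_apply]
    constructor <;> linarith
  · simp only [Set.indicator_of_notMem hω]
    constructor <;> linarith

/-- The kernel does not depend on the points in Λ, and it is by definition the conditional mean of
the indicator. -/
theorem lintegral_tilt (hH : IsAdmissible H R) (Λ : Window d) {A : Set (Config d)}
    (hA : MeasurableSet A) {t : ℝ} (ht0 : 0 ≤ t) (ht1 : t ≤ 1) {ξ : Config d}
    (hξ : restrict Λ.1ᶜ ξ ∈ finiteEnergy H) :
    ∫⁻ η, ENNReal.ofReal (tilt H R Λ A t (glue Λ η ξ)) *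
      EReal.exp (-localEnergy H R Λ (glue Λ η ξ)) ∂(poisson Λ) = partitionFn H R Λ ξ := by
  set κ := gibbsKernel H R Λ A ξ with hκ
  set Z := partitionFn H R Λ ξ with hZ
  set T := ENNReal.ofReal t with hT
  have hZ0 := hH.partitionFn_ne_zero hξ
  have hZt := hH.partitionFn_ne_top hξ
  have hκ1 : κ ≤ 1 := gibbsKernel_le_one hH.meas R Λ hA ξ
  have hκt : κ ≠ ⊤ := (hκ1.trans_lt ENNReal.one_lt_top).ne
  have hκr : κ.toReal ≤ 1 := by
    simpa using ENNReal.toReal_mono ENNReal.one_ne_top hκ1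
  have hκr0 : 0 ≤ κ.toReal := ENNReal.toReal_nonneg
  have hem : Measurable fun η => EReal.exp (-localEnergy H R Λ (glue Λ η ξ)) :=
    (measurable_expNeg (measurable_localEnergy hH.meas R Λ)).comp (measurable_glue_left Λ ξ)
  have hAm : Measurable fun η => A.indicator (1 : Config d → ℝ≥0∞) (glue Λ η ξ) *
      EReal.exp (-localEnergy H R Λ (glue Λ η ξ)) :=
    (((measurable_const (a := (1 : ℝ≥0∞))).indicator hA).comp (measurable_glue_left Λ ξ)).mul hem
  -- To avoid subtraction in `ℝ≥0∞`, the term t κ is moved to the left side; it is finite and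
  -- cancels after integration.
  have hpt : ∀ η, ENNReal.ofReal (tilt H R Λ A t (glue Λ η ξ)) *
        EReal.exp (-localEnergy H R Λ (glue Λ η ξ)) +
      T * κ * EReal.exp (-localEnergy H R Λ (glue Λ η ξ)) =
      EReal.exp (-localEnergy H R Λ (glue Λ η ξ)) +
        T * (A.indicator 1 (glue Λ η ξ) * EReal.exp (-localEnergy H R Λ (glue Λ η ξ))) := by
    intro η
    have hnn : 0 ≤ tilt H R Λ A t (glue Λ η ξ) := by
      have := (abs_le.1 (hH.abs_indicator_sub_gibbsKernel_le Λ hA (glue Λ η ξ))).1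
      rw [tilt]
      nlinarith
    have h1 : ENNReal.ofReal (tilt H R Λ A t (glue Λ η ξ)) + T * κ =
        1 + T * A.indicator 1 (glue Λ η ξ) := by
      rw [hT, ← ENNReal.ofReal_toReal hκt, ← ENNReal.ofReal_mul ht0,
        ← ENNReal.ofReal_add hnn (by positivity), tilt, gibbsKernel_glue, ← hκ]
      by_cases hm : glue Λ η ξ ∈ A
      · simp only [Set.indicator_of_mem hm, Pi.one_apply, mul_one]
        rw [← ENNReal.ofReal_one, ← ENNReal.ofReal_add zero_le_one ht0]
        congr 1
        ring
      · simp only [Set.indicator_of_notMem hm, mul_zero, add_zero]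
        rw [← ENNReal.ofReal_one]
        congr 1
        ring
    rw [← add_mul, h1, add_mul, one_mul, mul_assoc]
  have hsum := lintegral_congr (μ := poisson Λ) hpt
  rw [lintegral_add_right _ (hem.const_mul _), lintegral_add_left hem,
    lintegral_const_mul _ hem, lintegral_const_mul _ hAm] at hsum
  have hκZ : ∫⁻ η, A.indicator 1 (glue Λ η ξ) * EReal.exp (-localEnergy H R Λ (glue Λ η ξ))
      ∂(poisson Λ) = κ * Z := by
    rw [hκ, gibbsKernel_eq_div hH.meas R Λ hA, ENNReal.div_mul_cancel hZ0 hZt]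
  have hZe : ∫⁻ η, EReal.exp (-localEnergy H R Λ (glue Λ η ξ)) ∂(poisson Λ) = Z := rfl
  rw [hκZ, hZe, ← mul_assoc] at hsum
  exact (ENNReal.add_left_inj (ENNReal.mul_ne_top
    (ENNReal.mul_ne_top ENNReal.ofReal_ne_top hκt) hZt)).1 hsum

theorem _root_.GibbsPP.sub_two_sq_le_log {x : ℝ} (hx : |x| ≤ 1 / 2) :
    x - 2 * x ^ 2 ≤ Real.log (1 + x) := by
  rw [abs_le] at hx
  have hpos : 0 < 1 + x := by linarith [hx.1]
  refine le_trans ?_ (Real.one_sub_inv_le_log_of_pos hpos)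
  have h1 : 1 - (1 + x)⁻¹ - (x - 2 * x ^ 2) = x ^ 2 * (1 + 2 * x) / (1 + x) := by
    field_simp
    ring
  have h2 : 0 ≤ x ^ 2 * (1 + 2 * x) / (1 + x) :=
    div_nonneg (mul_nonneg (sq_nonneg x) (by linarith [hx.1])) hpos.le
  linarith

/-- First variation at u = 1: with D = 1_A − κ(A), the bound ∫ log(1 + tD) dP ≤ 0 and log(1 + x) ≥ x
− 2x² give ∫ D dP ≤ 2t for all small t. -/
theorem measure_le_resample (hH : IsAdmissible H R) {P : Measure (Config d)}
    (hP : IsStationaryFI P)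
    (hfin : ∀ᶠ n : ℕ in atTop,
      InformationTheory.klDiv (cubeLaw P n) (poisson (cube d n)) ≠ ⊤ ∧
      ∫⁻ ω, (H (finRestrict (cube d n) ω)).toENNReal ∂P ≠ ⊤ ∧
      ∫⁻ ω, (-H (finRestrict (cube d n) ω)).toENNReal ∂P ≠ ⊤)
    (hlim : Tendsto (fun n : ℕ =>
      ((InformationTheory.klDiv (cubeLaw P n) (poisson (cube d n))).toReal +
        ∫ ω, (H (finRestrict (cube d n) ω)).toReal ∂P +
        Real.log (∫⁻ ω, boltz H (cube d n) ω ∂(poisson (cube d n))).toReal) / vol (cube d n))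
      atTop (𝓝 0)) (Λ : Window d) {A : Set (Config d)} (hA : A ∈ localEvents d) :
    P A ≤ resample H R Λ P A := by
  have := hP.prob
  obtain ⟨hAm, n, hn⟩ := hA
  obtain ⟨n', hn'⟩ := exists_window_superset (Λ.thicken R)
  set m := max n n'
  have hΛ : (Λ.thicken R).1 ⊆ (cube d m).1 := hn'.trans (cube_mono (le_max_right _ _))
  have hAloc : IsLocalOn (cube d m).1 (· ∈ A) := hn.mono (cube_mono (le_max_left _ _))
  have hκloc := isLocalOn_gibbsKernel H R Λ hΛ hAloc
  have hκm := measurable_gibbsKernel hH.meas R Λ hAm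
  set D : Config d → ℝ := fun ω => A.indicator 1 ω - (gibbsKernel H R Λ A ω).toReal with hD
  have hDm : Measurable D := (measurable_one.indicator hAm).sub hκm.ennreal_toReal
  have hD1 : ∀ ω, |D ω| ≤ 1 := hH.abs_indicator_sub_gibbsKernel_le Λ hAm
  have hDloc : IsLocalOn (cube d m).1 D := fun ω => by
    classical
    have h1 := hAloc ω
    simp only [eq_iff_iff] at h1
    simp only [hD, hκloc ω, Set.indicator_apply, h1, Pi.one_apply]
  have hDint : Integrable D P :=
    Integrable.of_bound hDm.aestronglyMeasurable 1 (ae_of_all _ hD1)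
  -- Since |D| ≤ 1, the restriction t ≤ 1/2 keeps 1 + tD between 1/2 and 2.
  have key : ∀ t : ℝ, 0 < t → t ≤ 1 / 2 → ∫ ω, D ω ∂P ≤ 2 * t := by
    intro t ht0 ht1
    have htD : ∀ ω, |t * D ω| ≤ 1 / 2 := fun ω => by
      rw [abs_mul, abs_of_pos ht0]
      nlinarith [hD1 ω, abs_nonneg (D ω)]
    have h1 := hH.integral_log_nonpos hP hfin hlim hΛ (u := tilt H R Λ A t)
      (measurable_const.add (hDm.const_mul t)) (fun ω => by
        have h := hDloc ω
        simp only [hD] at h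
        simp only [tilt, h])
      (fun ω => by
        change 1 / 2 ≤ 1 + t * D ω
        linarith [(abs_le.1 (htD ω)).1])
      (fun ω => by
        change 1 + t * D ω ≤ 2
        linarith [(abs_le.1 (htD ω)).2])
      (fun ξ hξ => hH.lintegral_tilt Λ hAm ht0.le (by linarith) hξ)
    have hlog : ∀ ω, t * D ω - 2 * t ^ 2 ≤ Real.log (tilt H R Λ A t ω) := fun ω => by
      refine le_trans ?_ (sub_two_sq_le_log (htD ω))
      have : D ω ^ 2 ≤ 1 := by
        rw [← sq_abs]
        nlinarith [hD1 ω, abs_nonneg (D ω)]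
      nlinarith [sq_nonneg t]
    have hlogint : Integrable (fun ω => Real.log (tilt H R Λ A t ω)) P := by
      refine Integrable.of_bound
        (measurable_const.add (hDm.const_mul t)).log.aestronglyMeasurable 1 (ae_of_all _ fun ω => ?_)
      rw [Real.norm_eq_abs, abs_le]
      have hb := abs_le.1 (htD ω)
      constructor
      · have := sub_two_sq_le_log (htD ω)
        have h4 : (t * D ω) ^ 2 ≤ 1 / 4 := by nlinarith [hb.1, hb.2]
        change -1 ≤ Real.log (1 + t * D ω)
        linarith
      · change Real.log (1 + t * D ω) ≤ 1
        have := Real.log_le_sub_one_of_pos (x := 1 + t * D ω) (by linarith [hb.1])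
        linarith [hb.2]
    have hint2 : Integrable (fun ω => t * D ω - 2 * t ^ 2) P :=
      (hDint.const_mul t).sub (integrable_const _)
    have h2 := integral_mono hint2 hlogint hlog
    rw [integral_sub (hDint.const_mul t) (integrable_const _), integral_const_mul] at h2
    simp only [integral_const, probReal_univ, one_smul] at h2
    have h3 : t * ∫ ω, D ω ∂P ≤ t * (2 * t) := by nlinarith
    exact le_of_mul_le_mul_left h3 ht0
  have hD0 : ∫ ω, D ω ∂P ≤ 0 := by
    refine le_of_forall_pos_le_add fun ε hε => ?_
    have := key (min (ε / 2) (1 / 2)) (by positivity) (min_le_right _ _)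
    linarith [min_le_left (ε / 2) (1 / 2)]
  have hκint : Integrable (fun ω => (gibbsKernel H R Λ A ω).toReal) P :=
    Integrable.of_bound hκm.ennreal_toReal.aestronglyMeasurable 1 (ae_of_all _ fun ω => by
      rw [Real.norm_eq_abs, abs_of_nonneg ENNReal.toReal_nonneg]
      simpa using ENNReal.toReal_mono ENNReal.one_ne_top (gibbsKernel_le_one hH.meas R Λ hAm ω))
  have hκt : ∀ ω, gibbsKernel H R Λ A ω < ⊤ := fun ω =>
    (gibbsKernel_le_one hH.meas R Λ hAm ω).trans_lt ENNReal.one_lt_top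
  have hIA : Integrable (A.indicator (1 : Config d → ℝ)) P :=
    (integrable_const (1 : ℝ)).indicator hAm
  rw [hD, integral_sub hIA hκint, integral_indicator_one hAm,
    integral_toReal hκm.aemeasurable (ae_of_all _ hκt), ← hH.resample_apply Λ hAm] at hD0
  have hrt : resample H R Λ P A ≠ ⊤ := by
    rw [hH.resample_apply Λ hAm]
    refine ((lintegral_mono fun ω => gibbsKernel_le_one hH.meas R Λ hAm ω).trans_lt ?_).ne
    simp
  rw [← ENNReal.toReal_le_toReal (measure_ne_top P A) hrt]
  exact sub_nonpos.1 hD0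

theorem isGibbs_of_limit (hH : IsAdmissible H R) {P : Measure (Config d)}
    (hP : IsStationaryFI P)
    (hfin : ∀ᶠ n : ℕ in atTop,
      InformationTheory.klDiv (cubeLaw P n) (poisson (cube d n)) ≠ ⊤ ∧
      ∫⁻ ω, (H (finRestrict (cube d n) ω)).toENNReal ∂P ≠ ⊤ ∧
      ∫⁻ ω, (-H (finRestrict (cube d n) ω)).toENNReal ∂P ≠ ⊤)
    (hlim : Tendsto (fun n : ℕ =>
      ((InformationTheory.klDiv (cubeLaw P n) (poisson (cube d n))).toReal +
        ∫ ω, (H (finRestrict (cube d n) ω)).toReal ∂P +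
        Real.log (∫⁻ ω, boltz H (cube d n) ω ∂(poisson (cube d n))).toReal) / vol (cube d n))
      atTop (𝓝 0)) : IsGibbs H R P := by
  have := hP.prob
  have hfe : ∀ᵐ ω ∂P, ω ∈ finiteEnergy H := by
    obtain ⟨N, hN⟩ := eventually_atTop.1 hfin
    -- Integrability of the energy is known only for large cubes; heredity passes finiteness to the
    -- smaller ones.
    have h1 : ∀ᵐ ω ∂P, ∀ n : ℕ, H (finRestrict (cube d (max n N)) ω) ≠ ⊤ := by
      rw [ae_all_iff]
      intro n
      have h2 := hN (max n N) (le_max_right _ _)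
      filter_upwards [(eintegral_eq_integral (measurable_energy hH.meas _) h2.2.1 h2.2.2).1]
        with ω hω using hω.1
    filter_upwards [h1] with ω hω
    rw [hH.mem_finiteEnergy_iff]
    intro n
    exact hH.lt_top_of_subset (ω := finRestrict (cube d n) ω)
      (ω' := finRestrict (cube d (max n N)) ω)
      (fun x hx => ⟨hx.1, cube_mono (le_max_left n N) hx.2⟩) (lt_top_iff_ne_top.2 (hω n))
  refine hH.isGibbs_of_resample_eq this hfe fun Λ => ?_
  have hprob := hH.isProbabilityMeasure_resample Λ hfe
  symm
  refine ext_of_generate_finite (localEvents d) (generateFrom_localEvents d)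
    (isPiSystem_localEvents d) (fun A hA => ?_) (by simp)
  refine le_antisymm (hH.measure_le_resample hP hfin hlim Λ hA) ?_
  -- Both measures have mass one, so the inequality for the complement is the reverse inequality.
  have h1 := hH.measure_le_resample hP hfin hlim Λ (compl_mem_localEvents hA)
  rw [prob_compl_eq_one_sub hA.1, prob_compl_eq_one_sub hA.1] at h1
  have h2 := tsub_le_tsub_left h1 1
  rwa [ENNReal.sub_sub_cancel ENNReal.one_ne_top prob_le_one,
    ENNReal.sub_sub_cancel ENNReal.one_ne_top prob_le_one] at h2

end IsAdmissible

end Resampling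

section GibbsBound

variable {d : ℕ}

/-! ### Gibbs measures attain equality -/

namespace IsAdmissible

variable {H : Energy d} {R : ℝ}

theorem energy_ne_top (ω : Config d) (h : ω ∈ finiteEnergy H) (Λ : Window d) :
    H (finRestrict Λ ω) ≠ ⊤ := (h Λ).ne

/-- On configurations of finite energy all terms are real, and the convention ∞ − ∞ = 0 never
enters. -/
theorem exists_localEnergy_eq_coe (hH : IsAdmissible H R) {ω : Config d} (h : ω ∈ finiteEnergy H)
    (Λ : Window d) : ∃ e b : ℝ, localEnergy H R Λ ω = e ∧ H (finRestrict Λ ω) = b ∧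
      boundaryEnergy H R Λ ω = ((e - b : ℝ) : EReal) := by
  have hsub : ∀ x y : ℝ, esub x y = ((x - y : ℝ) : EReal) := fun x y => by
    rw [esub, if_neg (by simp), EReal.coe_sub]
  have hreal : ∀ V : Window d, ∃ x : ℝ, H (finRestrict V ω) = x := fun V =>
    ⟨_, (EReal.coe_toReal (h V).ne (hH.ne_bot _)).symm⟩
  obtain ⟨x, hx⟩ := hreal (Λ.thicken R)
  obtain ⟨y, hy⟩ := hreal ((Λ.thicken R).diff Λ)
  obtain ⟨b, hb⟩ := hreal Λ
  have he : localEnergy H R Λ ω = ((x - y : ℝ) : EReal) := by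
    rw [localEnergy, energyDiff, hx, hy, hsub]
  exact ⟨x - y, b, he, hb, by rw [boundaryEnergy, he, hb, hsub]⟩

/-- The random variable whose mean under a Gibbs measure is at most one. -/
def _root_.GibbsPP.gibbsRatio (H : Energy d) (R : ℝ) (Λ : Window d) (F : Config d → ℝ) (c : ℝ)
    (ω : Config d) : ℝ≥0∞ :=
  ENNReal.ofReal (Real.exp (F (restrict Λ.1 ω) - c)) / localDensity H R Λ ω

theorem measurable_gibbsRatio (hH : IsAdmissible H R) (Λ : Window d) {F : Config d → ℝ}
    (hF : Measurable F) (c : ℝ) : Measurable (gibbsRatio H R Λ F c) :=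
  ((hF.comp (measurable_restrict Λ.2.1)).sub_const c).exp.ennreal_ofReal.div
    (measurable_localDensity hH.meas R Λ)

/-- Resampling multiplies the ratio by the local density and leaves at most e^{F − c}, whose Poisson
mean is one. Loss occurs where the density is 0 or ∞, hence an inequality. -/
theorem lintegral_gibbsRatio_le (hH : IsAdmissible H R) {P : Measure (Config d)}
    (hP : IsGibbs H R P) (Λ : Window d) {F : Config d → ℝ} (hF : Measurable F)
    (hint : Integrable (fun ω => Real.exp (F ω)) (poisson Λ)) :
    ∫⁻ ω, gibbsRatio H R Λ F (Real.log (∫ ω, Real.exp (F ω) ∂(poisson Λ))) ω ∂P ≤ 1 := by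
  have := hP.prob
  set c := Real.log (∫ ω, Real.exp (F ω) ∂(poisson Λ)) with hc
  have hpos : 0 < ∫ ω, Real.exp (F ω) ∂(poisson Λ) := integral_exp_pos hint
  conv_lhs => rw [← hH.resample_eq_of_isGibbs hP Λ]
  rw [hH.lintegral_resample Λ (hH.measurable_gibbsRatio Λ hF c)]
  have hinner : ∀ ω, ∫⁻ η, gibbsRatio H R Λ F c (glue Λ η ω) *
      localDensity H R Λ (glue Λ η ω) ∂(poisson Λ) ≤ 1 := by
    intro ω
    calc ∫⁻ η, gibbsRatio H R Λ F c (glue Λ η ω) * localDensity H R Λ (glue Λ η ω) ∂(poisson Λ)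
        ≤ ∫⁻ η, ENNReal.ofReal (Real.exp (F η) * Real.exp (-c)) ∂(poisson Λ) := by
          refine lintegral_mono_ae ?_
          filter_upwards [ae_poisson_subset Λ] with η hη
          rw [gibbsRatio, restrict_glue_of_subset subset_rfl, restrict_of_subset hη,
            ← Real.exp_add, ← sub_eq_add_neg]
          rw [div_eq_mul_inv, mul_assoc]
          exact mul_le_of_le_one_right zero_le (ENNReal.inv_mul_le_one _)
      _ = 1 := by
          rw [← ofReal_integral_eq_lintegral_ofReal (hint.mul_const _)
            (ae_of_all _ fun _ => by positivity), integral_mul_const, Real.exp_neg, hc,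
            Real.exp_log hpos, mul_inv_cancel₀ hpos.ne', ENNReal.ofReal_one]
  refine (lintegral_mono hinner).trans ?_
  simp

theorem toReal_gibbsRatio (hH : IsAdmissible H R) {ω : Config d} (h : ω ∈ finiteEnergy H)
    (Λ : Window d) (F : Config d → ℝ) (c : ℝ) {e : ℝ} (he : localEnergy H R Λ ω = e) :
    (gibbsRatio H R Λ F c ω).toReal =
      Real.exp (F (restrict Λ.1 ω) - c + e + Real.log (partitionFn H R Λ ω).toReal) := by
  have hr := hH.finiteEnergy_restrict h Λ.1ᶜ
  have hZ : 0 < (partitionFn H R Λ ω).toReal :=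
    ENNReal.toReal_pos (hH.partitionFn_ne_zero hr) (hH.partitionFn_ne_top hr)
  rw [gibbsRatio, localDensity, he, ← EReal.coe_neg, EReal.exp_coe, ENNReal.toReal_div,
    ENNReal.toReal_div, ENNReal.toReal_ofReal (Real.exp_pos _).le,
    ENNReal.toReal_ofReal (Real.exp_pos _).le, Real.exp_add, Real.exp_add, Real.exp_log hZ,
    Real.exp_neg]
  field_simp

theorem log_partitionFn_ge (hH : IsAdmissible H R) {B Λ : Window d}
    (hB : (B.thicken R).1 ⊆ Λ.1) {ω : Config d} (hω : ω ∈ finiteEnergy H) :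
    Real.log (freeZ H B).toReal - vol Λ ≤ Real.log (partitionFn H R Λ ω).toReal := by
  have hr := hH.finiteEnergy_restrict hω Λ.1ᶜ
  have hZt := hH.partitionFn_ne_top hr
  have hZ : 0 < (partitionFn H R Λ ω).toReal :=
    ENNReal.toReal_pos (hH.partitionFn_ne_zero hr) hZt
  have h1 := hH.log_freeZ_mono (hH.freeZ_le_partitionFn hB hr)
    (ENNReal.mul_ne_top ENNReal.ofReal_ne_top hZt)
  rw [ENNReal.toReal_mul, ENNReal.toReal_ofReal (Real.exp_pos _).le,
    Real.log_mul (Real.exp_pos _).ne' hZ.ne', Real.log_exp] at h1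
  linarith

theorem lintegral_negPart_ne_top (hH : IsAdmissible H R) {P : Measure (Config d)}
    (hP : IsStationaryFI P) {n : ℕ} (hn : 0 < n) :
    ∫⁻ ω, (-H (finRestrict (cube d n) ω)).toENNReal ∂P ≠ ⊤ := by
  obtain ⟨C, -, hC⟩ := hH.exists_lintegral_negPart_le hP
  exact ((hC n hn).trans_lt ENNReal.ofReal_lt_top).ne

theorem measurable_boundaryEnergy (hH : IsAdmissible H R) (Λ : Window d) :
    Measurable (boundaryEnergy H R Λ) := by
  have hl := measurable_localEnergy hH.meas R Λ
  have hEm := measurable_energy hH.meas Λ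
  unfold boundaryEnergy esub
  refine Measurable.ite ((hl (measurableSet_singleton _)).inter
    (hEm (measurableSet_singleton _))) measurable_const ?_
  simp only [sub_eq_add_neg]
  exact hl.add (continuous_neg.measurable.comp hEm)

/-- Upper bound for the free energy of a Gibbs measure in a finite volume. -/
theorem klDiv_add_energy_le (hH : IsAdmissible H R) {P : Measure (Config d)}
    (hP : IsStationaryFI P) (hG : IsGibbs H R P) {n : ℕ} (hn : 0 < n) {B : Window d}
    (hB : (B.thicken R).1 ⊆ (cube d n).1)
    (hb1 : ∫⁻ ω, (boundaryEnergy H R (cube d n) ω).toENNReal ∂P ≠ ⊤)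
    (hb2 : ∫⁻ ω, (-boundaryEnergy H R (cube d n) ω).toENNReal ∂P ≠ ⊤) :
    InformationTheory.klDiv (cubeLaw P n) (poisson (cube d n)) ≠ ⊤ ∧
    ∫⁻ ω, (H (finRestrict (cube d n) ω)).toENNReal ∂P ≠ ⊤ ∧
    (InformationTheory.klDiv (cubeLaw P n) (poisson (cube d n))).toReal +
      ∫ ω, (H (finRestrict (cube d n) ω)).toReal ∂P ≤
        -∫ ω, (boundaryEnergy H R (cube d n) ω).toReal ∂P -
          (Real.log (freeZ H B).toReal - vol (cube d n)) := by
  have hPp := hP.prob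
  have hcl := isProbabilityMeasure_cubeLaw hP n
  set Λ := cube d n with hΛ
  have hEm := measurable_energy hH.meas Λ
  obtain ⟨-, hDint, -⟩ := eintegral_eq_integral (hH.measurable_boundaryEnergy Λ) hb1 hb2
  set D : Config d → ℝ := fun ω => (boundaryEnergy H R Λ ω).toReal with hD
  set E : Config d → ℝ := fun ω => (H (finRestrict Λ ω)).toReal with hE
  set K := Real.log (freeZ H B).toReal - vol Λ with hK
  -- This is x + 1 ≤ e^x for x = F − c + H_Λ + log Z_Λ(ω), with H_Λ split as D + E and log Z_Λ(ω)
  -- bounded below by K.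
  have hmain : ∀ (F : Config d → ℝ) (c : ℝ), ∀ᵐ ω ∂P,
      F (restrict Λ.1 ω) - c + D ω + E ω + K ≤ (gibbsRatio H R Λ F c ω).toReal - 1 := by
    intro F c
    filter_upwards [hG.finite] with ω hω
    obtain ⟨e, b, he, hb, hbd⟩ := hH.exists_localEnergy_eq_coe hω Λ
    have h1 := hH.log_partitionFn_ge hB hω
    simp only [hD, hE, hb, hbd, EReal.toReal_coe]
    rw [hH.toReal_gibbsRatio hω Λ F c he]
    have h2 := Real.add_one_le_exp
      (F (restrict Λ.1 ω) - c + e + Real.log (partitionFn H R Λ ω).toReal)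
    linarith
  have hneg : ∫⁻ ω, (-H (finRestrict Λ ω)).toENNReal ∂P ≠ ⊤ :=
    hH.lintegral_negPart_ne_top hP hn
  -- With F = 0 and c = 0, the pointwise bound dominates the energy by an integrable function.
  have hpos : ∫⁻ ω, (H (finRestrict Λ ω)).toENNReal ∂P ≠ ⊤ := by
    have hY1 := hH.lintegral_gibbsRatio_le hG Λ (F := fun _ => 0) measurable_const
      (integrable_const _)
    simp only [Real.exp_zero, integral_const, probReal_univ, smul_eq_mul, mul_one,
      Real.log_one] at hY1
    have hYint := integrable_toReal_of_lintegral_ne_top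
      (hH.measurable_gibbsRatio Λ (F := fun _ => 0) measurable_const 0).aemeasurable
      (hY1.trans_lt ENNReal.one_lt_top).ne
    have hbound : Integrable (fun ω =>
        (gibbsRatio H R Λ (fun _ => 0) 0 ω).toReal - 1 - D ω - K) P :=
      ((hYint.sub (integrable_const 1)).sub hDint).sub (integrable_const K)
    refine (lt_of_le_of_lt (lintegral_mono_ae ?_) hbound.lintegral_lt_top).ne
    filter_upwards [hG.finite, hmain (fun _ => 0) 0] with ω hω hω'
    rw [EReal.toENNReal_of_ne_top (energy_ne_top ω hω Λ)]
    refine ENNReal.ofReal_le_ofReal ?_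
    simp only [hE] at hω'
    linarith
  obtain ⟨-, hEint, -⟩ := eintegral_eq_integral hEm hpos hneg
  have hFle : ∀ F : Config d → ℝ, Measurable F → (∃ C, ∀ ω, |F ω| ≤ C) →
      ∫ ω, F ω ∂(cubeLaw P n) - Real.log (∫ ω, Real.exp (F ω) ∂(poisson Λ)) ≤
        -∫ ω, D ω ∂P - ∫ ω, E ω ∂P - K := by
    rintro F hF ⟨C, hC⟩
    set c := Real.log (∫ ω, Real.exp (F ω) ∂(poisson Λ)) with hc
    have hexp : Integrable (fun ω => Real.exp (F ω)) (poisson Λ) :=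
      Integrable.of_bound hF.exp.aestronglyMeasurable (Real.exp C) (ae_of_all _ fun ω => by
        rw [Real.norm_eq_abs, Real.abs_exp]
        exact Real.exp_le_exp.2 ((le_abs_self _).trans (hC ω)))
    have hFm : Measurable fun ω => F (restrict Λ.1 ω) := hF.comp (measurable_restrict Λ.2.1)
    have hFint : Integrable (fun ω => F (restrict Λ.1 ω)) P :=
      Integrable.of_bound hFm.aestronglyMeasurable C (ae_of_all _ fun ω => hC _)
    have i1 : Integrable (fun ω => F (restrict Λ.1 ω) - c) P := hFint.sub (integrable_const c)
    have i2 : Integrable (fun ω => F (restrict Λ.1 ω) - c + D ω) P := i1.add hDint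
    have i3 : Integrable (fun ω => F (restrict Λ.1 ω) - c + D ω + E ω) P := i2.add hEint
    have h1 := integral_nonpos_of_le_sub_one
      (hH.measurable_gibbsRatio Λ hF c).aemeasurable
      (hH.lintegral_gibbsRatio_le hG Λ hF hexp) (i3.add (integrable_const K)) (hmain F c)
    have h2 : ∫ ω, (F (restrict Λ.1 ω) - c + D ω + E ω + K) ∂P =
        ∫ ω, F (restrict Λ.1 ω) ∂P - c + ∫ ω, D ω ∂P + ∫ ω, E ω ∂P + K := by
      rw [integral_add i3 (integrable_const K), integral_add i2 hEint, integral_add i1 hDint,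
        integral_sub hFint (integrable_const c)]
      simp [D, E]
    have h3 : ∫ ω, F ω ∂(cubeLaw P n) = ∫ ω, F (restrict Λ.1 ω) ∂P :=
      integral_map (measurable_restrict Λ.2.1).aemeasurable hF.aestronglyMeasurable
    simp only [Pi.add_apply] at h1
    rw [h2] at h1
    rw [h3]
    linarith
  set M := -∫ ω, D ω ∂P - ∫ ω, E ω ∂P - K with hM
  have hM0 : 0 ≤ M := by
    have := hFle (fun _ => 0) measurable_const ⟨0, by simp⟩
    simpa using this
  have hkl : InformationTheory.klDiv (cubeLaw P n) (poisson Λ) ≤ ENNReal.ofReal M := by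
    by_contra! hlt
    obtain ⟨c, -, hc1, hc2⟩ := ENNReal.lt_iff_exists_real_btwn.1 hlt
    obtain ⟨F, hF, hFb, hcF⟩ := exists_bounded_of_lt_klDiv hc2
    have h1 := hFle F hF hFb
    have h2 := (ENNReal.ofReal_lt_ofReal_iff'.1 hc1).1
    linarith
  refine ⟨(hkl.trans_lt ENNReal.ofReal_lt_top).ne, hpos, ?_⟩
  have h1 := ENNReal.toReal_mono ENNReal.ofReal_ne_top hkl
  rw [ENNReal.toReal_ofReal hM0] at h1
  linarith

end IsAdmissible

theorem tendsto_vol_cube_sub_div (d r : ℕ) :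
    Tendsto (fun n : ℕ => vol (cube d (n - r)) / vol (cube d n)) atTop (𝓝 1) := by
  have h1 : Tendsto (fun n : ℕ => (1 : ℝ) - (r : ℝ) / n) atTop (𝓝 (1 - 0)) :=
    (tendsto_const_div_atTop_nhds_zero_nat _).const_sub 1
  have h2 := h1.pow d
  rw [sub_zero, one_pow] at h2
  refine h2.congr' ?_
  filter_upwards [eventually_gt_atTop r] with n hn
  have hn' : (0 : ℝ) < n := by exact_mod_cast (Nat.zero_le r).trans_lt hn
  rw [vol_cube, vol_cube, ← div_pow, Nat.cast_sub hn.le]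
  congr 1
  field_simp

/-- Shrinking the cube by a fixed margin does not change limits per volume. -/
theorem tendsto_div_vol_sub {a : ℕ → ℝ} {L : ℝ} (r : ℕ)
    (h : Tendsto (fun n => a n / vol (cube d n)) atTop (𝓝 L)) :
    Tendsto (fun n => a (n - r) / vol (cube d n)) atTop (𝓝 L) := by
  have h1 := (h.comp (tendsto_sub_atTop_nat r)).mul (tendsto_vol_cube_sub_div d r)
  rw [mul_one] at h1
  refine h1.congr' ?_
  filter_upwards [eventually_gt_atTop r] with n hn
  have hv := (vol_cube_pos d (Nat.sub_pos_of_lt hn)).ne'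
  simp only [Function.comp_apply]
  field_simp

namespace IsAdmissible

variable {H : Energy d} {R : ℝ}

theorem variational_le (hH : IsAdmissible H R) {P : Measure (Config d)} (hP : IsStationaryFI P)
    {n : ℕ} (hkl : InformationTheory.klDiv (cubeLaw P n) (poisson (cube d n)) ≠ ⊤)
    (h1 : ∫⁻ ω, (H (finRestrict (cube d n) ω)).toENNReal ∂P ≠ ⊤)
    (h2 : ∫⁻ ω, (-H (finRestrict (cube d n) ω)).toENNReal ∂P ≠ ⊤) :
    -Real.log (∫⁻ ω, boltz H (cube d n) ω ∂(poisson (cube d n))).toReal ≤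
      (InformationTheory.klDiv (cubeLaw P n) (poisson (cube d n))).toReal +
        ∫ ω, (H (finRestrict (cube d n) ω)).toReal ∂P := by
  -- With no blocks and u = 1, the entropy gap reduces to the plain inequality.
  have h := hH.block_mul_integral_log_le hP (m := 0) (g := 1) (q := 0) one_pos (by lia)
    (Λ := emptyWindow d) (by simp [emptyWindow, Window.thicken]) (u := fun _ => 1)
    measurable_const (fun _ => rfl) (fun _ => by norm_num) (fun _ => by norm_num)
    (fun ξ _ => by simp [partitionFn]) hkl h1 h2
  simp only [Real.log_one, integral_zero, mul_zero] at h
  linarith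

end IsAdmissible

end GibbsBound

section VariationalPrinciple

variable {d : ℕ}

/-! ### The variational principle -/

theorem eventually_ne_top_of_div_vol {a : ℕ → EReal} {x : EReal} (hx : x ≠ ⊤)
    (h : Tendsto (fun n => a n / (vol (cube d n) : EReal)) atTop (𝓝 x)) :
    ∀ᶠ n in atTop, a n ≠ ⊤ := by
  filter_upwards [h.eventually_ne hx, eventually_gt_atTop 0] with n hn hn0 ha
  exact hn (by rw [ha, EReal.top_div_of_pos_ne_top (by exact_mod_cast vol_cube_pos d hn0)
    (EReal.coe_ne_top _)])

theorem eventually_ne_bot_of_div_vol {a : ℕ → EReal} {x : EReal} (hx : x ≠ ⊥)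
    (h : Tendsto (fun n => a n / (vol (cube d n) : EReal)) atTop (𝓝 x)) :
    ∀ᶠ n in atTop, a n ≠ ⊥ := by
  filter_upwards [h.eventually_ne hx, eventually_gt_atTop 0] with n hn hn0 ha
  exact hn (by rw [ha, EReal.bot_div_of_pos_ne_top (by exact_mod_cast vol_cube_pos d hn0)
    (EReal.coe_ne_top _)])

/-- The free energy per volume of `P` in the cube `[-n, n]^d`. -/
def freeEnergy (H : Energy d) (P : Measure (Config d)) (n : ℕ) : EReal :=
  ((InformationTheory.klDiv (cubeLaw P n) (poisson (cube d n)) : ℝ≥0∞) : EReal) /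
      (vol (cube d n) : EReal) +
    eintegral P (fun ω => H (finRestrict (cube d n) ω)) / (vol (cube d n) : EReal)

theorem freeEnergy_eq_coe {H : Energy d} (hH : Measurable H) {P : Measure (Config d)} {n : ℕ}
    (hkl : InformationTheory.klDiv (cubeLaw P n) (poisson (cube d n)) ≠ ⊤)
    (h1 : ∫⁻ ω, (H (finRestrict (cube d n) ω)).toENNReal ∂P ≠ ⊤)
    (h2 : ∫⁻ ω, (-H (finRestrict (cube d n) ω)).toENNReal ∂P ≠ ⊤) :
    freeEnergy H P n =
      ((((InformationTheory.klDiv (cubeLaw P n) (poisson (cube d n))).toReal +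
        ∫ ω, (H (finRestrict (cube d n) ω)).toReal ∂P) / vol (cube d n) : ℝ) : EReal) := by
  rw [freeEnergy, (eintegral_eq_integral (measurable_energy hH _) h1 h2).2.2,
    ← EReal.coe_ennreal_toReal hkl, ← EReal.coe_div, ← EReal.coe_div, ← EReal.coe_add, add_div]

/-- Addition of extended reals is continuous away from ∞ − ∞, which the two hypotheses exclude. -/
theorem tendsto_freeEnergy {H : Energy d} {P : Measure (Config d)} {I h : EReal} (hI : I ≠ ⊥)
    (hh : h ≠ ⊥) (hIP : HasSpecificEntropy P I) (hhP : HasMeanEnergy H P h) :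
    Tendsto (freeEnergy H P) atTop (𝓝 (I + h)) :=
  (EReal.continuousAt_add (p := (I, h)) (Or.inr hh) (Or.inl hI)).tendsto.comp
    (hIP.prodMk_nhds hhP)

namespace IsAdmissible

variable {H : Energy d} {R : ℝ}

theorem tendsto_log_lintegral_boltz (hH : IsAdmissible H R) {L : ℝ}
    (hL : Tendsto (fun n : ℕ => Real.log (freeZ H (cube d n)).toReal / vol (cube d n)) atTop
      (𝓝 L)) :
    Tendsto (fun n : ℕ => Real.log (∫⁻ ω, boltz H (cube d n) ω ∂(poisson (cube d n))).toReal /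
      vol (cube d n)) atTop (𝓝 (L - 1)) := by
  refine (hL.sub_const 1).congr' ?_
  filter_upwards [eventually_gt_atTop 0] with n hn
  rw [hH.log_lintegral_boltz, sub_div, div_self (vol_cube_pos d hn).ne']

/-- If energy or entropy is infinite, the right side is ⊤, as neither term can be ⊥. -/
theorem neg_log_le_freeEnergy (hH : IsAdmissible H R) {P : Measure (Config d)}
    (hP : IsStationaryFI P) {n : ℕ} (hn : 0 < n) :
    ((-(Real.log (∫⁻ ω, boltz H (cube d n) ω ∂(poisson (cube d n))).toReal /
      vol (cube d n)) : ℝ) : EReal) ≤ freeEnergy H P n := by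
  have hv := vol_cube_pos d hn
  have hv' : (0 : EReal) < (vol (cube d n) : EReal) := by exact_mod_cast hv
  have h2 := hH.lintegral_negPart_ne_top hP hn
  by_cases h1 : ∫⁻ ω, (H (finRestrict (cube d n) ω)).toENNReal ∂P = ⊤
  · rw [freeEnergy, eintegral, h1, ← EReal.coe_ennreal_toReal h2, EReal.coe_ennreal_top,
      EReal.top_sub_coe, EReal.top_div_of_pos_ne_top hv' (EReal.coe_ne_top _),
      ← ereal_coe_div hv, EReal.add_top_of_ne_bot (EReal.coe_ennreal_ne_bot _)]
    exact le_top
  by_cases hkl : InformationTheory.klDiv (cubeLaw P n) (poisson (cube d n)) = ⊤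
  · rw [freeEnergy, hkl, EReal.coe_ennreal_top, EReal.top_div_of_pos_ne_top hv'
      (EReal.coe_ne_top _), (eintegral_eq_integral (measurable_energy hH.meas _) h1 h2).2.2,
      ← EReal.coe_div, EReal.top_add_coe]
    exact le_top
  rw [freeEnergy_eq_coe hH.meas hkl h1 h2, EReal.coe_le_coe_iff, ← neg_div]
  exact div_le_div_of_nonneg_right (hH.variational_le hP hkl h1 h2) hv.le

theorem neg_pressure_le (hH : IsAdmissible H R) {L : ℝ}
    (hL : Tendsto (fun n : ℕ => Real.log (freeZ H (cube d n)).toReal / vol (cube d n)) atTop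
      (𝓝 L)) {P : Measure (Config d)} (hP : IsStationaryFI P) {x : EReal}
    (hx : Tendsto (freeEnergy H P) atTop (𝓝 x)) : ((-(L - 1) : ℝ) : EReal) ≤ x := by
  refine le_of_tendsto_of_tendsto
    (EReal.tendsto_coe.2 (hH.tendsto_log_lintegral_boltz hL).neg) hx ?_
  filter_upwards [eventually_gt_atTop 0] with n hn
  exact hH.neg_log_le_freeEnergy hP hn

/-- Minimizers of the free energy are Gibbs measures. -/
theorem isGibbs_of_tendsto_freeEnergy (hH : IsAdmissible H R) {L : ℝ}
    (hL : Tendsto (fun n : ℕ => Real.log (freeZ H (cube d n)).toReal / vol (cube d n)) atTop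
      (𝓝 L)) {P : Measure (Config d)} (hP : IsStationaryFI P) {I h : EReal}
    (hIP : HasSpecificEntropy P I) (hhP : HasMeanEnergy H P h) (hI : 0 ≤ I)
    (heq : I + h = ((-(L - 1) : ℝ) : EReal)) : IsGibbs H R P := by
  have hIb : I ≠ ⊥ := fun h => by simp [h] at hI
  have hhb := hH.meanEnergy_ne_bot hP hhP
  have hIt : I ≠ ⊤ := by
    rintro rfl
    rw [EReal.top_add_of_ne_bot hhb] at heq
    exact EReal.coe_ne_top _ heq.symm
  have hht : h ≠ ⊤ := by
    rintro rfl
    rw [EReal.add_top_of_ne_bot hIb] at heq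
    exact EReal.coe_ne_top _ heq.symm
  have hfin : ∀ᶠ n : ℕ in atTop,
      InformationTheory.klDiv (cubeLaw P n) (poisson (cube d n)) ≠ ⊤ ∧
      ∫⁻ ω, (H (finRestrict (cube d n) ω)).toENNReal ∂P ≠ ⊤ ∧
      ∫⁻ ω, (-H (finRestrict (cube d n) ω)).toENNReal ∂P ≠ ⊤ := by
    filter_upwards [eventually_ne_top_of_div_vol hIt hIP, eventually_ne_top_of_div_vol hht hhP,
      eventually_ne_bot_of_div_vol hhb hhP] with n h1 h2 h3
    exact ⟨fun h => h1 (by rw [h]; rfl), lintegral_ne_top_of_eintegral h2 h3⟩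
  refine hH.isGibbs_of_limit hP hfin ?_
  have hF := tendsto_freeEnergy hIb hhb hIP hhP
  rw [heq] at hF
  have hF' : Tendsto (fun n : ℕ =>
      ((InformationTheory.klDiv (cubeLaw P n) (poisson (cube d n))).toReal +
        ∫ ω, (H (finRestrict (cube d n) ω)).toReal ∂P) / vol (cube d n)) atTop
      (𝓝 (-(L - 1))) := by
    refine EReal.tendsto_coe.1 (hF.congr' ?_)
    filter_upwards [hfin] with n hn
    exact freeEnergy_eq_coe hH.meas hn.1 hn.2.1 hn.2.2
  have h := hF'.add (hH.tendsto_log_lintegral_boltz hL)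
  rw [neg_add_cancel] at h
  exact h.congr fun n => (add_div _ _ _).symm

/-- Gibbs measures minimize the free energy. -/
theorem le_neg_pressure_of_isGibbs (hH : IsAdmissible H R) {L : ℝ}
    (hL : Tendsto (fun n : ℕ => Real.log (freeZ H (cube d n)).toReal / vol (cube d n)) atTop
      (𝓝 L)) {P : Measure (Config d)} (hP : IsStationaryFI P) (hG : IsGibbs H R P)
    (hb : HasNegligibleBoundary H R P) {x : EReal}
    (hx : Tendsto (freeEnergy H P) atTop (𝓝 x)) : x ≤ ((-(L - 1) : ℝ) : EReal) := by
  -- The cube of half-side n − r, thickened by R, stays inside the cube of half-side n and serves as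
  -- inner window B.
  obtain ⟨r, hr⟩ := exists_nat_gt R
  have hfin : ∀ᶠ n : ℕ in atTop,
      ∫⁻ ω, (boundaryEnergy H R (cube d n) ω).toENNReal ∂P ≠ ⊤ ∧
      ∫⁻ ω, (-boundaryEnergy H R (cube d n) ω).toENNReal ∂P ≠ ⊤ := by
    filter_upwards [eventually_ne_top_of_div_vol EReal.zero_ne_top hb,
      eventually_ne_bot_of_div_vol EReal.zero_ne_bot hb] with n h1 h2
    exact lintegral_ne_top_of_eintegral h1 h2
  have hD : Tendsto (fun n : ℕ =>
      (∫ ω, (boundaryEnergy H R (cube d n) ω).toReal ∂P) / vol (cube d n)) atTop (𝓝 0) := by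
    refine EReal.tendsto_coe.1 (Tendsto.congr' ?_ hb)
    filter_upwards [hfin] with n hn
    rw [(eintegral_eq_integral (hH.measurable_boundaryEnergy _) hn.1 hn.2).2.2, EReal.coe_div]
  have hlim := hD.neg.sub ((tendsto_div_vol_sub r hL).sub_const 1)
  rw [neg_zero, zero_sub] at hlim
  refine le_of_tendsto_of_tendsto hx (EReal.tendsto_coe.2 hlim) ?_
  filter_upwards [hfin, eventually_gt_atTop 0, eventually_ge_atTop r] with n hn hn0 hnr
  have hv := vol_cube_pos d hn0
  have hB : ((cube d (n - r)).thicken R).1 ⊆ (cube d n).1 := by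
    have := thicken_cube_subset (d := d) (n - r) r hH.range_nonneg hr
    rwa [Nat.sub_add_cancel hnr] at this
  obtain ⟨h1, h2, h3⟩ := hH.klDiv_add_energy_le hP hG hn0 hB hn.1 hn.2
  rw [freeEnergy_eq_coe hH.meas h1 h2 (hH.lintegral_negPart_ne_top hP hn0),
    EReal.coe_le_coe_iff]
  refine (div_le_div_of_nonneg_right h3 hv.le).trans (le_of_eq ?_)
  field_simp

end IsAdmissible

end VariationalPrinciple

end GibbsPP

end

theorem theorem1 (d : ℕ) (hd : 1 ≤ d) (H : Energy d) (hmeas : Measurable H)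
    (hbot : ∀ ω, H ω ≠ ⊥) (hstat : IsStationaryEnergy H) (hher : IsHereditary H)
    (hnd : IsNonDegenerate H) (hstable : IsStable H)
    (R : ℝ) (hR : 0 ≤ R) (hrange : HasRange H R)
    (hmean : ∀ P : Measure (Config d), IsStationaryFI P → ∃ h : EReal, HasMeanEnergy H P h)
    (hbdry : ∀ P : Measure (Config d), IsStationaryFI P → IsGibbs H R P →
      HasNegligibleBoundary H R P) :
    ∃ p : ℝ, HasPressure H R p ∧
      ∀ P : Measure (Config d), IsStationaryFI P →
        ∃ I h : EReal, HasSpecificEntropy P I ∧ HasMeanEnergy H P h ∧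
          -(p : EReal) ≤ I + h ∧ (I + h = -(p : EReal) ↔ IsGibbs H R P) := by
  have hH : IsAdmissible H R := ⟨hmeas, hstat, hher, hnd, hstable, hR, hrange⟩
  obtain ⟨L, hL⟩ := hH.exists_tendsto_log_freeZ
  refine ⟨L - 1, hH.hasPressure hL, fun P hP => ?_⟩
  obtain ⟨I, hI, hIP⟩ := exists_hasSpecificEntropy hP
  obtain ⟨h, hhP⟩ := hmean P hP
  have hIb : I ≠ ⊥ := fun h => by simp [h] at hI
  have hF := tendsto_freeEnergy hIb (hH.meanEnergy_ne_bot hP hhP) hIP hhP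
  have hge := hH.neg_pressure_le hL hP hF
  rw [← EReal.coe_neg]
  exact ⟨I, h, hIP, hhP, hge, fun heq => hH.isGibbs_of_tendsto_freeEnergy hL hP hIP hhP hI heq,
    fun hG => le_antisymm (hH.le_neg_pressure_of_isGibbs hL hP hG (hbdry P hP hG) hF) hge⟩
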